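/- Work over $\mathbb{C}$. For integers $d_1,d_2\ge 1$ let $\Sigma_{d_1,d_2}\subset\mathbb{P}^{d_1+d_2+1}$ be the rational normal scroll, i.e. the Zariski closure of the image of $(\mathbb{C}^*)^2$ under $(s,t)\mapsto(1:t:\dots:t^{d_2}:s:st:\dots:st^{d_1})$; for $t\in\mathbb{P}^1=\mathbb{C}\cup\{\infty\}$ let $L_t\subset\Sigma_{d_1,d_2}$ be its line over the parameter $t$. A linear projection $\alpha$ from $\Sigma_{d_1,d_2}$ to $\mathbb{P}^4$ is encoded by two vectors of polynomials $Q_1,Q_2\in\mathbb{C}[t]^5$ with entries of degree at most $d_1$, respectively $d_2$, such that $\alpha$ sends the point with parameters $(s,t)$ to $Q_2(t)+s\,Q_1(t)$. A surface $S\subset\mathbb{P}^3$ is called good if each of its points has, in suitable local analytic coordinates $(x,y,z)$ of $\mathbb{P}^3$ centered at the point, one of the local equations $x=0$ (smooth point), $xy=0$ (self-intersection), $xyz=0$ (triple point), $x^2-y^2z=0$ (pinch point), and if the singular locus of $S$ is irreducible (or empty). A line contained in a surface $T$, but not in the singular locus of $T$, is called torsal if the tangent planes of $T$ at all smooth points of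 $T$ on the line are equal. A projection is singular at a point $P'$ of $\Sigma_{d_1,d_2}$ if its differential at $P'$ is not injective on the tangent space of $\Sigma_{d_1,d_2}$. **Lemma.** Let $\alpha\colon\Sigma_{d_1,d_2}\to\mathbb{P}^4$ be a linear projection and $\pi\colon\mathbb{P}^4\dashrightarrow\mathbb{P}^3$ a linear projection such that $\beta=\pi\circ\alpha$ is defined at all points of $\Sigma_{d_1,d_2}$, is birational onto its image, and has as image a good (rational ruled) surface in $\mathbb{P}^3$. Let $P'\in\Sigma_{d_1,d_2}$ be a point at which $\alpha$ is singular, and let $L_{t_0}$ be the line of $\Sigma_{d_1,d_2}$ through $P'$. Then $\alpha(P')$ lies on a torsal line of the surface $\alpha(\Sigma_{d_1,d_2})\subset\mathbb{P}^4$, namely on $\alpha(L_{t_0})$, and the $5\times4$ matrix $$\bigl(\,Q_1(t_0)\mid Q_2(t_0)\mid Q_1'(t_0)\mid Q_2'(t_0)\,\bigr)$$ has rank exactly $3$. (If $t_0=\infty$, the matrix is formed with the polynomials $u^{d_1}Q_1(1/u)$, $u^{d_2}Q_2(1/u)$ in the local parameter $u=1/t$, at $u=0$.) -/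

import Mathlib

open scoped Topology Polynomial LinearAlgebra.Projectivization OnePoint

noncomputable section

/-! Projective varieties are treated as sets of complex points of `ℙ ℂ (ι → ℂ)`. -/

namespace RuledSurface

section ProjectiveSets

variable {ι κ : Type} [Fintype ι] [Fintype κ]

/-- The polynomial `f` vanishes at (all representatives of) the projective point `p`. -/
def VanishesAt (f : MvPolynomial ι ℂ) (p : ℙ ℂ (ι → ℂ)) : Prop :=
  ∀ v ∈ p.submodule, MvPolynomial.eval v f = 0

/-- The Zariski closure of a set of points of a projective space: the common zeros of all
homogeneous polynomials that vanish on the set. -/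
def zariskiClosure (X : Set (ℙ ℂ (ι → ℂ))) : Set (ℙ ℂ (ι → ℂ)) :=
  {p | ∀ (f : MvPolynomial ι ℂ) (n : ℕ), f.IsHomogeneous n →
    (∀ q ∈ X, VanishesAt f q) → VanishesAt f p}

/-- Zariski closed subsets of a projective space. -/
def IsZariskiClosed (X : Set (ℙ ℂ (ι → ℂ))) : Prop :=
  zariskiClosure X = X

/-- The punctured affine cone over a subset of a projective space. -/
def cone (X : Set (ℙ ℂ (ι → ℂ))) : Set (ι → ℂ) :=
  {w | ∃ hw : w ≠ 0, Projectivization.mk ℂ w hw ∈ X}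

/-- `p` is a smooth point of the surface `X` and `W` is the (projective) tangent plane of `X` at
`p`, given as a three-dimensional linear subspace: near some representative `v` of `p`, the
affine cone over `X` is the zero set of an analytic submersion whose differential at `v` has
kernel `W`. -/
def HasTangentPlane (X : Set (ℙ ℂ (ι → ℂ))) (p : ℙ ℂ (ι → ℂ))
    (W : Submodule ℂ (ι → ℂ)) : Prop :=
  Module.finrank ℂ W = 3 ∧
  ∃ v ∈ p.submodule, v ≠ 0 ∧ ∃ (k : ℕ) (F : (ι → ℂ) → (Fin k → ℂ)),
    AnalyticAt ℂ F v ∧ F v = 0 ∧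
    Function.Surjective (fderiv ℂ F v) ∧
    LinearMap.ker (fderiv ℂ F v : (ι → ℂ) →ₗ[ℂ] (Fin k → ℂ)) = W ∧
    ∀ᶠ w in 𝓝 v, w ∈ cone X ↔ F w = 0

/-- The singular locus of a surface. -/
def singularLocus (X : Set (ℙ ℂ (ι → ℂ))) : Set (ℙ ℂ (ι → ℂ)) :=
  {p | p ∈ X ∧ ¬ ∃ W, HasTangentPlane X p W}

/-- The line `ℓ` (a two-dimensional linear subspace) of the surface `X` is torsal: it is
contained in `X` but not in the singular locus of `X`, and the tangent planes of `X` at all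
smooth points of `X` on `ℓ` are equal. -/
def IsTorsalLine (X : Set (ℙ ℂ (ι → ℂ))) (ℓ : Submodule ℂ (ι → ℂ)) : Prop :=
  Module.finrank ℂ ℓ = 2 ∧
  (∀ p : ℙ ℂ (ι → ℂ), p.submodule ≤ ℓ → p ∈ X) ∧
  ∃ E : Submodule ℂ (ι → ℂ),
    (∃ p : ℙ ℂ (ι → ℂ), p.submodule ≤ ℓ ∧ HasTangentPlane X p E) ∧
    ∀ (p : ℙ ℂ (ι → ℂ)) (W : Submodule ℂ (ι → ℂ)),
      p.submodule ≤ ℓ → HasTangentPlane X p W → W = E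

/-- The linear projection induced by the linear map `L` is defined at all points of `X`, that
is, its center does not meet `X`. -/
def IsRegularOn (L : (ι → ℂ) →ₗ[ℂ] (κ → ℂ)) (X : Set (ℙ ℂ (ι → ℂ))) : Prop :=
  ∀ p ∈ X, ∀ v ∈ p.submodule, L v = 0 → v = 0

/-- The image of `X` under the linear projection induced by `L`. -/
def projImage (L : (ι → ℂ) →ₗ[ℂ] (κ → ℂ)) (X : Set (ℙ ℂ (ι → ℂ))) : Set (ℙ ℂ (κ → ℂ)) :=
  {q | ∃ p ∈ X, p.submodule.map L = q.submodule}

/-- The linear projection induced by `L` is birational from `X` onto its image: outside a Zariski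
closed set that does not contain `X`, every point of `X` is the only point in its fibre. (This
is used for irreducible `X`.) -/
def IsBirationalOn (L : (ι → ℂ) →ₗ[ℂ] (κ → ℂ)) (X : Set (ℙ ℂ (ι → ℂ))) : Prop :=
  ∃ Z : Set (ℙ ℂ (ι → ℂ)), IsZariskiClosed Z ∧ ¬ X ⊆ Z ∧
    ∀ p ∈ X, p ∉ Z → ∀ p' ∈ X, p'.submodule.map L = p.submodule.map L → p' = p

/-- The linear projection induced by `L` is singular at the smooth point `p` of the surface `X`:
its differential on the tangent space of `X` at `p` is not injective. Where the projection is
defined at `p`, this says that the tangent plane of `X` at `p` meets the center, because the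
differential at `p` is the map `W / p → (κ → ℂ) / L p` induced by `L` (up to twist). -/
def IsSingularAt (L : (ι → ℂ) →ₗ[ℂ] (κ → ℂ)) (X : Set (ℙ ℂ (ι → ℂ)))
    (p : ℙ ℂ (ι → ℂ)) : Prop :=
  ∃ W, HasTangentPlane X p W ∧ ∃ w ∈ W, w ≠ 0 ∧ L w = 0

end ProjectiveSets

section OrdinarySingularities

/-- `x` is a system of local analytic coordinates of three-dimensional projective space centered
at `p`, written as a function of homogeneous coordinates. -/
def IsLocalCoordinates (p : ℙ ℂ (Fin 4 → ℂ)) (x : (Fin 4 → ℂ) → (Fin 3 → ℂ)) : Prop :=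
  (∀ (c : ℂ) (w : Fin 4 → ℂ), c ≠ 0 → x (c • w) = x w) ∧
  ∀ v ∈ p.submodule, v ≠ 0 → AnalyticAt ℂ x v ∧ x v = 0 ∧
    LinearMap.ker (fderiv ℂ x v : (Fin 4 → ℂ) →ₗ[ℂ] (Fin 3 → ℂ)) = p.submodule

/-- In suitable local analytic coordinates centered at `p`, the set `S` has equation `f = 0`. -/
def HasLocalEquation (S : Set (ℙ ℂ (Fin 4 → ℂ))) (p : ℙ ℂ (Fin 4 → ℂ))
    (f : (Fin 3 → ℂ) → ℂ) : Prop :=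
  ∃ x, IsLocalCoordinates p x ∧
    ∀ v ∈ p.submodule, v ≠ 0 → ∀ᶠ w in 𝓝 v, w ∈ cone S ↔ f (x w) = 0

/-- A surface `S` in three-dimensional projective space is good: it has at most ordinary
singularities, that is, each of its points is smooth, a point where two smooth branches cross
transversally, a triple point where three smooth branches cross transversally, or a pinch point;
and its self-intersection curve (the singular locus) is irreducible, if not empty. -/
structure IsGood (S : Set (ℙ ℂ (Fin 4 → ℂ))) : Prop where
  ordinary : ∀ p ∈ S,
    HasLocalEquation S p (fun x => x 0) ∨
    HasLocalEquation S p (fun x => x 0 * x 1) ∨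
    HasLocalEquation S p (fun x => x 0 * x 1 * x 2) ∨
    HasLocalEquation S p (fun x => x 0 ^ 2 - x 1 ^ 2 * x 2)
  irreducible : ∀ Z₁ Z₂ : Set (ℙ ℂ (Fin 4 → ℂ)), IsZariskiClosed Z₁ → IsZariskiClosed Z₂ →
    singularLocus S ⊆ Z₁ ∪ Z₂ → singularLocus S ⊆ Z₁ ∨ singularLocus S ⊆ Z₂

end OrdinarySingularities

section Scroll

/-- Index type of the homogeneous coordinates of the projective space of dimension
`d₁ + d₂ + 1` that contains the scroll. -/
abbrev ScrollIndex (d₁ d₂ : ℕ) : Type := Fin (d₂ + 1) ⊕ Fin (d₁ + 1)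

/-- The vector `(1, t, …, t ^ d₂, s, s t, …, s t ^ d₁)`. -/
def torusVec (d₁ d₂ : ℕ) (s t : ℂ) : ScrollIndex d₁ d₂ → ℂ :=
  Sum.elim (fun j => t ^ (j : ℕ)) (fun j => s * t ^ (j : ℕ))

/-- The rational normal scroll: the Zariski closure of the image of the torus under
`(s, t) ↦ (1 : t : … : t ^ d₂ : s : s t : … : s t ^ d₁)`. -/
def scroll (d₁ d₂ : ℕ) : Set (ℙ ℂ (ScrollIndex d₁ d₂ → ℂ)) :=
  zariskiClosure {p | ∃ s t : ℂ, s ≠ 0 ∧ t ≠ 0 ∧ p.submodule = ℂ ∙ torusVec d₁ d₂ s t}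

/-- The line of the scroll over the parameter `t` of the projective line: the closure of the
points with parameters `(s, t)`, where `s` varies; at `t = ∞` the limit of these lines. -/
def ruling (d₁ d₂ : ℕ) : OnePoint ℂ → Submodule ℂ (ScrollIndex d₁ d₂ → ℂ)
  | ∞ => Submodule.span ℂ
      {Pi.single (Sum.inl (Fin.last d₂)) 1, Pi.single (Sum.inr (Fin.last d₁)) 1}
  | OnePoint.some t => Submodule.span ℂ
      {(Sum.elim (fun j => t ^ (j : ℕ)) (fun _ => 0) : ScrollIndex d₁ d₂ → ℂ),
        (Sum.elim (fun _ => 0) (fun j => t ^ (j : ℕ)) : ScrollIndex d₁ d₂ → ℂ)}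

variable {d₁ d₂ : ℕ} {n : ℕ}

/-- The vector of polynomials `Q₁` (of degree at most `d₁`) of the projection induced by `L`,
so that `L` maps `torusVec d₁ d₂ s t` to `Q₂(t) + s Q₁(t)`. -/
def polyQ₁ (L : (ScrollIndex d₁ d₂ → ℂ) →ₗ[ℂ] (Fin n → ℂ)) (i : Fin n) : ℂ[X] :=
  ∑ j : Fin (d₁ + 1), Polynomial.C (L (Pi.single (Sum.inr j) 1) i) * Polynomial.X ^ (j : ℕ)

/-- The vector of polynomials `Q₂` (of degree at most `d₂`) of the projection induced by `L`. -/
def polyQ₂ (L : (ScrollIndex d₁ d₂ → ℂ) →ₗ[ℂ] (Fin n → ℂ)) (i : Fin n) : ℂ[X] :=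
  ∑ j : Fin (d₂ + 1), Polynomial.C (L (Pi.single (Sum.inl j) 1) i) * Polynomial.X ^ (j : ℕ)

/-- The matrix `(Q₁ | Q₂ | Q₁' | Q₂')` evaluated at `t`. -/
def derivMatrix (Q₁ Q₂ : Fin n → ℂ[X]) (t : ℂ) : Matrix (Fin n) (Fin 4) ℂ :=
  Matrix.of fun i => ![(Q₁ i).eval t, (Q₂ i).eval t,
    (Polynomial.derivative (Q₁ i)).eval t, (Polynomial.derivative (Q₂ i)).eval t]

/-- The matrix `(Q₁ | Q₂ | Q₁' | Q₂')` of the projection induced by `L` at a parameter in the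
projective line. At `∞` it is formed with the local parameter `u = 1 / t`, that is, with the
polynomials `u ^ d₁ Q₁(1 / u)` and `u ^ d₂ Q₂(1 / u)` at `u = 0`. -/
def rulingMatrix (L : (ScrollIndex d₁ d₂ → ℂ) →ₗ[ℂ] (Fin n → ℂ)) :
    OnePoint ℂ → Matrix (Fin n) (Fin 4) ℂ
  | ∞ => derivMatrix (fun i => (polyQ₁ L i).reflect d₁) (fun i => (polyQ₂ L i).reflect d₂) 0
  | OnePoint.some t => derivMatrix (polyQ₁ L) (polyQ₂ L) t

end Scroll

end RuledSurface

end

/-! Write the ruling over `p + τ • r` as the image of an injective linear map `Φ τ : ℂ² → ℂ⁵`,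
depending analytically on `τ`. That α is singular at a point `y` of the ruling `τ = 0` means that
`Φ' 0 y` lies in the range of `Φ 0`, so the ruling and all its tangent directions together span at
most three dimensions. The dimension is exactly three, and the ruling is torsal, as soon as one
point `y'` of the ruling is immersed and its image lies on no other ruling. Then `y, y'` is a basis
of `ℂ²`, the tangent plane at `y'` is the full span, and continuity of the differential of a local
equation gives the same plane at every smooth point of the line, including the image of `y` if that
is smooth.

The point `y'` is found in `ℙ³`, since both of its properties lift from β to α
(`exists_immersed_point`). Three facts are needed.

A birational β is an immersion wherever its image germ lies in a smooth hypersurface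
(`immersion_of_smooth`). Otherwise the position of the rulings along a line transversal to the given
one is an analytic function `c` of `τ` with `c 0 = c' 0 = 0`. Such a function takes some value twice
near `0`, which gives a point on two rulings, immersed along one of them; that branch fills the
hypersurface, so an open set of points has a second preimage. Since analytic germs form a domain,
the germ lies in one smooth branch at smooth, double and triple points. Hence β maps `y` to a pinch
point.

The ruling through a pinch point is not contained in the double line (`exists_ne_zero_of_pinch`),
because a parity argument on vanishing orders would otherwise send all nearby rulings through the
pinch point. Nearby points of the ruling off the double line are smooth on the surface, and they
serve as `y'`.

The image of the scroll is not even locally a cone (`not_eventually_mem_range`): a common point of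
the rulings would lift to a bounded entire curve on the affine cone over the scroll, constant by
Liouville, although distinct rulings are disjoint. -/

namespace RuledSurface

open Filter

/-! ### Local analytic geometry -/

section LocalAnalytic

variable {E G : Type*} [NormedAddCommGroup E] [NormedSpace ℂ E]
  [NormedAddCommGroup G] [NormedSpace ℂ G] [FiniteDimensional ℂ G]

/-- The ring of germs of analytic functions is a domain. -/
theorem eventually_zero_or_of_mul {f g : E → ℂ} {a : E} (hf : AnalyticAt ℂ f a)
    (hg : AnalyticAt ℂ g a) (h : ∀ᶠ x in 𝓝 a, f x * g x = 0) :
    (∀ᶠ x in 𝓝 a, f x = 0) ∨ ∀ᶠ x in 𝓝 a, g x = 0 := by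
  obtain ⟨ε, hε, hball⟩ := Metric.eventually_nhds_iff_ball.1
    ((hf.eventually_analyticAt.and hg.eventually_analyticAt).and h)
  by_cases hz : ∀ x ∈ Metric.ball a ε, f x = 0
  · exact Or.inl (Metric.eventually_nhds_iff_ball.2 ⟨ε, hε, hz⟩)
  · push Not at hz
    obtain ⟨x, hx, hfx⟩ := hz
    right
    -- Near `x` the factor `f` is invertible, so `g` vanishes there; the identity theorem carries
    -- this over the ball back to `a`.
    have h1 : ∀ᶠ y in 𝓝 x, g y = 0 := by
      filter_upwards [(hball x hx).1.1.continuousAt.eventually_ne hfx,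
        Metric.isOpen_ball.mem_nhds hx] with y hy hyb
      exact (mul_eq_zero.1 (hball y hyb).2).resolve_left hy
    have h2 : AnalyticOnNhd ℂ g (Metric.ball a ε) := fun y hy => (hball y hy).1.2
    have h3 := h2.eqOn_zero_of_preconnected_of_eventuallyEq_zero
      (convex_ball a ε).isPreconnected hx h1
    exact Metric.eventually_nhds_iff_ball.2 ⟨ε, hε, h3⟩

/-- An injective linear map between finite-dimensional spaces has a continuous left inverse. -/
theorem exists_continuous_leftInverse (f : E →L[ℂ] G) (hf : Function.Injective f) :
    ∃ g : G →L[ℂ] E, ∀ x, g (f x) = x := by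
  obtain ⟨g, hg⟩ := (f : E →ₗ[ℂ] G).exists_leftInverse_of_injective (LinearMap.ker_eq_bot.2 hf)
  exact ⟨LinearMap.toContinuousLinearMap g, fun x => LinearMap.congr_fun hg x⟩

variable [FiniteDimensional ℂ E]

/-- A strictly differentiable map with injective differential is locally injective. -/
theorem exists_injOn_nhds {f : E → G} {f' : E →L[ℂ] G} {a : E} (hf : HasStrictFDerivAt f f' a)
    (hinj : Function.Injective f') : ∃ U ∈ 𝓝 a, Set.InjOn f U := by
  have : CompleteSpace E := FiniteDimensional.complete ℂ E
  obtain ⟨g, hg⟩ := exists_continuous_leftInverse f' hinj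
  have h1 : HasStrictFDerivAt (fun x => g (f x)) (g ∘L f') a := g.hasStrictFDerivAt.comp a hf
  have h2 : g ∘L f' = (ContinuousLinearEquiv.refl ℂ E : E →L[ℂ] E) := by ext x; simp [hg]
  rw [h2] at h1
  refine ⟨(h1.toOpenPartialHomeomorph _).source,
    (h1.toOpenPartialHomeomorph _).open_source.mem_nhds h1.mem_toOpenPartialHomeomorph_source, ?_⟩
  intro x hx y hy hxy
  refine (h1.toOpenPartialHomeomorph _).injOn hx hy ?_
  simp [hxy]

/-- A hypersurface which contains the image of an immersion of codimension one is locally equal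
to that image. -/
theorem eventually_mem_image_of_eq_zero {φ : E → G} {φ' : E →L[ℂ] G} {q : E}
    (hφ : HasStrictFDerivAt φ φ' q) (hinj : Function.Injective φ')
    (hdim : Module.finrank ℂ G = Module.finrank ℂ E + 1)
    {h : G → ℂ} {h' : G →L[ℂ] ℂ} (hh : HasStrictFDerivAt h h' (φ q)) (hh' : h' ≠ 0)
    (hzero : ∀ᶠ x in 𝓝 q, h (φ x) = 0) {N : Set E} (hN : N ∈ 𝓝 q) :
    ∀ᶠ w in 𝓝 (φ q), h w = 0 → w ∈ φ '' N := by
  have : CompleteSpace E := FiniteDimensional.complete ℂ E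
  have : CompleteSpace G := FiniteDimensional.complete ℂ G
  -- The retraction `M` onto `K` is a chart of the hypersurface. As `φ'` is an isomorphism onto `K`,
  -- the map `M ∘ φ` is open at `q`; as `(M, h)` is locally injective, a zero of `h` with the same
  -- `M`-value as a zero `φ x` equals `φ x`.
  set K : Submodule ℂ G := LinearMap.ker (h' : G →ₗ[ℂ] ℂ) with hK
  have : CompleteSpace K := FiniteDimensional.complete ℂ K
  obtain ⟨M, hM⟩ := exists_continuous_leftInverse K.subtypeL Subtype.val_injective
  have hcomp : ∀ x, φ' x ∈ K := by
    intro x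
    have h1 : HasFDerivAt (fun x => h (φ x)) (h' ∘L φ') q := (hh.comp q hφ).hasFDerivAt
    have h2 : HasFDerivAt (fun x => h (φ x)) (0 : E →L[ℂ] ℂ) q :=
      (hasFDerivAt_const (0 : ℂ) q).congr_of_eventuallyEq hzero
    have := ContinuousLinearMap.ext_iff.1 (h1.unique h2) x
    simpa [hK] using this
  have hMinj : ∀ x, M (φ' x) = 0 → x = 0 := by
    intro x hx
    have h1 : M (φ' x) = ⟨φ' x, hcomp x⟩ := hM ⟨φ' x, hcomp x⟩
    rw [hx] at h1
    have h2 : φ' x = 0 := (congrArg Subtype.val h1).symm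
    exact hinj (by simpa using h2)
  have hKdim : Module.finrank ℂ K = Module.finrank ℂ E := by
    have hr : LinearMap.range (h' : G →ₗ[ℂ] ℂ) = ⊤ :=
      LinearMap.range_eq_top.2 (LinearMap.surjective (by
        intro h0; exact hh' (by ext x; exact LinearMap.congr_fun h0 x)))
    have h1 : Module.finrank ℂ (LinearMap.range (h' : G →ₗ[ℂ] ℂ)) + Module.finrank ℂ K =
      Module.finrank ℂ G := LinearMap.finrank_range_add_finrank_ker (h' : G →ₗ[ℂ] ℂ)
    rw [hr, finrank_top, Module.finrank_self] at h1
    omega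
  have hinj2 : Function.Injective ((M ∘L φ' : E →L[ℂ] K) : E →ₗ[ℂ] K) :=
    (injective_iff_map_eq_zero _).2 hMinj
  have hsurj : LinearMap.range ((M ∘L φ' : E →L[ℂ] K) : E →ₗ[ℂ] K) = ⊤ :=
    LinearMap.range_eq_top.2
      ((LinearMap.injective_iff_surjective_of_finrank_eq_finrank hKdim.symm).1 hinj2)
  have hMφ : HasStrictFDerivAt (fun x => M (φ x)) (M ∘L φ') q := M.hasStrictFDerivAt.comp q hφ
  have hopen := hMφ.map_nhds_eq_of_surj hsurj
  -- `(M, h)` is locally injective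
  have hpair : HasStrictFDerivAt (fun w => (M w, h w)) (M.prod h') (φ q) :=
    M.hasStrictFDerivAt.prodMk hh
  obtain ⟨U, hU, hUinj⟩ := exists_injOn_nhds hpair (by
    refine (injective_iff_map_eq_zero _).2 fun w hw => ?_
    have h1 : M w = 0 := congrArg Prod.fst hw
    have h2 : h' w = 0 := congrArg Prod.snd hw
    have h3 : M w = ⟨w, h2⟩ := hM ⟨w, h2⟩
    rw [h1] at h3
    exact (congrArg Subtype.val h3).symm)
  have hN' : N ∩ {x | h (φ x) = 0} ∩ φ ⁻¹' U ∈ 𝓝 q :=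
    inter_mem (inter_mem hN hzero) (hφ.continuousAt.preimage_mem_nhds hU)
  have himg : (fun x => M (φ x)) '' (N ∩ {x | h (φ x) = 0} ∩ φ ⁻¹' U) ∈ 𝓝 (M (φ q)) := by
    rw [← hopen]; exact image_mem_map hN'
  filter_upwards [M.continuous.continuousAt.preimage_mem_nhds himg, hU] with w hw hwU hw0
  obtain ⟨x, ⟨⟨hxN, hx0⟩, hxU⟩, hx⟩ := hw
  refine ⟨x, hxN, hUinj hxU hwU ?_⟩
  simp only [Set.mem_ofPred_eq] at hx0
  simp [hx, hx0, hw0]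

/-- The image of an analytic immersion is locally the zero set of an analytic submersion. -/
theorem exists_submersion_of_immersion {φ : E → G} {q : E} (hφ : AnalyticAt ℂ φ q)
    (hinj : Function.Injective (fderiv ℂ φ q)) {N : Set E} (hN : N ∈ 𝓝 q) :
    ∃ (k : ℕ) (F : G → (Fin k → ℂ)), AnalyticAt ℂ F (φ q) ∧ F (φ q) = 0 ∧
      Function.Surjective (fderiv ℂ F (φ q)) ∧
      LinearMap.ker (fderiv ℂ F (φ q) : G →ₗ[ℂ] (Fin k → ℂ)) =
        LinearMap.range (fderiv ℂ φ q : E →ₗ[ℂ] G) ∧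
      (∀ᶠ w in 𝓝 (φ q), F w = 0 → w ∈ φ '' N) ∧ ∀ᶠ x in 𝓝 q, F (φ x) = 0 := by
  have : CompleteSpace E := FiniteDimensional.complete ℂ E
  have : CompleteSpace G := FiniteDimensional.complete ℂ G
  set R : Submodule ℂ G := LinearMap.range (fderiv ℂ φ q : E →ₗ[ℂ] G) with hR
  obtain ⟨C, hC⟩ := R.exists_isCompl
  set k := Module.finrank ℂ C with hk
  let eC : C ≃L[ℂ] (Fin k → ℂ) := ContinuousLinearEquiv.ofFinrankEq (by simp [hk])
  -- Thickening `φ` by a complement of its tangent space gives a local biholomorphism; `F` is the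
  -- second component of its inverse.
  let Θ : E × (Fin k → ℂ) → G := fun x => φ x.1 + (eC.symm x.2 : G)
  let Θ' : E × (Fin k → ℂ) →L[ℂ] G :=
    (fderiv ℂ φ q) ∘L ContinuousLinearMap.fst ℂ E (Fin k → ℂ) +
      (C.subtypeL ∘L (eC.symm : (Fin k → ℂ) →L[ℂ] C)) ∘L ContinuousLinearMap.snd ℂ E (Fin k → ℂ)
  have hΘan : AnalyticAt ℂ Θ (q, 0) := by
    have h1 : AnalyticAt ℂ (fun x : E × (Fin k → ℂ) => φ x.1) (q, 0) :=
      AnalyticAt.fun_comp (g := φ) (f := Prod.fst) hφ analyticAt_fst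
    exact h1.add (((C.subtypeL ∘L (eC.symm : (Fin k → ℂ) →L[ℂ] C)) ∘L
      ContinuousLinearMap.snd ℂ E (Fin k → ℂ)).analyticAt _)
  have hΘd : HasStrictFDerivAt Θ Θ' (q, 0) := by
    have h1 : HasStrictFDerivAt (fun x : E × (Fin k → ℂ) => φ x.1)
        ((fderiv ℂ φ q) ∘L ContinuousLinearMap.fst ℂ E (Fin k → ℂ)) (q, 0) :=
      HasStrictFDerivAt.comp (g := φ) (q, 0) hφ.hasStrictFDerivAt hasStrictFDerivAt_fst
    exact h1.add (((C.subtypeL ∘L (eC.symm : (Fin k → ℂ) →L[ℂ] C)) ∘L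
      ContinuousLinearMap.snd ℂ E (Fin k → ℂ)).hasStrictFDerivAt)
  have hΘ'app : ∀ x c, Θ' (x, c) = fderiv ℂ φ q x + (eC.symm c : G) := fun x c => rfl
  have hbij : Function.Bijective Θ' := by
    constructor
    · refine (injective_iff_map_eq_zero _).2 ?_
      rintro ⟨x, c⟩ hx
      rw [hΘ'app] at hx
      have h1 : fderiv ℂ φ q x ∈ R := ⟨x, rfl⟩
      have h2 : fderiv ℂ φ q x ∈ C := by
        rw [eq_neg_of_add_eq_zero_left hx]; exact C.neg_mem (eC.symm c).2
      have h3 := Submodule.disjoint_def.1 hC.disjoint _ h1 h2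
      have h4 : x = 0 := hinj (by simpa using h3)
      rw [h3, zero_add] at hx
      have h5 : eC.symm c = 0 := Subtype.ext hx
      have h6 : c = 0 := by simpa using h5
      simp [h4, h6]
    · intro w
      have hw : w ∈ R ⊔ C := by rw [hC.sup_eq_top]; trivial
      obtain ⟨_, ⟨x, rfl⟩, c, hc, rfl⟩ := Submodule.mem_sup.1 hw
      exact ⟨(x, eC ⟨c, hc⟩), by rw [hΘ'app]; simp⟩
  let e : (E × (Fin k → ℂ)) ≃L[ℂ] G :=
    (LinearEquiv.ofBijective (Θ' : E × (Fin k → ℂ) →ₗ[ℂ] G) hbij).toContinuousLinearEquiv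
  have he : (e : E × (Fin k → ℂ) →L[ℂ] G) = Θ' := by ext x <;> rfl
  rw [← he] at hΘd
  set H := hΘd.toOpenPartialHomeomorph Θ with hH
  have hsrc : (q, (0 : Fin k → ℂ)) ∈ H.source := hΘd.mem_toOpenPartialHomeomorph_source
  have hHcoe : ∀ x, H x = Θ x := fun x => rfl
  have hΘq : Θ (q, 0) = φ q := by simp [Θ]
  have hinvan : AnalyticAt ℂ H.symm (φ q) := by
    rw [← hΘq]
    exact H.analyticAt_symm' hsrc hΘan (by exact hΘd.hasFDerivAt.fderiv)
  have hinvd : HasFDerivAt H.symm (e.symm : G →L[ℂ] E × (Fin k → ℂ)) (φ q) := by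
    rw [← hΘq]
    exact hΘd.to_localInverse.hasFDerivAt
  have hFd : HasFDerivAt (fun w => (H.symm w).2)
      ((ContinuousLinearMap.snd ℂ E (Fin k → ℂ)) ∘L (e.symm : G →L[ℂ] E × (Fin k → ℂ))) (φ q) :=
    (ContinuousLinearMap.snd ℂ E (Fin k → ℂ)).hasFDerivAt.comp _ hinvd
  have hinvq : H.symm (φ q) = (q, 0) := by
    rw [← hΘq]; exact H.left_inv hsrc
  refine ⟨k, fun w => (H.symm w).2, ?_, ?_, ?_, ?_, ?_, ?_⟩
  · exact ((ContinuousLinearMap.snd ℂ E (Fin k → ℂ)).analyticAt _).comp hinvan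
  · simp [hinvq]
  · rw [hFd.fderiv]
    intro c
    exact ⟨e (0, c), by simp⟩
  · rw [hFd.fderiv]
    ext w
    have key : ∀ z, e z = fderiv ℂ φ q z.1 + (eC.symm z.2 : G) := fun z => rfl
    constructor
    · intro hw
      have hw' : (e.symm w).2 = 0 := hw
      refine ⟨(e.symm w).1, ?_⟩
      have := key (e.symm w)
      rw [hw'] at this
      simpa using this.symm
    · rintro ⟨x, rfl⟩
      have : e (x, 0) = fderiv ℂ φ q x := by rw [key]; simp
      show (e.symm (fderiv ℂ φ q x)).2 = 0
      rw [← this]; simp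
  · have hcont : ContinuousAt (fun w => (H.symm w).1) (φ q) :=
      continuous_fst.continuousAt.comp hinvan.continuousAt
    have h1 : ∀ᶠ w in 𝓝 (φ q), (H.symm w).1 ∈ N := by
      apply hcont; simpa [hinvq] using hN
    have h2 : ∀ᶠ w in 𝓝 (φ q), w ∈ H.target := by
      rw [← hΘq]; exact H.open_target.mem_nhds (H.map_source hsrc)
    filter_upwards [h1, h2] with w hw1 hw2 hw0
    refine ⟨_, hw1, ?_⟩
    have h3 := H.right_inv hw2
    rw [hHcoe] at h3
    have h4 : Θ ((H.symm w).1, 0) = w := by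
      rw [← hw0]; exact h3
    simpa [Θ] using h4
  · have h1 : ∀ᶠ x in 𝓝 q, (x, (0 : Fin k → ℂ)) ∈ H.source := by
      have : ContinuousAt (fun x : E => (x, (0 : Fin k → ℂ))) q := by fun_prop
      exact this (H.open_source.mem_nhds hsrc)
    filter_upwards [h1] with x hx
    have h3 := H.left_inv hx
    have h4 : H (x, 0) = φ x := by rw [hHcoe]; simp [Θ]
    rw [h4] at h3
    simp [h3]

end LocalAnalytic

/-! ### Branching of analytic functions of one variable -/

section OneVariable

/-- A nonconstant analytic function with vanishing derivative at a point is not injective near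
the point; in fact two points with the same value can be chosen away from the critical point. -/
theorem exists_ne_of_deriv_eq_zero {c : ℂ → ℂ} (hc : AnalyticAt ℂ c 0) (hc0 : c 0 = 0)
    (hd : deriv c 0 = 0) (hne : ¬ ∀ᶠ τ in 𝓝 0, c τ = 0) {N : Set ℂ} (hN : N ∈ 𝓝 (0 : ℂ)) :
    ∃ τ₁ ∈ N, ∃ τ₂ ∈ N, τ₁ ≠ τ₂ ∧ c τ₁ = c τ₂ ∧ deriv c τ₂ ≠ 0 := by
  obtain ⟨n, g, hg, hg0, hgc⟩ := hc.exists_eventuallyEq_pow_smul_nonzero_iff.2 hne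
  simp only [sub_zero, smul_eq_mul] at hgc
  have hn0 : n ≠ 0 := by
    rintro rfl
    have := hgc.self_of_nhds
    simp [hc0] at this
    exact hg0 this.symm
  obtain ⟨z, hz⟩ := IsAlgClosed.exists_pow_nat_eq (g 0) (Nat.pos_of_ne_zero hn0)
  have hz0 : z ≠ 0 := by rintro rfl; rw [zero_pow hn0] at hz; exact hg0 hz.symm
  -- An analytic `n`-th root of `g`: dividing by `g 0` moves the values close to `1`, where the
  -- principal logarithm is analytic. Then `l = τ * u` is a local coordinate with `c = l ^ n`.
  set u : ℂ → ℂ := fun τ => z * Complex.exp (Complex.log (g τ / g 0) / n) with hu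
  have hslit : g 0 / g 0 ∈ Complex.slitPlane := by rw [div_self hg0]; simp
  have huan : AnalyticAt ℂ u 0 := by
    have h1 : AnalyticAt ℂ (fun τ => g τ / g 0) 0 := hg.div_const
    have h2 : AnalyticAt ℂ (fun τ => Complex.log (g τ / g 0)) 0 := h1.clog hslit
    exact analyticAt_const.mul (h2.div_const).cexp
  have hu0 : u 0 = z := by simp [hu, div_self hg0]
  set l : ℂ → ℂ := fun τ => τ * u τ with hl
  have hlan : AnalyticAt ℂ l 0 := analyticAt_id.mul huan
  have hpow : ∀ᶠ τ in 𝓝 0, c τ = l τ ^ n := by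
    filter_upwards [hgc, hg.continuousAt.eventually_ne hg0] with τ hτ hτ0
    rw [hτ, hl, mul_pow, hu]
    congr 1
    rw [mul_pow, ← Complex.exp_nat_mul, mul_div_cancel₀ _ (Nat.cast_ne_zero.2 hn0),
      Complex.exp_log (div_ne_zero hτ0 hg0), hz, mul_div_cancel₀ _ hg0]
  have hld : HasDerivAt l z 0 := by
    have := (hasDerivAt_id (0 : ℂ)).mul huan.differentiableAt.hasDerivAt
    rw [hu0] at this
    exact this.congr_deriv (by simp)
  have hl0 : l 0 = 0 := by simp [hl]
  have hn2 : 2 ≤ n := by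
    rcases Nat.lt_or_ge n 2 with h | h
    · have : n = 1 := by omega
      subst this
      have h1 : HasDerivAt c z 0 := hld.congr_of_eventuallyEq (by
        filter_upwards [hpow] with τ hτ; simpa using hτ)
      exact absurd (h1.deriv.symm.trans hd) hz0
    · exact h
  have hderiv : ∀ᶠ τ in 𝓝 0, l τ ≠ 0 → deriv c τ ≠ 0 := by
    have hl1 : ∀ᶠ τ in 𝓝 0, deriv l τ ≠ 0 :=
      hlan.deriv.continuousAt.eventually_ne (by rw [hld.deriv]; exact hz0)
    filter_upwards [hl1, hpow.eventually_nhds, hlan.eventually_analyticAt] with τ h1 h2 h3 h4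
    have h5 : HasDerivAt (fun τ => l τ ^ n) (n * l τ ^ (n - 1) * deriv l τ) τ :=
      h3.differentiableAt.hasDerivAt.pow n
    have h6 : HasDerivAt c (n * l τ ^ (n - 1) * deriv l τ) τ := h5.congr_of_eventuallyEq h2
    rw [h6.deriv]
    exact mul_ne_zero (mul_ne_zero (Nat.cast_ne_zero.2 hn0) (pow_ne_zero _ h4)) h1
  have hstrict : HasStrictDerivAt l z 0 := by
    have := hlan.hasStrictDerivAt; rwa [hld.deriv] at this
  have hmap : map l (𝓝 0) = 𝓝 0 := by
    have := hstrict.map_nhds_eq hz0; rwa [hl0] at this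
  have hN' : N ∩ {τ | c τ = l τ ^ n} ∩ {τ | l τ ≠ 0 → deriv c τ ≠ 0} ∈ 𝓝 (0 : ℂ) :=
    inter_mem (inter_mem hN hpow) hderiv
  have himg : l '' (N ∩ {τ | c τ = l τ ^ n} ∩ {τ | l τ ≠ 0 → deriv c τ ≠ 0}) ∈ 𝓝 (0 : ℂ) := by
    rw [← hmap]; exact image_mem_map hN'
  -- The points with `l`-coordinates `ε` and `ζ * ε` are distinct and have the same `n`-th power;
  -- both lie in `N` for small `ε`.
  set ζ : ℂ := Complex.exp (2 * Real.pi * Complex.I / n) with hζ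
  have hprim : IsPrimitiveRoot ζ n := Complex.isPrimitiveRoot_exp n hn0
  have hζ1 : ζ ≠ 1 := hprim.ne_one hn2
  have hζ0 : ζ ≠ 0 := Complex.exp_ne_zero _
  have himg2 : ∀ᶠ ε in 𝓝 (0 : ℂ),
      ζ * ε ∈ l '' (N ∩ {τ | c τ = l τ ^ n} ∩ {τ | l τ ≠ 0 → deriv c τ ≠ 0}) := by
    have : ContinuousAt (fun ε : ℂ => ζ * ε) 0 := by fun_prop
    apply this; simpa using himg
  have hpunct : ∀ᶠ ε in 𝓝[≠] (0 : ℂ),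
      ε ∈ l '' (N ∩ {τ | c τ = l τ ^ n} ∩ {τ | l τ ≠ 0 → deriv c τ ≠ 0}) ∧
      ζ * ε ∈ l '' (N ∩ {τ | c τ = l τ ^ n} ∩ {τ | l τ ≠ 0 → deriv c τ ≠ 0}) ∧ ε ≠ 0 := by
    filter_upwards [nhdsWithin_le_nhds himg, nhdsWithin_le_nhds himg2,
      self_mem_nhdsWithin] with ε h1 h2 h3 using ⟨h1, h2, h3⟩
  obtain ⟨ε, ⟨τ₁, ⟨⟨h1N, h1c⟩, -⟩, h1⟩, ⟨τ₂, ⟨⟨h2N, h2c⟩, h2d⟩, h2⟩, hε⟩ := hpunct.exists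
  simp only [Set.mem_ofPred_eq] at h1c h2c h2d
  refine ⟨τ₁, h1N, τ₂, h2N, ?_, ?_, h2d ?_⟩
  · rintro rfl
    rw [h1] at h2
    exact hζ1 (mul_right_cancel₀ hε (by rw [one_mul]; exact h2.symm))
  · rw [h1c, h2c, h1, h2, mul_pow, hprim.pow_eq_one, one_mul]
  · rw [h2]; exact mul_ne_zero hζ0 hε

end OneVariable

/-! ### Analytic families of planes -/

section Families

variable {E F G : Type*} [NormedAddCommGroup E] [NormedSpace ℂ E]
  [NormedAddCommGroup F] [NormedSpace ℂ F] [NormedAddCommGroup G] [NormedSpace ℂ G]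

/-- The solution of a linear system that depends analytically on a parameter is analytic. -/
theorem exists_analytic_solution [FiniteDimensional ℂ E] {T : ℂ → E →L[ℂ] F} {a : ℂ} (hT : AnalyticAt ℂ T a)
    (hbij : Function.Bijective (T a)) (w : F) :
    ∃ s : ℂ → E, AnalyticAt ℂ s a ∧
      ∀ᶠ τ in 𝓝 a, T τ (s τ) = w ∧ Function.Injective (T τ) := by
  have : CompleteSpace E := FiniteDimensional.complete ℂ E
  let e : E ≃L[ℂ] F :=
    (LinearEquiv.ofBijective (T a : E →ₗ[ℂ] F) hbij).toContinuousLinearEquiv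
  have he : ∀ x, e x = T a x := fun _ => rfl
  -- Normalizing by the inverse of `T a` reduces the claim to analyticity of inversion near the
  -- identity of a Banach algebra.
  set A : ℂ → (E →L[ℂ] E) := fun τ => (e.symm : F →L[ℂ] E) ∘L T τ with hA
  have hAan : AnalyticAt ℂ A a :=
    ((ContinuousLinearMap.compL ℂ E F E (e.symm : F →L[ℂ] E)).analyticAt _).comp hT
  have hA0 : A a = 1 := by
    ext x
    show e.symm (T a x) = x
    rw [← he, e.symm_apply_apply]
  have hinv : AnalyticAt ℂ (fun τ => Ring.inverse (A τ)) a := by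
    have h1 : AnalyticAt ℂ Ring.inverse (A a) := by
      rw [hA0]; exact analyticAt_inverse (1 : (E →L[ℂ] E)ˣ)
    exact h1.fun_comp hAan
  refine ⟨fun τ => Ring.inverse (A τ) (e.symm w),
    ((ContinuousLinearMap.apply ℂ E (e.symm w)).analyticAt _).comp hinv, ?_⟩
  have hunit : ∀ᶠ τ in 𝓝 a, IsUnit (A τ) := by
    have : {x : E →L[ℂ] E | IsUnit x} ∈ 𝓝 (A a) := by
      rw [hA0]; exact Units.nhds (1 : (E →L[ℂ] E)ˣ)
    exact hAan.continuousAt this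
  filter_upwards [hunit] with τ hτ
  constructor
  · apply e.symm.injective
    have := ContinuousLinearMap.ext_iff.1 (Ring.mul_inverse_cancel _ hτ) (e.symm w)
    exact this
  · intro x y hxy
    have h1 := fun x => ContinuousLinearMap.ext_iff.1 (Ring.inverse_mul_cancel _ hτ) x
    have h2 : A τ x = A τ y := congrArg e.symm hxy
    have h3 : Ring.inverse (A τ) (A τ x) = x := h1 x
    rw [← h3, h2]; exact h1 y

theorem AnalyticAt.clm_apply_joint {Φ : ℂ → E →L[ℂ] G} {a : ℂ} (hΦ : AnalyticAt ℂ Φ a) (y : E) :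
    AnalyticAt ℂ (fun x : E × ℂ => Φ x.2 x.1) (y, a) := by
  have h1 : AnalyticAt ℂ (fun x : E × ℂ => Φ x.2) (y, a) :=
    AnalyticAt.fun_comp (g := Φ) (f := Prod.snd) hΦ analyticAt_snd
  exact AnalyticAt.fun_comp (f := fun x : E × ℂ => (Φ x.2, x.1))
    ((ContinuousLinearMap.id ℂ (E →L[ℂ] G)).analyticAt_bilinear (Φ a, y)) (h1.prod analyticAt_fst)

theorem fderiv_joint_apply {Φ : ℂ → E →L[ℂ] G} {a : ℂ} (hΦ : AnalyticAt ℂ Φ a)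
    (y : E) (z : E) (t : ℂ) :
    fderiv ℂ (fun x : E × ℂ => Φ x.2 x.1) (y, a) (z, t) = Φ a z + t • deriv Φ a y := by
  have h1 : HasFDerivAt (fun x : E × ℂ => Φ x.2)
      ((fderiv ℂ Φ a) ∘L ContinuousLinearMap.snd ℂ E ℂ) (y, a) :=
    HasFDerivAt.comp (g := Φ) (y, a) hΦ.differentiableAt.hasFDerivAt hasFDerivAt_snd
  have h2 := h1.clm_apply (hasFDerivAt_fst (𝕜 := ℂ) (E := E) (F := ℂ) (p := (y, a)))
  rw [h2.fderiv]
  have h3 : fderiv ℂ Φ a t = t • deriv Φ a := by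
    rw [← fderiv_apply_one_eq_deriv, ← map_smul]; simp
  simp [h3]

/-- The differential of `(y, τ) ↦ Φ τ y` is injective if `deriv Φ a y` is transversal to the
range of the injective map `Φ a`. -/
theorem injective_fderiv_joint {Φ : ℂ → E →L[ℂ] G} {a : ℂ} (hΦ : AnalyticAt ℂ Φ a)
    (hinj : Function.Injective (Φ a)) {y : E}
    (hy : deriv Φ a y ∉ LinearMap.range (Φ a : E →ₗ[ℂ] G)) :
    Function.Injective (fderiv ℂ (fun x : E × ℂ => Φ x.2 x.1) (y, a)) := by
  refine (injective_iff_map_eq_zero _).2 ?_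
  rintro ⟨z, t⟩ h
  rw [fderiv_joint_apply hΦ] at h
  have ht : t = 0 := by
    by_contra ht
    refine hy ⟨-(t⁻¹ • z), ?_⟩
    have h2 : t • deriv Φ a y = - Φ a z := eq_neg_of_add_eq_zero_right h
    show Φ a _ = _
    rw [map_neg, map_smul, ← smul_neg, ← h2, inv_smul_smul₀ ht]
  subst ht
  have : z = 0 := hinj (by simpa using h)
  simp [this]

/-- Suppose that the ruled surface with the rulings `range (Φ τ)` lies near the point
`v = Φ 0 y₀` in the smooth hypersurface `h = 0`, and that its parametrization is singular at
this point. If `v` does not lie on all rulings, then some points of the hypersurface near `v` lie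
on two rulings, and the parametrization is an immersion at one of the preimages. -/
theorem exists_double_point [FiniteDimensional ℂ G] (hG : Module.finrank ℂ G = 4) {Φ : ℂ → (ℂ × ℂ) →L[ℂ] G}
    (hΦ : AnalyticAt ℂ Φ 0) (hinj : Function.Injective (Φ 0)) {y₀ : ℂ × ℂ} {h : G → ℂ}
    (hh : AnalyticAt ℂ h (Φ 0 y₀)) (hh' : fderiv ℂ h (Φ 0 y₀) ≠ 0)
    (hzero : ∀ᶠ x : (ℂ × ℂ) × ℂ in 𝓝 (y₀, 0), h (Φ x.2 x.1) = 0)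
    (hsing : deriv Φ 0 y₀ ∈ LinearMap.range (Φ 0 : (ℂ × ℂ) →ₗ[ℂ] G))
    (hfin : ¬ ∀ᶠ τ in 𝓝 (0 : ℂ), Φ 0 y₀ ∈ LinearMap.range (Φ τ : (ℂ × ℂ) →ₗ[ℂ] G))
    {N : Set ((ℂ × ℂ) × ℂ)} (hN : N ∈ 𝓝 (y₀, (0 : ℂ))) :
    ∃ x₁ ∈ N, ∃ x₂ ∈ N, x₁.2 ≠ x₂.2 ∧ Φ x₁.2 x₁.1 = Φ x₂.2 x₂.1 ∧
      deriv Φ x₂.2 x₂.1 ∉ LinearMap.range (Φ x₂.2 : (ℂ × ℂ) →ₗ[ℂ] G) := by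
  set v := Φ 0 y₀ with hv
  set h' := fderiv ℂ h v with hh'def
  set K : Submodule ℂ G := LinearMap.ker (h' : G →ₗ[ℂ] ℂ) with hK
  obtain ⟨M, hM⟩ := exists_continuous_leftInverse K.subtypeL Subtype.val_injective
  have hrange : ∀ y, Φ 0 y ∈ K := by
    intro y
    have h0 : HasFDerivAt h h' (Φ 0 y₀) := hh.differentiableAt.hasFDerivAt
    have h1 : HasFDerivAt (fun y => h (Φ 0 y)) (h' ∘L Φ 0) y₀ := h0.comp y₀ (Φ 0).hasFDerivAt
    have h2 : HasFDerivAt (fun y => h (Φ 0 y)) (0 : (ℂ × ℂ) →L[ℂ] ℂ) y₀ := by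
      refine (hasFDerivAt_const (0 : ℂ) y₀).congr_of_eventuallyEq ?_
      have : ContinuousAt (fun y : ℂ × ℂ => (y, (0 : ℂ))) y₀ := by fun_prop
      exact this.eventually hzero
    have := ContinuousLinearMap.ext_iff.1 (h1.unique h2) y
    simpa [hK] using this
  have hMinj : Function.Injective ((M ∘L Φ 0 : (ℂ × ℂ) →L[ℂ] K) : (ℂ × ℂ) →ₗ[ℂ] K) := by
    refine (injective_iff_map_eq_zero _).2 fun y hy => ?_
    have h1 : M (Φ 0 y) = ⟨Φ 0 y, hrange y⟩ := hM ⟨Φ 0 y, hrange y⟩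
    have h0 : M (Φ 0 y) = 0 := hy
    rw [h0] at h1
    exact hinj (by simpa using (congrArg Subtype.val h1).symm)
  have hKdim : Module.finrank ℂ K = 3 := by
    have hr : LinearMap.range (h' : G →ₗ[ℂ] ℂ) = ⊤ :=
      LinearMap.range_eq_top.2 (LinearMap.surjective (by
        intro h0; exact hh' (by ext x; exact LinearMap.congr_fun h0 x)))
    have h1 : Module.finrank ℂ (LinearMap.range (h' : G →ₗ[ℂ] ℂ)) + Module.finrank ℂ K =
      Module.finrank ℂ G := LinearMap.finrank_range_add_finrank_ker (h' : G →ₗ[ℂ] ℂ)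
    rw [hr, finrank_top, Module.finrank_self] at h1
    omega
  -- The ruling through `v` fills only a plane in the three-dimensional space `K`; `e` is a
  -- direction transversal to it.
  obtain ⟨e, he⟩ : ∃ e : K, e ∉
      LinearMap.range ((M ∘L Φ 0 : (ℂ × ℂ) →L[ℂ] K) : (ℂ × ℂ) →ₗ[ℂ] K) := by
    by_contra hcon
    push Not at hcon
    have h1 := LinearMap.finrank_range_of_inj hMinj
    rw [(Submodule.eq_top_iff'.2 hcon), finrank_top, hKdim] at h1
    simp at h1
  -- Solving `T τ (y, c) = M v` finds the point of the ruling `τ` that lies over the line `M v + ℂ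
  -- e`; its position on this line is `c τ`.
  set T : ℂ → ((ℂ × ℂ) × ℂ) →L[ℂ] K := fun τ =>
    (M ∘L Φ τ) ∘L ContinuousLinearMap.fst ℂ (ℂ × ℂ) ℂ -
      (ContinuousLinearMap.toSpanSingleton ℂ e) ∘L ContinuousLinearMap.snd ℂ (ℂ × ℂ) ℂ with hT
  have hTapp : ∀ τ y c, T τ (y, c) = M (Φ τ y) - c • e := fun τ y c => rfl
  have hTan : AnalyticAt ℂ T 0 := by
    have h1 : AnalyticAt ℂ (fun τ => M ∘L Φ τ) 0 :=
      ((ContinuousLinearMap.compL ℂ (ℂ × ℂ) G K M).analyticAt _).comp hΦ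
    have h2 : AnalyticAt ℂ (fun τ => (M ∘L Φ τ) ∘L ContinuousLinearMap.fst ℂ (ℂ × ℂ) ℂ) 0 :=
      (((ContinuousLinearMap.compL ℂ ((ℂ × ℂ) × ℂ) (ℂ × ℂ) K).flip
        (ContinuousLinearMap.fst ℂ (ℂ × ℂ) ℂ)).analyticAt _).comp h1
    exact h2.sub analyticAt_const
  have hT0inj : Function.Injective (T 0 : ((ℂ × ℂ) × ℂ) →ₗ[ℂ] K) := by
    refine (injective_iff_map_eq_zero _).2 ?_
    rintro ⟨y, c⟩ hyc
    have hyc' : M (Φ 0 y) - c • e = 0 := hyc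
    have hc : c = 0 := by
      by_contra hc
      refine he ⟨c⁻¹ • y, ?_⟩
      show M (Φ 0 (c⁻¹ • y)) = e
      rw [map_smul, map_smul, sub_eq_zero.1 hyc', inv_smul_smul₀ hc]
    subst hc
    have : y = 0 := hMinj (by simpa using hyc')
    simp [this]
  have hT0 : Function.Bijective (T 0) :=
    ⟨hT0inj, (LinearMap.injective_iff_surjective_of_finrank_eq_finrank
      (by simp [hKdim])).1 hT0inj⟩
  obtain ⟨s, hs, hsol⟩ := exists_analytic_solution hTan hT0 (M v)
  have hs0 : s 0 = (y₀, 0) := by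
    obtain ⟨h1, h2⟩ := hsol.self_of_nhds
    refine h2 (h1.trans ?_)
    rw [hTapp]; simp [hv]
  set c : ℂ → ℂ := fun τ => (s τ).2 with hc
  have hcan : AnalyticAt ℂ c 0 := ((ContinuousLinearMap.snd ℂ (ℂ × ℂ) ℂ).analyticAt _).comp hs
  have hyan : AnalyticAt ℂ (fun τ => (s τ).1) 0 :=
    ((ContinuousLinearMap.fst ℂ (ℂ × ℂ) ℂ).analyticAt _).comp hs
  have hderiv : ∀ᶠ τ in 𝓝 0,
      M (deriv Φ τ (s τ).1 + Φ τ (deriv (fun τ => (s τ).1) τ)) = deriv c τ • e := by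
    filter_upwards [hsol.eventually_nhds, hΦ.eventually_analyticAt, hcan.eventually_analyticAt,
      hyan.eventually_analyticAt] with τ h1 h2 h3 h4
    have h5 := h2.differentiableAt.hasDerivAt.clm_apply h4.differentiableAt.hasDerivAt
    have h6 := (M.hasFDerivAt.comp_hasDerivAt τ h5).sub
      (h3.differentiableAt.hasDerivAt.smul_const e)
    have h7 : HasDerivAt (fun τ => M (Φ τ (s τ).1) - c τ • e) 0 τ :=
      (hasDerivAt_const τ (M v)).congr_of_eventuallyEq (h1.mono fun τ h => h.1)
    have h8 := h6.unique h7
    exact sub_eq_zero.1 h8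
  have hc0 : c 0 = 0 := by simp [hc, hs0]
  -- By singularity the differentiated equation puts `deriv c 0 • e` into the plane that `e` avoids.
  have hcd : deriv c 0 = 0 := by
    have h1 := hderiv.self_of_nhds
    obtain ⟨z, hz⟩ := hsing
    have hz' : Φ 0 z = deriv Φ 0 y₀ := hz
    rw [hs0, ← hz', ← map_add] at h1
    by_contra hne
    refine he ⟨(deriv c 0)⁻¹ • (z + deriv (fun τ => (s τ).1) 0), ?_⟩
    show M (Φ 0 _) = e
    rw [map_smul, map_smul, h1, inv_smul_smul₀ hne]
  have hpair : HasStrictFDerivAt (fun w => (M w, h w)) (M.prod h') v :=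
    M.hasStrictFDerivAt.prodMk hh.hasStrictFDerivAt
  obtain ⟨U, hU, hUinj⟩ := exists_injOn_nhds hpair (by
    refine (injective_iff_map_eq_zero _).2 fun w hw => ?_
    have h1 : M w = 0 := congrArg Prod.fst hw
    have h2 : h' w = 0 := congrArg Prod.snd hw
    have h3 : M w = ⟨w, h2⟩ := hM ⟨w, h2⟩
    rw [h1] at h3
    exact (congrArg Subtype.val h3).symm)
  have hcurve : ContinuousAt (fun τ => ((s τ).1, τ)) 0 := hyan.continuousAt.prodMk continuousAt_id
  have hcurve0 : (fun τ => ((s τ).1, τ)) 0 = (y₀, (0 : ℂ)) := by simp [hs0]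
  have hnear : ∀ᶠ τ in 𝓝 0, ((s τ).1, τ) ∈ N ∧ h (Φ τ (s τ).1) = 0 ∧ Φ τ (s τ).1 ∈ U := by
    have h1 : ∀ᶠ x : (ℂ × ℂ) × ℂ in 𝓝 (y₀, (0 : ℂ)), Φ x.2 x.1 ∈ U :=
      (AnalyticAt.clm_apply_joint hΦ y₀).continuousAt hU
    have h2 : ∀ᶠ x in 𝓝 (y₀, (0 : ℂ)), x ∈ N ∧ h (Φ x.2 x.1) = 0 ∧ Φ x.2 x.1 ∈ U :=
      (eventually_mem_set.2 hN).and (hzero.and h1)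
    rw [← hcurve0] at h2
    exact hcurve.eventually h2
  -- If `c` vanished identically, local injectivity of `(M, h)` would identify all the points found
  -- with `v`, which would lie on every nearby ruling.
  have hne : ¬ ∀ᶠ τ in 𝓝 0, c τ = 0 := by
    intro hcz
    apply hfin
    filter_upwards [hcz, hsol, hnear] with τ h1 h2 h3
    refine ⟨(s τ).1, hUinj h3.2.2 (mem_of_mem_nhds hU) ?_⟩
    have h4 : M (Φ τ (s τ).1) - c τ • e = M v := h2.1
    rw [h1, zero_smul, sub_zero] at h4
    have h5 : h v = 0 := hzero.self_of_nhds
    show (M _, h _) = (M v, h v)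
    rw [h5, ← h4, Prod.mk.injEq]
    exact ⟨rfl, h3.2.1⟩
  have hN' : {τ | ((((s τ).1, τ) ∈ N ∧ h (Φ τ (s τ).1) = 0 ∧ Φ τ (s τ).1 ∈ U) ∧
      T τ (s τ) = M v ∧ Function.Injective (T τ)) ∧
      M (deriv Φ τ (s τ).1 + Φ τ (deriv (fun τ => (s τ).1) τ)) = deriv c τ • e} ∈ 𝓝 (0 : ℂ) :=
    (hnear.and hsol).and hderiv
  obtain ⟨τ₁, ⟨⟨⟨h1N, h1z, h1U⟩, h1s, -⟩, -⟩, τ₂, ⟨⟨⟨h2N, h2z, h2U⟩, h2s, h2i⟩, h2d⟩, hτ, hcc,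
    hd⟩ := exists_ne_of_deriv_eq_zero hcan hc0 hcd hne hN'
  refine ⟨_, h1N, _, h2N, hτ, ?_, ?_⟩
  · refine hUinj h1U h2U ?_
    have h3 : M (Φ τ₁ (s τ₁).1) - c τ₁ • e = M v := h1s
    have h4 : M (Φ τ₂ (s τ₂).1) - c τ₂ • e = M v := h2s
    rw [hcc, ← h4, sub_left_inj] at h3
    show (M _, h _) = (M _, h _)
    rw [h3, h1z, h2z]
  -- A singular second point would give a kernel vector of the injective map `T τ₂` with last entry
  -- `deriv c τ₂ ≠ 0`.
  · rintro ⟨z, hz⟩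
    have hz' : Φ τ₂ z = deriv Φ τ₂ (s τ₂).1 := hz
    have h3 : T τ₂ (z + deriv (fun τ => (s τ).1) τ₂, deriv c τ₂) = 0 := by
      rw [hTapp, map_add, hz', h2d, sub_self]
    have h4 := h2i (h3.trans (map_zero (T τ₂)).symm)
    exact hd (congrArg Prod.snd h4)

end Families

/-! ### Rulings through a pinch point -/

section PinchPoint

/-- Along an analytic arc on which `g₂` has a simple zero, the equation `g₀ ^ 2 = g₁ ^ 2 * g₂`
has only the trivial solution. -/
theorem eventually_zero_of_sq_eq {g₀ g₁ g₂ : ℂ → ℂ} (h₀ : AnalyticAt ℂ g₀ 0)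
    (h₁ : AnalyticAt ℂ g₁ 0) (h₂ : AnalyticAt ℂ g₂ 0)
    (heq : ∀ᶠ z in 𝓝 0, g₀ z ^ 2 = g₁ z ^ 2 * g₂ z) (hz : g₂ 0 = 0) (hd : deriv g₂ 0 ≠ 0) :
    ∀ᶠ z in 𝓝 0, g₁ z = 0 := by
  rw [← analyticOrderAt_eq_top]
  -- The orders of the two sides are `2 * a` and `2 * b + 1`; parity leaves only `b = ⊤`.
  have h3 : analyticOrderAt (g₀ ^ 2) 0 = analyticOrderAt (g₁ ^ 2 * g₂) 0 :=
    analyticOrderAt_congr heq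
  rw [analyticOrderAt_mul (h₁.pow 2) h₂, analyticOrderAt_pow h₀, analyticOrderAt_pow h₁,
    h₂.analyticOrderAt_eq_one_of_zero_deriv_ne_zero hz hd] at h3
  generalize analyticOrderAt g₀ 0 = a at h3
  generalize analyticOrderAt g₁ 0 = b at h3
  by_contra hb
  lift b to ℕ using hb
  have ha : a ≠ ⊤ := by
    rintro rfl
    have : (2 : ℕ) • (⊤ : ℕ∞) = ⊤ := by simp
    rw [this] at h3
    exact ENat.natCast_ne_top (2 * b + 1) (by rw [h3]; push_cast; simp)
  lift a to ℕ using ha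
  have h4 : 2 * a = 2 * b + 1 := by
    have : ((2 * a : ℕ) : ℕ∞) = ((2 * b + 1 : ℕ) : ℕ∞) := by
      push_cast; simpa using h3
    exact_mod_cast this
  omega

/-- If a map `(g₀, g₁, g₂)` of a surface to the pinch point surface maps a curve through the
origin with nonzero speed to the double line, then the whole surface is mapped to the double line;
in particular all curves near the first one meet the preimage of the pinch point. -/
theorem eventually_exists_zero_of_sq_eq {g₀ g₁ g₂ : ℂ × ℂ → ℂ} (h₀ : AnalyticAt ℂ g₀ 0)
    (h₁ : AnalyticAt ℂ g₁ 0) (h₂ : AnalyticAt ℂ g₂ 0)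
    (heq : ∀ᶠ z in 𝓝 0, g₀ z ^ 2 = g₁ z ^ 2 * g₂ z) (hz : g₂ 0 = 0)
    (hline : ∀ᶠ s in 𝓝 (0 : ℂ), g₁ (s, 0) = 0)
    (hd : ¬ (fderiv ℂ g₀ 0 (1, 0) = 0 ∧ fderiv ℂ g₁ 0 (1, 0) = 0 ∧ fderiv ℂ g₂ 0 (1, 0) = 0))
    {N : Set (ℂ × ℂ)} (hN : N ∈ 𝓝 (0 : ℂ × ℂ)) :
    ∀ᶠ σ in 𝓝 (0 : ℂ), ∃ s, (s, σ) ∈ N ∧ g₀ (s, σ) = 0 ∧ g₁ (s, σ) = 0 ∧ g₂ (s, σ) = 0 := by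
  have hfd : ∀ g : ℂ × ℂ → ℂ, AnalyticAt ℂ g 0 → (∀ᶠ s in 𝓝 (0 : ℂ), g (s, 0) = 0) →
      fderiv ℂ g 0 (1, 0) = 0 := by
    intro g hg hgz
    have hg0 : HasFDerivAt g (fderiv ℂ g 0) ((0 : ℂ), (0 : ℂ)) :=
      hg.differentiableAt.hasFDerivAt
    have h1 : HasDerivAt (fun s : ℂ => (s, (0 : ℂ))) (1, 0) 0 :=
      (hasDerivAt_id 0).prodMk (hasDerivAt_const 0 0)
    have h2 : HasDerivAt (fun s : ℂ => g (s, 0)) (fderiv ℂ g 0 (1, 0)) 0 :=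
      hg0.comp_hasDerivAt (f := fun s : ℂ => (s, (0 : ℂ))) (0 : ℂ) h1
    exact h2.unique ((hasDerivAt_const (0 : ℂ) (0 : ℂ)).congr_of_eventuallyEq hgz)
  have hline0 : ∀ᶠ s in 𝓝 (0 : ℂ), g₀ (s, 0) = 0 := by
    have hc : ContinuousAt (fun s : ℂ => (s, (0 : ℂ))) 0 := by fun_prop
    filter_upwards [hline, hc.eventually heq] with s h3 h4
    rw [h3] at h4
    simpa using h4
  -- On the curve `σ = 0` both `g₁` and `g₀` vanish, so the nonzero speed must come from `g₂`.
  have hd2 : fderiv ℂ g₂ 0 (1, 0) ≠ 0 := fun h =>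
    hd ⟨hfd g₀ h₀ hline0, hfd g₁ h₁ hline, h⟩
  obtain ⟨ε, hε, hball⟩ := Metric.eventually_nhds_iff_ball.1
    (((h₀.eventually_analyticAt.and h₁.eventually_analyticAt).and h₂.eventually_analyticAt).and heq)
  have hoff : ∀ s σ : ℂ, s ≠ 0 → (s, σ) ∈ Metric.ball (0 : ℂ × ℂ) ε → g₁ (s, σ) = 0 := by
    intro s σ hs hmem
    rw [mem_ball_zero_iff, Prod.norm_def, max_lt_iff] at hmem
    -- A parabola through `(s, σ)`, tangent to the first axis at the origin. The tangency gives `g₂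
    -- ∘ γ` a simple zero, so the parity argument applies; for `‖t‖ ≤ ‖s‖` the parabola stays in the
    -- ball, which allows continuation from `0` to `s`.
    set γ : ℂ → ℂ × ℂ := fun t => (t, σ / s ^ 2 * t ^ 2) with hγ
    have hγmem : ∀ t ∈ Metric.closedBall (0 : ℂ) ‖s‖, γ t ∈ Metric.ball (0 : ℂ × ℂ) ε := by
      intro t ht
      rw [mem_closedBall_zero_iff] at ht
      rw [mem_ball_zero_iff, Prod.norm_def, max_lt_iff]
      refine ⟨ht.trans_lt hmem.1, lt_of_le_of_lt ?_ hmem.2⟩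
      have hs' : 0 < ‖s‖ := norm_pos_iff.2 hs
      simp only [hγ, norm_mul, norm_div, norm_pow]
      rw [div_mul_eq_mul_div, div_le_iff₀ (by positivity)]
      gcongr
    have hγan : ∀ t, AnalyticAt ℂ γ t := fun t => by
      refine analyticAt_id.prod (analyticAt_const.mul (analyticAt_id.pow 2))
    have hγ0 : γ 0 = 0 := by simp [hγ]
    have hγs : γ s = (s, σ) := by
      simp [hγ, div_mul_cancel₀ _ (pow_ne_zero 2 hs)]
    have hcomp : ∀ g : ℂ × ℂ → ℂ, ∀ t, AnalyticAt ℂ g (γ t) → AnalyticAt ℂ (fun t => g (γ t)) t :=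
      fun g t hg => AnalyticAt.fun_comp (g := g) (f := γ) hg (hγan t)
    have hev : ∀ᶠ t in 𝓝 (0 : ℂ), g₁ (γ t) = 0 := by
      refine eventually_zero_of_sq_eq (g₀ := fun t => g₀ (γ t)) (g₁ := fun t => g₁ (γ t))
        (g₂ := fun t => g₂ (γ t)) (hcomp _ _ (by rwa [hγ0])) (hcomp _ _ (by rwa [hγ0]))
        (hcomp _ _ (by rwa [hγ0])) ?_ (by simpa [hγ0] using hz) ?_
      · have hc := (hγan 0).continuousAt
        rw [← hγ0] at heq
        exact hc.eventually heq
      · have h1 : HasDerivAt γ (1, 0) 0 := by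
          refine (hasDerivAt_id (0 : ℂ)).prodMk ?_
          have := ((hasDerivAt_id (0 : ℂ)).pow 2).const_mul (σ / s ^ 2)
          exact this.congr_deriv (by simp)
        have hg0 : HasFDerivAt g₂ (fderiv ℂ g₂ 0) (γ 0) := by
          rw [hγ0]; exact h₂.differentiableAt.hasFDerivAt
        have h2 : HasDerivAt (fun t => g₂ (γ t)) (fderiv ℂ g₂ 0 (1, 0)) 0 :=
          hg0.comp_hasDerivAt (0 : ℂ) h1
        rw [h2.deriv]; exact hd2
    have han : AnalyticOnNhd ℂ (fun t => g₁ (γ t)) (Metric.closedBall (0 : ℂ) ‖s‖) :=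
      fun t ht => hcomp _ _ (hball _ (hγmem t ht)).1.1.2
    have := han.eqOn_zero_of_preconnected_of_eventuallyEq_zero
      (convex_closedBall _ _).isPreconnected (by simp) hev (x := s) (by simp)
    simpa [hγs] using this
  have hall : ∀ z ∈ Metric.ball (0 : ℂ × ℂ) ε, g₁ z = 0 := by
    rintro ⟨s, σ⟩ hmem
    have hc : ContinuousAt (fun t : ℂ => (t, σ)) s := by fun_prop
    have h3 : Tendsto (fun t : ℂ => g₁ (t, σ)) (𝓝[≠] s) (𝓝 (g₁ (s, σ))) := by
      have h4 : ContinuousAt g₁ (s, σ) := (hball _ hmem).1.1.2.continuousAt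
      exact (ContinuousAt.comp (f := fun t : ℂ => (t, σ)) (g := g₁) h4 hc).tendsto.mono_left
        nhdsWithin_le_nhds
    have h5 : ∀ᶠ t in 𝓝[≠] s, g₁ (t, σ) = 0 := by
      have h6 : ∀ᶠ t in 𝓝[≠] s, t ≠ 0 := by
        by_cases hs : s = 0
        · subst hs; exact self_mem_nhdsWithin
        · exact nhdsWithin_le_nhds (isOpen_ne.mem_nhds hs)
      filter_upwards [h6, nhdsWithin_le_nhds (hc (Metric.isOpen_ball.mem_nhds hmem))]
        with t h7 h8 using hoff t σ h7 h8
    exact tendsto_nhds_unique h3 (tendsto_const_nhds.congr' (h5.mono fun t h => h.symm))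
  -- As `(g₂, σ)` are local coordinates, each nearby curve of constant `σ` contains a zero of `g₂`;
  -- there `g₀` vanishes too, because `g₁` vanishes everywhere near the origin.
  set L : (ℂ × ℂ) →L[ℂ] (ℂ × ℂ) := (fderiv ℂ g₂ 0).prod (ContinuousLinearMap.snd ℂ ℂ ℂ) with hL
  have hstrict : HasStrictFDerivAt (fun z : ℂ × ℂ => (g₂ z, z.2)) L 0 :=
    h₂.hasStrictFDerivAt.prodMk hasStrictFDerivAt_snd
  have hinj : Function.Injective (L : (ℂ × ℂ) →ₗ[ℂ] (ℂ × ℂ)) := by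
    refine (injective_iff_map_eq_zero _).2 ?_
    rintro ⟨s, σ⟩ h
    have h1 : fderiv ℂ g₂ 0 (s, σ) = 0 := congrArg Prod.fst h
    have h2 : σ = 0 := congrArg Prod.snd h
    subst h2
    have h3 : ((s, 0) : ℂ × ℂ) = s • (1, 0) := by simp
    rw [h3, map_smul, smul_eq_mul] at h1
    simp [(mul_eq_zero.1 h1).resolve_right hd2]
  have hsurj : LinearMap.range (L : (ℂ × ℂ) →ₗ[ℂ] (ℂ × ℂ)) = ⊤ :=
    LinearMap.range_eq_top.2 (LinearMap.injective_iff_surjective.1 hinj)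
  have hmap := hstrict.map_nhds_eq_of_surj hsurj
  have himg : (fun z : ℂ × ℂ => (g₂ z, z.2)) '' (N ∩ Metric.ball 0 ε) ∈ 𝓝 ((0, 0) : ℂ × ℂ) := by
    have : ((0, 0) : ℂ × ℂ) = (g₂ 0, (0 : ℂ × ℂ).2) := by simp [hz]
    rw [this, ← hmap]
    exact image_mem_map (inter_mem hN (Metric.ball_mem_nhds _ hε))
  have hc : ContinuousAt (fun σ : ℂ => ((0 : ℂ), σ)) 0 := by fun_prop
  filter_upwards [hc himg] with σ hσ
  obtain ⟨⟨s, σ'⟩, ⟨hsN, hsb⟩, hs⟩ := hσ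
  simp only [Prod.mk.injEq] at hs
  obtain ⟨hs1, rfl⟩ := hs
  refine ⟨s, hsN, ?_, hall _ hsb, hs1⟩
  have := (hball _ hsb).2
  rw [hall _ hsb] at this
  simpa using this

/-- Suppose that the ruled surface with the rulings `range (Φ τ)` lies near the point
`v = Φ 0 y₀` in the pinch point surface `x₀ ^ 2 = x₁ ^ 2 * x₂`. If `v` does not lie on all rulings,
then the ruling through `v` is not contained in the double line. -/
theorem exists_ne_zero_of_pinch {G : Type*} [NormedAddCommGroup G] [NormedSpace ℂ G]
    [FiniteDimensional ℂ G] {Φ : ℂ → (ℂ × ℂ) →L[ℂ] G}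
    (hΦ : AnalyticAt ℂ Φ 0) (hinj : Function.Injective (Φ 0)) {y₀ : ℂ × ℂ} (hy₀ : y₀ ≠ 0)
    {x : G → (Fin 3 → ℂ)} (hx : AnalyticAt ℂ x (Φ 0 y₀)) (hx0 : x (Φ 0 y₀) = 0)
    (hker : LinearMap.ker (fderiv ℂ x (Φ 0 y₀) : G →ₗ[ℂ] (Fin 3 → ℂ)) = ℂ ∙ Φ 0 y₀)
    (hhom : ∀ (c : ℂ) (w : G), c ≠ 0 → x (c • w) = x w)
    (heq : ∀ᶠ z : (ℂ × ℂ) × ℂ in 𝓝 (y₀, 0),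
      x (Φ z.2 z.1) 0 ^ 2 = x (Φ z.2 z.1) 1 ^ 2 * x (Φ z.2 z.1) 2)
    (hfin : ¬ ∀ᶠ τ in 𝓝 (0 : ℂ), Φ 0 y₀ ∈ LinearMap.range (Φ τ : (ℂ × ℂ) →ₗ[ℂ] G))
    {N : Set (ℂ × ℂ)} (hN : N ∈ 𝓝 y₀) : ∃ y ∈ N, x (Φ 0 y) 1 ≠ 0 := by
  by_contra hcon
  push Not at hcon
  apply hfin
  set v := Φ 0 y₀ with hv
  have hv0 : v ≠ 0 := fun h => hy₀ (hinj (by simpa using h))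
  obtain ⟨y₁, hy₁⟩ : ∃ y₁ : ℂ × ℂ, y₁ ∉ (ℂ ∙ y₀) := by
    by_contra hall
    push Not at hall
    have h1 := finrank_span_singleton (K := ℂ) hy₀
    rw [Submodule.eq_top_iff'.2 hall, finrank_top] at h1
    simp at h1
  -- A slice transversal to scaling: `s` moves along a ruling and `σ` changes the ruling. Since the
  -- kernel of `fderiv ℂ x v` is the line of `v` and `y₁` is not proportional to `y₀`, the map `x ∘
  -- ψ` has nonzero speed in the direction of `s`.
  set ψ : ℂ × ℂ → G := fun z => Φ z.2 (y₀ + z.1 • y₁) with hψ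
  have hlin : ∀ z : ℂ × ℂ, AnalyticAt ℂ (fun z : ℂ × ℂ => (y₀ + z.1 • y₁, z.2)) z := fun z =>
    (analyticAt_const.add (analyticAt_fst.smul analyticAt_const)).prod analyticAt_snd
  have hlin0 : (fun z : ℂ × ℂ => (y₀ + z.1 • y₁, z.2)) 0 = (y₀, (0 : ℂ)) := by simp
  have hψan : AnalyticAt ℂ ψ 0 := by
    refine AnalyticAt.fun_comp (g := fun z : (ℂ × ℂ) × ℂ => Φ z.2 z.1)
      (f := fun z : ℂ × ℂ => (y₀ + z.1 • y₁, z.2)) ?_ (hlin 0)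
    simpa using AnalyticAt.clm_apply_joint hΦ y₀
  have hψ0 : ψ 0 = v := by simp [hψ, hv]
  have hxψ : AnalyticAt ℂ (fun z => x (ψ z)) 0 :=
    AnalyticAt.fun_comp (g := x) (f := ψ) (by rwa [hψ0]) hψan
  have hg : ∀ i, AnalyticAt ℂ (fun z => x (ψ z) i) 0 := fun i =>
    ((ContinuousLinearMap.proj (R := ℂ) (φ := fun _ : Fin 3 => ℂ) i).analyticAt _).fun_comp hxψ
  have hψd : fderiv ℂ ψ 0 (1, 0) = Φ 0 y₁ := by
    have h1 : HasDerivAt (fun s : ℂ => (s, (0 : ℂ))) (1, 0) 0 :=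
      (hasDerivAt_id 0).prodMk (hasDerivAt_const 0 0)
    have h2 : HasFDerivAt ψ (fderiv ℂ ψ 0) ((0 : ℂ), (0 : ℂ)) := hψan.differentiableAt.hasFDerivAt
    have h3 := h2.comp_hasDerivAt (f := fun s : ℂ => (s, (0 : ℂ))) (0 : ℂ) h1
    have h4 : HasDerivAt (fun s : ℂ => Φ 0 (y₀ + s • y₁)) (Φ 0 y₁) 0 := by
      have h5 : HasDerivAt (fun s : ℂ => y₀ + s • y₁) y₁ 0 := by
        simpa using ((hasDerivAt_id (0 : ℂ)).smul_const y₁).const_add y₀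
      exact (Φ 0).hasFDerivAt.comp_hasDerivAt (0 : ℂ) h5
    exact h3.unique h4
  have hgd : ∀ i, fderiv ℂ (fun z => x (ψ z) i) 0 (1, 0) = fderiv ℂ x v (Φ 0 y₁) i := by
    intro i
    have h1 : HasFDerivAt x (fderiv ℂ x v) (ψ 0) := by
      rw [hψ0]; exact hx.differentiableAt.hasFDerivAt
    have h2 := h1.comp 0 hψan.differentiableAt.hasFDerivAt
    have h3 := (ContinuousLinearMap.proj (R := ℂ) (φ := fun _ : Fin 3 => ℂ) i).hasFDerivAt.comp
      (0 : ℂ × ℂ) h2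
    have h4 : HasFDerivAt (fun z => x (ψ z) i) _ 0 := h3
    rw [h4.fderiv]
    simp [hψd]
  have hd : ¬ (fderiv ℂ (fun z => x (ψ z) 0) 0 (1, 0) = 0 ∧
      fderiv ℂ (fun z => x (ψ z) 1) 0 (1, 0) = 0 ∧
      fderiv ℂ (fun z => x (ψ z) 2) 0 (1, 0) = 0) := by
    rintro ⟨h0, h1, h2⟩
    rw [hgd] at h0 h1 h2
    have h3 : Φ 0 y₁ ∈ LinearMap.ker (fderiv ℂ x v : G →ₗ[ℂ] (Fin 3 → ℂ)) := by
      show fderiv ℂ x v (Φ 0 y₁) = 0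
      ext i
      fin_cases i
      exacts [h0, h1, h2]
    rw [hker] at h3
    obtain ⟨a, ha⟩ := Submodule.mem_span_singleton.1 h3
    rw [hv, ← map_smul] at ha
    exact hy₁ (Submodule.mem_span_singleton.2 ⟨a, hinj ha⟩)
  -- The coordinates `x` determine points only up to scaling; the normalization `ν = 1` makes `(x,
  -- ν)` locally injective, so that `x = 0` recovers `v` itself.
  obtain ⟨ν, hν⟩ := SeparatingDual.exists_eq_one (R := ℂ) hv0
  have hpair : HasStrictFDerivAt (fun w => (x w, ν w)) ((fderiv ℂ x v).prod ν) v :=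
    hx.hasStrictFDerivAt.prodMk ν.hasStrictFDerivAt
  obtain ⟨U, hU, hUinj⟩ := exists_injOn_nhds hpair (by
    refine (injective_iff_map_eq_zero _).2 fun w hw => ?_
    have h1 : w ∈ LinearMap.ker (fderiv ℂ x v : G →ₗ[ℂ] (Fin 3 → ℂ)) := congrArg Prod.fst hw
    have h2 : ν w = 0 := congrArg Prod.snd hw
    rw [hker] at h1
    obtain ⟨a, rfl⟩ := Submodule.mem_span_singleton.1 h1
    rw [map_smul, hν, smul_eq_mul, mul_one] at h2
    rw [h2, zero_smul])
  have hνψ : ContinuousAt (fun z => ν (ψ z)) 0 := ν.continuous.continuousAt.comp hψan.continuousAt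
  have hνψ0 : ν (ψ 0) ≠ 0 := by rw [hψ0, hν]; exact one_ne_zero
  have hN' : {z | ν (ψ z) ≠ 0 ∧ (ν (ψ z))⁻¹ • ψ z ∈ U} ∈ 𝓝 (0 : ℂ × ℂ) := by
    have h1 : ContinuousAt (fun z => (ν (ψ z))⁻¹ • ψ z) 0 :=
      (hνψ.inv₀ hνψ0).smul hψan.continuousAt
    have h2 : (fun z => (ν (ψ z))⁻¹ • ψ z) 0 = v := by simp [hψ0, hν]
    exact (hνψ.eventually_ne hνψ0).and (h1 (by rwa [h2]))
  have hlinc := (hlin 0).continuousAt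
  have hline : ∀ᶠ s in 𝓝 (0 : ℂ), x (ψ (s, 0)) 1 = 0 := by
    have h1 : ContinuousAt (fun s : ℂ => y₀ + s • y₁) 0 := by fun_prop
    have h2 : N ∈ 𝓝 ((fun s : ℂ => y₀ + s • y₁) 0) := by simpa using hN
    filter_upwards [h1 h2] with s hs using hcon _ hs
  have heqψ : ∀ᶠ z in 𝓝 (0 : ℂ × ℂ), x (ψ z) 0 ^ 2 = x (ψ z) 1 ^ 2 * x (ψ z) 2 := by
    rw [← hlin0] at heq
    exact hlinc.eventually heq
  filter_upwards [eventually_exists_zero_of_sq_eq (hg 0) (hg 1) (hg 2) heqψ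
    (by simp [hψ0, hx0]) hline hd hN'] with σ hσ
  obtain ⟨s, ⟨hs0, hsU⟩, h0, h1, h2⟩ := hσ
  have h3 : x (ψ (s, σ)) = 0 := by
    ext i
    fin_cases i
    exacts [h0, h1, h2]
  have h4 : (ν (ψ (s, σ)))⁻¹ • ψ (s, σ) = v := by
    refine hUinj hsU (mem_of_mem_nhds hU) ?_
    show (x _, ν _) = (x v, ν v)
    rw [hhom _ _ (inv_ne_zero hs0), h3, hx0, map_smul, hν, smul_eq_mul, inv_mul_cancel₀ hs0]
  refine ⟨(ν (ψ (s, σ)))⁻¹ • (y₀ + s • y₁), ?_⟩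
  show Φ σ _ = v
  rw [map_smul, ← h4]

end PinchPoint

/-! ### Parametrization of the scroll -/

section ScrollMap

variable (d₁ d₂ : ℕ)

/-- The point `(p₀ ^ d₂, p₀ ^ (d₂ - 1) p₁, …, p₁ ^ d₂, 0, …, 0)`. -/
def directrixLeft (p : ℂ × ℂ) : ScrollIndex d₁ d₂ → ℂ :=
  Sum.elim (fun j => p.1 ^ (d₂ - (j : ℕ)) * p.2 ^ (j : ℕ)) (fun _ => 0)

/-- The point `(0, …, 0, p₀ ^ d₁, p₀ ^ (d₁ - 1) p₁, …, p₁ ^ d₁)`. -/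
def directrixRight (p : ℂ × ℂ) : ScrollIndex d₁ d₂ → ℂ :=
  Sum.elim (fun _ => 0) (fun j => p.1 ^ (d₁ - (j : ℕ)) * p.2 ^ (j : ℕ))

/-- The linear parametrization of the ruling of the scroll over the point of the projective line
with homogeneous coordinates `p`. -/
noncomputable def scrollMap (p : ℂ × ℂ) : (ℂ × ℂ) →L[ℂ] (ScrollIndex d₁ d₂ → ℂ) :=
  (ContinuousLinearMap.fst ℂ ℂ ℂ).smulRight (directrixLeft d₁ d₂ p) +
    (ContinuousLinearMap.snd ℂ ℂ ℂ).smulRight (directrixRight d₁ d₂ p)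

variable {d₁ d₂}

theorem scrollMap_apply (p y : ℂ × ℂ) :
    scrollMap d₁ d₂ p y = y.1 • directrixLeft d₁ d₂ p + y.2 • directrixRight d₁ d₂ p := rfl

theorem scrollMap_inl (p y : ℂ × ℂ) (j : Fin (d₂ + 1)) :
    scrollMap d₁ d₂ p y (Sum.inl j) = y.1 * (p.1 ^ (d₂ - (j : ℕ)) * p.2 ^ (j : ℕ)) := by
  simp [scrollMap_apply, directrixLeft, directrixRight]

theorem scrollMap_inr (p y : ℂ × ℂ) (j : Fin (d₁ + 1)) :
    scrollMap d₁ d₂ p y (Sum.inr j) = y.2 * (p.1 ^ (d₁ - (j : ℕ)) * p.2 ^ (j : ℕ)) := by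
  simp [scrollMap_apply, directrixLeft, directrixRight]

/-- The directrices are homogeneous of degrees `d₂` and `d₁` in `p`. Hence rescaling `p` merely
reparametrizes the ruling, which depends only on a point of `ℙ¹`. -/
theorem scrollMap_smul (c : ℂ) (p y : ℂ × ℂ) :
    scrollMap d₁ d₂ (c • p) y = scrollMap d₁ d₂ p (c ^ d₂ * y.1, c ^ d₁ * y.2) := by
  ext i
  rcases i with j | j
  · rw [scrollMap_inl, scrollMap_inl]
    have : c ^ d₂ = c ^ (d₂ - (j : ℕ)) * c ^ (j : ℕ) := by rw [← pow_add]; congr 1; omega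
    simp only [Prod.smul_fst, Prod.smul_snd, smul_eq_mul, mul_pow, this]
    ring
  · rw [scrollMap_inr, scrollMap_inr]
    have : c ^ d₁ = c ^ (d₁ - (j : ℕ)) * c ^ (j : ℕ) := by rw [← pow_add]; congr 1; omega
    simp only [Prod.smul_fst, Prod.smul_snd, smul_eq_mul, mul_pow, this]
    ring

theorem scrollMap_injective {p : ℂ × ℂ} (hp : p ≠ 0) : Function.Injective (scrollMap d₁ d₂ p) := by
  refine (injective_iff_map_eq_zero _).2 fun y hy => ?_
  by_cases h : p.1 = 0
  · have h2 : p.2 ≠ 0 := fun h2 => hp (Prod.ext h h2)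
    have hl := congrFun hy (Sum.inl (Fin.last d₂))
    have hr := congrFun hy (Sum.inr (Fin.last d₁))
    rw [scrollMap_inl] at hl
    rw [scrollMap_inr] at hr
    ext
    · simpa [h2] using hl
    · simpa [h2] using hr
  · have hl := congrFun hy (Sum.inl 0)
    have hr := congrFun hy (Sum.inr 0)
    rw [scrollMap_inl] at hl
    rw [scrollMap_inr] at hr
    ext
    · simpa [h] using hl
    · simpa [h] using hr

/-- The index of the first entry of a column of the matrix whose minors define the scroll. -/
def lowIndex : Fin d₂ ⊕ Fin d₁ → ScrollIndex d₁ d₂ := Sum.map Fin.castSucc Fin.castSucc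

/-- The index of the second entry of a column of the matrix whose minors define the scroll. -/
def highIndex : Fin d₂ ⊕ Fin d₁ → ScrollIndex d₁ d₂ := Sum.map Fin.succ Fin.succ

/-- Consecutive entries within each block have the ratio `p.1 : p.2`. These linear equations cut out
the ruling over `p`, and eliminating `p` gives the minors that define the scroll. -/
theorem scrollMap_column (p y : ℂ × ℂ) (c : Fin d₂ ⊕ Fin d₁) :
    p.2 * scrollMap d₁ d₂ p y (lowIndex c) = p.1 * scrollMap d₁ d₂ p y (highIndex c) := by
  rcases c with j | j
  · simp only [lowIndex, highIndex, Sum.map_inl, scrollMap_inl, Fin.val_castSucc, Fin.val_succ]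
    have : d₂ - (j : ℕ) = (d₂ - ((j : ℕ) + 1)) + 1 := by omega
    rw [this, pow_succ, pow_succ]; ring
  · simp only [lowIndex, highIndex, Sum.map_inr, scrollMap_inr, Fin.val_castSucc, Fin.val_succ]
    have : d₁ - (j : ℕ) = (d₁ - ((j : ℕ) + 1)) + 1 := by omega
    rw [this, pow_succ, pow_succ]; ring

/-- As both degrees are positive, every coordinate occurs in some column; a block of degree zero
would contribute none. -/
theorem eq_zero_of_columns (hd₁ : 1 ≤ d₁) (hd₂ : 1 ≤ d₂) {x : ScrollIndex d₁ d₂ → ℂ}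
    (hl : ∀ c, x (lowIndex c) = 0) (hh : ∀ c, x (highIndex c) = 0) : x = 0 := by
  ext i
  rcases i with j | j
  · rcases Fin.eq_castSucc_or_eq_last j with ⟨k, rfl⟩ | rfl
    · exact hl (Sum.inl k)
    · have := hh (Sum.inl ⟨d₂ - 1, by omega⟩)
      refine Eq.trans ?_ this
      simp only [highIndex, Sum.map_inl]; congr 2
      ext; simp; omega
  · rcases Fin.eq_castSucc_or_eq_last j with ⟨k, rfl⟩ | rfl
    · exact hl (Sum.inr k)
    · have := hh (Sum.inr ⟨d₁ - 1, by omega⟩)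
      refine Eq.trans ?_ this
      simp only [highIndex, Sum.map_inr]; congr 2
      ext; simp; omega

/-- Different rulings of the scroll are disjoint. -/
theorem scrollMap_eq_zero_of_eq (hd₁ : 1 ≤ d₁) (hd₂ : 1 ≤ d₂) {p p' y y' : ℂ × ℂ}
    (hpp' : p.1 * p'.2 ≠ p.2 * p'.1) (h : scrollMap d₁ d₂ p y = scrollMap d₁ d₂ p' y') :
    scrollMap d₁ d₂ p y = 0 := by
  have hdet : p.1 * p'.2 - p.2 * p'.1 ≠ 0 := sub_ne_zero.2 hpp'
  have h1 := scrollMap_column (d₁ := d₁) (d₂ := d₂) p y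
  have h2 := scrollMap_column (d₁ := d₁) (d₂ := d₂) p' y'
  rw [← h] at h2
  refine eq_zero_of_columns hd₁ hd₂ (fun c => ?_) fun c => ?_
  · refine (mul_eq_zero.1 (?_ : (p.1 * p'.2 - p.2 * p'.1) * _ = 0)).resolve_left hdet
    linear_combination p.1 * h2 c - p'.1 * h1 c
  · refine (mul_eq_zero.1 (?_ : (p.1 * p'.2 - p.2 * p'.1) * _ = 0)).resolve_left hdet
    linear_combination p.2 * h2 c - p'.2 * h1 c

theorem exists_geometric {d : ℕ} {p : ℂ × ℂ} (hp : p ≠ 0) {u : Fin (d + 1) → ℂ}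
    (hu : ∀ j : Fin d, p.2 * u j.castSucc = p.1 * u j.succ) :
    ∃ a, ∀ j, u j = a * (p.1 ^ (d - (j : ℕ)) * p.2 ^ (j : ℕ)) := by
  by_cases h : p.1 = 0
  · have h2 : p.2 ≠ 0 := fun h2 => hp (Prod.ext h h2)
    refine ⟨u (Fin.last d) / p.2 ^ d, fun j => ?_⟩
    rcases Fin.eq_castSucc_or_eq_last j with ⟨k, rfl⟩ | rfl
    · have h3 := hu k
      rw [h, zero_mul] at h3
      have h4 : d - (k : ℕ) ≠ 0 := by omega
      simp [(mul_eq_zero.1 h3).resolve_left h2, h, h4]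
    · simp [h2]
  · refine ⟨u 0 / p.1 ^ d, fun j => ?_⟩
    induction j using Fin.induction with
    | zero => simp [h]
    | succ k ih =>
      have h3 := hu k
      rw [ih] at h3
      have h4 : d - ((k.castSucc : Fin (d + 1)) : ℕ) = (d - ((k.succ : Fin (d + 1)) : ℕ)) + 1 := by
        simp; omega
      rw [h4, pow_succ] at h3
      have h5 : p.1 * (u k.succ - u 0 / p.1 ^ d *
          (p.1 ^ (d - ((k.succ : Fin (d + 1)) : ℕ)) * p.2 ^ ((k.succ : Fin (d + 1)) : ℕ))) = 0 := by
        rw [mul_sub, ← h3, Fin.val_succ, Fin.val_castSucc, pow_succ]; ring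
      exact sub_eq_zero.1 ((mul_eq_zero.1 h5).resolve_left h)

/-- Vanishing minors make all columns proportional to a nonzero one, which serves as `p`; both
blocks are then geometric sequences with this ratio. -/
theorem exists_scrollMap_eq (hd₁ : 1 ≤ d₁) (hd₂ : 1 ≤ d₂) {x : ScrollIndex d₁ d₂ → ℂ} (hx : x ≠ 0)
    (hminors : ∀ c c', x (lowIndex c) * x (highIndex c') = x (highIndex c) * x (lowIndex c')) :
    ∃ p : ℂ × ℂ, p ≠ 0 ∧ ∃ y, scrollMap d₁ d₂ p y = x := by
  obtain ⟨c, hc⟩ : ∃ c : Fin d₂ ⊕ Fin d₁, ((x (lowIndex c), x (highIndex c)) : ℂ × ℂ) ≠ 0 := by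
    by_contra hcon
    push Not at hcon
    exact hx (eq_zero_of_columns hd₁ hd₂ (fun c => congrArg Prod.fst (hcon c))
      fun c => congrArg Prod.snd (hcon c))
  refine ⟨_, hc, ?_⟩
  obtain ⟨a, ha⟩ := exists_geometric (u := fun j => x (Sum.inl j)) hc
    (fun j => (hminors c (Sum.inl j)).symm)
  obtain ⟨b, hb⟩ := exists_geometric (u := fun j => x (Sum.inr j)) hc
    (fun j => (hminors c (Sum.inr j)).symm)
  refine ⟨(a, b), ?_⟩
  ext i
  rcases i with j | j
  · rw [scrollMap_inl]; exact (ha j).symm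
  · rw [scrollMap_inr]; exact (hb j).symm

theorem torusVec_eq (s t : ℂ) : torusVec d₁ d₂ s t = scrollMap d₁ d₂ (1, t) (1, s) := by
  ext i
  rcases i with j | j
  · simp [scrollMap_inl, torusVec]
  · simp [scrollMap_inr, torusVec]

theorem torusVec_ne_zero (s t : ℂ) : torusVec d₁ d₂ s t ≠ 0 := by
  rw [torusVec_eq]
  intro h
  have := scrollMap_injective (by simp) (h.trans (map_zero _).symm)
  simp at this

theorem Continuous.scrollMap {X : Type*} [TopologicalSpace X] {f g : X → ℂ × ℂ}
    (hf : Continuous f) (hg : Continuous g) : Continuous fun x => scrollMap d₁ d₂ (f x) (g x) := by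
  refine continuous_pi fun i => ?_
  rcases i with j | j
  · simp only [scrollMap_inl]; fun_prop
  · simp only [scrollMap_inr]; fun_prop

theorem continuous_scrollMap :
    Continuous fun z : (ℂ × ℂ) × (ℂ × ℂ) => scrollMap d₁ d₂ z.1 z.2 :=
  Continuous.scrollMap continuous_fst continuous_snd

/-- A polynomial that vanishes on the torus orbit vanishes on the image of the parametrization. -/
theorem eval_scrollMap_eq_zero {f : MvPolynomial (ScrollIndex d₁ d₂) ℂ}
    (hf : ∀ c s t : ℂ, s ≠ 0 → t ≠ 0 → MvPolynomial.eval (c • torusVec d₁ d₂ s t) f = 0)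
    (p y : ℂ × ℂ) : MvPolynomial.eval (scrollMap d₁ d₂ p y) f = 0 := by
  have hcont : Continuous fun z : (ℂ × ℂ) × (ℂ × ℂ) =>
      MvPolynomial.eval (scrollMap d₁ d₂ z.1 z.2) f :=
    (MvPolynomial.continuous_eval f).comp continuous_scrollMap
  have hd : Dense ({0}ᶜ : Set ℂ) := dense_compl_singleton 0
  -- Where all four parameters are nonzero, the point is a multiple of a torus point; continuity
  -- gives the rest.
  have hdense : Dense ((({0}ᶜ : Set ℂ) ×ˢ ({0}ᶜ : Set ℂ)) ×ˢ (({0}ᶜ : Set ℂ) ×ˢ ({0}ᶜ : Set ℂ))) :=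
    (hd.prod hd).prod (hd.prod hd)
  refine congrFun (hcont.ext_on hdense continuous_const (g := fun _ => 0) fun z hz => ?_) (p, y)
  obtain ⟨⟨p₁, p₂⟩, ⟨a, b⟩⟩ := z
  obtain ⟨⟨h1, h2⟩, h3, h4⟩ := hz
  simp only [Set.mem_compl_iff, Set.mem_singleton_iff] at h1 h2 h3 h4
  have hc : p₁ ^ d₂ * a ≠ 0 := mul_ne_zero (pow_ne_zero _ h1) h3
  have key : scrollMap d₁ d₂ (p₁, p₂) (a, b) =
      (p₁ ^ d₂ * a) • torusVec d₁ d₂ (p₁ ^ d₁ * b / (p₁ ^ d₂ * a)) (p₂ / p₁) := by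
    have h5 : ((p₁, p₂) : ℂ × ℂ) = p₁ • (1, p₂ / p₁) := by
      ext <;> simp [mul_div_cancel₀ _ h1]
    rw [h5, scrollMap_smul, torusVec_eq, ← map_smul]
    congr 1
    ext
    · simp
    · simp only [Prod.smul_mk, smul_eq_mul, mul_div_cancel₀ _ hc]
  show MvPolynomial.eval (scrollMap d₁ d₂ (p₁, p₂) (a, b)) f = 0
  rw [key]
  exact hf _ _ _ (div_ne_zero (mul_ne_zero (pow_ne_zero _ h1) h4) hc) (div_ne_zero h2 h1)

/-- Replaces the Zariski closure by an explicit parametrization. The minors vanish on the torus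
orbit, hence on its closure, and force the parametrized form; conversely, the orbit is dense in the
parametrized set. -/
theorem mk_mem_scroll_iff (hd₁ : 1 ≤ d₁) (hd₂ : 1 ≤ d₂) {x : ScrollIndex d₁ d₂ → ℂ} (hx : x ≠ 0) :
    Projectivization.mk ℂ x hx ∈ scroll d₁ d₂ ↔
      ∃ p : ℂ × ℂ, p ≠ 0 ∧ ∃ y, scrollMap d₁ d₂ p y = x := by
  constructor
  · intro h
    refine exists_scrollMap_eq hd₁ hd₂ hx fun c c' => ?_
    have h1 := h (MvPolynomial.X (lowIndex c) * MvPolynomial.X (highIndex c') -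
      MvPolynomial.X (highIndex c) * MvPolynomial.X (lowIndex c')) (1 + 1)
      (((MvPolynomial.isHomogeneous_X _ _).mul (MvPolynomial.isHomogeneous_X _ _)).sub
        ((MvPolynomial.isHomogeneous_X _ _).mul (MvPolynomial.isHomogeneous_X _ _))) ?_ x ?_
    · simpa [sub_eq_zero] using h1
    · rintro q ⟨s, t, -, -, hq⟩ v hv
      rw [hq] at hv
      obtain ⟨a, rfl⟩ := Submodule.mem_span_singleton.1 hv
      have h2 : ∀ c : Fin d₂ ⊕ Fin d₁,
          torusVec d₁ d₂ s t (highIndex c) = t * torusVec d₁ d₂ s t (lowIndex c) := by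
        intro c
        have := scrollMap_column (d₁ := d₁) (d₂ := d₂) (1, t) (1, s) c
        rw [← torusVec_eq] at this
        simpa using this.symm
      simp only [map_sub, map_mul, MvPolynomial.eval_X, Pi.smul_apply, smul_eq_mul, h2]
      ring
    · rw [Projectivization.submodule_mk]; exact Submodule.mem_span_singleton_self x
  · rintro ⟨p, -, y, rfl⟩ f n hf hvan v hv
    rw [Projectivization.submodule_mk] at hv
    obtain ⟨a, rfl⟩ := Submodule.mem_span_singleton.1 hv
    rw [← map_smul]
    refine eval_scrollMap_eq_zero (fun c s t hs ht => ?_) _ _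
    refine hvan (Projectivization.mk ℂ _ (torusVec_ne_zero s t)) ⟨s, t, hs, ht, ?_⟩ _ ?_
    · rw [Projectivization.submodule_mk]
    · rw [Projectivization.submodule_mk]
      exact Submodule.smul_mem _ _ (Submodule.mem_span_singleton_self _)

theorem mem_cone_projImage_iff (hd₁ : 1 ≤ d₁) (hd₂ : 1 ≤ d₂) {n : ℕ}
    {L : (ScrollIndex d₁ d₂ → ℂ) →ₗ[ℂ] (Fin n → ℂ)} {w : Fin n → ℂ} (hw : w ≠ 0) :
    w ∈ cone (projImage L (scroll d₁ d₂)) ↔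
      ∃ p : ℂ × ℂ, p ≠ 0 ∧ ∃ y, L (scrollMap d₁ d₂ p y) = w := by
  constructor
  · rintro ⟨_, q, hq, hqw⟩
    rw [Projectivization.submodule_mk] at hqw
    have h1 : w ∈ q.submodule.map L := by rw [hqw]; exact Submodule.mem_span_singleton_self w
    obtain ⟨x, hx, rfl⟩ := h1
    have hx0 : x ≠ 0 := by rintro rfl; simp at hw
    have h2 : q = Projectivization.mk ℂ x hx0 := by
      rw [q.submodule_eq] at hx
      obtain ⟨a, ha⟩ := Submodule.mem_span_singleton.1 hx
      rw [← q.mk_rep, eq_comm, Projectivization.mk_eq_mk_iff']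
      exact ⟨a, ha⟩
    rw [h2] at hq
    obtain ⟨p, hp, y, rfl⟩ := (mk_mem_scroll_iff hd₁ hd₂ hx0).1 hq
    exact ⟨p, hp, y, rfl⟩
  · rintro ⟨p, hp, y, rfl⟩
    have hx0 : scrollMap d₁ d₂ p y ≠ 0 := by intro h; rw [h] at hw; simp at hw
    refine ⟨hw, _, (mk_mem_scroll_iff hd₁ hd₂ hx0).2 ⟨p, hp, y, rfl⟩, ?_⟩
    rw [Projectivization.submodule_mk, Projectivization.submodule_mk, Submodule.map_span,
      Set.image_singleton]

end ScrollMap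

/-! ### Projections of the scroll -/

section RuledFamily

variable {d₁ d₂ : ℕ} {G : Type*} [NormedAddCommGroup G] [NormedSpace ℂ G]

/-- The rulings of the image of the scroll under `L` over the parameters `p + τ • r`. -/
noncomputable def ruledFamily (L : (ScrollIndex d₁ d₂ → ℂ) →L[ℂ] G) (p r : ℂ × ℂ) (τ : ℂ) :
    (ℂ × ℂ) →L[ℂ] G :=
  L ∘L scrollMap d₁ d₂ (p + τ • r)

theorem ruledFamily_apply (L : (ScrollIndex d₁ d₂ → ℂ) →L[ℂ] G) (p r : ℂ × ℂ) (τ : ℂ) (y : ℂ × ℂ) :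
    ruledFamily L p r τ y = L (scrollMap d₁ d₂ (p + τ • r) y) := rfl

theorem ruledFamily_zero (L : (ScrollIndex d₁ d₂ → ℂ) →L[ℂ] G) (p r : ℂ × ℂ) :
    ruledFamily L p r 0 = L ∘L scrollMap d₁ d₂ p := by
  rw [ruledFamily, zero_smul, add_zero]

theorem analyticAt_scrollMap (p r : ℂ × ℂ) (a : ℂ) :
    AnalyticAt ℂ (fun τ => scrollMap d₁ d₂ (p + τ • r)) a := by
  have h1 : AnalyticAt ℂ (fun τ : ℂ => p.1 + τ * r.1) a :=
    analyticAt_const.add (analyticAt_id.mul analyticAt_const)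
  have h2 : AnalyticAt ℂ (fun τ : ℂ => p.2 + τ * r.2) a :=
    analyticAt_const.add (analyticAt_id.mul analyticAt_const)
  have hl : AnalyticAt ℂ (fun τ => directrixLeft d₁ d₂ (p + τ • r)) a := by
    refine analyticAt_pi_iff.2 fun i => ?_
    rcases i with j | j
    · exact (h1.pow _).mul (h2.pow _)
    · exact analyticAt_const
  have hr : AnalyticAt ℂ (fun τ => directrixRight d₁ d₂ (p + τ • r)) a := by
    refine analyticAt_pi_iff.2 fun i => ?_
    rcases i with j | j
    · exact analyticAt_const
    · exact (h1.pow _).mul (h2.pow _)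
  exact (((ContinuousLinearMap.smulRightL ℂ (ℂ × ℂ) (ScrollIndex d₁ d₂ → ℂ)
      (ContinuousLinearMap.fst ℂ ℂ ℂ)).analyticAt _).comp hl).add
    (((ContinuousLinearMap.smulRightL ℂ (ℂ × ℂ) (ScrollIndex d₁ d₂ → ℂ)
      (ContinuousLinearMap.snd ℂ ℂ ℂ)).analyticAt _).comp hr)

theorem analyticAt_ruledFamily (L : (ScrollIndex d₁ d₂ → ℂ) →L[ℂ] G) (p r : ℂ × ℂ) (a : ℂ) :
    AnalyticAt ℂ (ruledFamily L p r) a :=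
  ((ContinuousLinearMap.compL ℂ (ℂ × ℂ) (ScrollIndex d₁ d₂ → ℂ) G L).analyticAt _).comp
    (analyticAt_scrollMap p r a)

/-- The derivative of the parametrization of the rulings of the scroll. -/
noncomputable def scrollDeriv (d₁ d₂ : ℕ) (p r : ℂ × ℂ) :
    (ℂ × ℂ) →L[ℂ] (ScrollIndex d₁ d₂ → ℂ) :=
  deriv (fun τ : ℂ => scrollMap d₁ d₂ (p + τ • r)) 0

theorem deriv_ruledFamily (L : (ScrollIndex d₁ d₂ → ℂ) →L[ℂ] G) (p r : ℂ × ℂ) :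
    deriv (ruledFamily L p r) 0 = L ∘L scrollDeriv d₁ d₂ p r :=
  ((ContinuousLinearMap.compL ℂ (ℂ × ℂ) (ScrollIndex d₁ d₂ → ℂ) G L).hasFDerivAt.comp_hasDerivAt
    (0 : ℂ) (analyticAt_scrollMap p r 0).differentiableAt.hasDerivAt).deriv

theorem ruledFamily_add (L : (ScrollIndex d₁ d₂ → ℂ) →L[ℂ] G) (p r : ℂ × ℂ) (a τ : ℂ) :
    ruledFamily L (p + a • r) r τ = ruledFamily L p r (a + τ) := by
  rw [ruledFamily, ruledFamily, add_smul, add_assoc]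

theorem deriv_ruledFamily_add (L : (ScrollIndex d₁ d₂ → ℂ) →L[ℂ] G) (p r : ℂ × ℂ) (a : ℂ) :
    deriv (ruledFamily L (p + a • r) r) 0 = deriv (ruledFamily L p r) a := by
  have : ruledFamily L (p + a • r) r = fun τ => ruledFamily L p r (a + τ) := by
    ext1 τ; exact ruledFamily_add L p r a τ
  rw [this, deriv_comp_const_add, add_zero]

theorem add_smul_ne_zero {p r : ℂ × ℂ} (hpr : p.1 * r.2 ≠ p.2 * r.1) (τ : ℂ) : p + τ • r ≠ 0 := by
  intro h
  have h1 : p.1 + τ * r.1 = 0 := congrArg Prod.fst h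
  have h2 : p.2 + τ * r.2 = 0 := congrArg Prod.snd h
  exact hpr (by linear_combination r.2 * h1 - r.1 * h2)

theorem ruledFamily_injective {L : (ScrollIndex d₁ d₂ → ℂ) →L[ℂ] G}
    (hL : ∀ p : ℂ × ℂ, p ≠ 0 → ∀ y, L (scrollMap d₁ d₂ p y) = 0 → y = 0) {p r : ℂ × ℂ}
    (hpr : p.1 * r.2 ≠ p.2 * r.1) (τ : ℂ) : Function.Injective (ruledFamily L p r τ) :=
  (injective_iff_map_eq_zero _).2 fun y hy => hL _ (add_smul_ne_zero hpr τ) y hy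

theorem exists_norm_eq_one {p : ℂ × ℂ} (hp : p ≠ 0) (y : ℂ × ℂ) :
    ∃ (c : ℂ) (p' y' : ℂ × ℂ), c ≠ 0 ∧ ‖p'‖ = 1 ∧ p = c • p' ∧
      scrollMap d₁ d₂ p' y' = scrollMap d₁ d₂ p y := by
  have hn : (‖p‖ : ℂ) ≠ 0 := by exact_mod_cast norm_ne_zero_iff.2 hp
  have hp' : p = (‖p‖ : ℂ) • ((‖p‖ : ℂ)⁻¹ • p) := by rw [smul_inv_smul₀ hn]
  refine ⟨‖p‖, (‖p‖ : ℂ)⁻¹ • p, ((‖p‖ : ℂ) ^ d₂ * y.1, (‖p‖ : ℂ) ^ d₁ * y.2), hn, ?_, hp', ?_⟩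
  · rw [norm_smul, norm_inv, Complex.norm_real, norm_norm, inv_mul_cancel₀ (norm_ne_zero_iff.2 hp)]
  · rw [← scrollMap_smul, ← hp']

/-- A linear projection which is defined on the whole scroll is proper. -/
theorem exists_norm_le {L : (ScrollIndex d₁ d₂ → ℂ) →L[ℂ] G}
    (hL : ∀ p : ℂ × ℂ, p ≠ 0 → ∀ y, L (scrollMap d₁ d₂ p y) = 0 → y = 0) :
    ∃ C : ℝ, ∀ p : ℂ × ℂ, ‖p‖ = 1 → ∀ y, ‖y‖ ≤ C * ‖L (scrollMap d₁ d₂ p y)‖ := by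
  -- By homogeneity in `y` the bound reduces to this compact set, on which the norm of the image has
  -- a positive minimum.
  set K : Set ((ℂ × ℂ) × (ℂ × ℂ)) := Metric.sphere 0 1 ×ˢ Metric.sphere 0 1 with hK
  have hKc : IsCompact K := (isCompact_sphere _ _).prod (isCompact_sphere _ _)
  have hmem : (((1, 0), (1, 0)) : (ℂ × ℂ) × (ℂ × ℂ)) ∈ K := by
    constructor <;> simp [Prod.norm_def]
  have hcont : Continuous fun z : (ℂ × ℂ) × (ℂ × ℂ) => ‖L (scrollMap d₁ d₂ z.1 z.2)‖ :=
    (L.continuous.comp continuous_scrollMap).norm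
  obtain ⟨z, hz, hmin⟩ := hKc.exists_isMinOn ⟨_, hmem⟩ hcont.continuousOn
  have hz1 : z.1 ≠ 0 := fun h => by have := hz.1; simp [h] at this
  have hz2 : z.2 ≠ 0 := fun h => by have := hz.2; simp [h] at this
  have hpos : 0 < ‖L (scrollMap d₁ d₂ z.1 z.2)‖ := by
    rw [norm_pos_iff]; exact fun h => hz2 (hL _ hz1 _ h)
  refine ⟨‖L (scrollMap d₁ d₂ z.1 z.2)‖⁻¹, fun p hp y => ?_⟩
  by_cases hy : y = 0
  · simp [hy]
  have hn : (‖y‖ : ℂ) ≠ 0 := by exact_mod_cast norm_ne_zero_iff.2 hy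
  have h1 : (p, (‖y‖ : ℂ)⁻¹ • y) ∈ K := by
    refine ⟨by simpa using hp, ?_⟩
    rw [mem_sphere_zero_iff_norm, norm_smul, norm_inv, Complex.norm_real, norm_norm,
      inv_mul_cancel₀ (norm_ne_zero_iff.2 hy)]
  have h2 := isMinOn_iff.1 hmin _ h1
  dsimp only at h2
  rw [ContinuousLinearMap.map_smul, ContinuousLinearMap.map_smul, norm_smul, norm_inv,
    Complex.norm_real, norm_norm] at h2
  have hy' : 0 < ‖y‖ := norm_pos_iff.2 hy
  rw [inv_mul_eq_div, le_div_iff₀ hy'] at h2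
  rw [inv_mul_eq_div, le_div_iff₀ hpos, mul_comm]
  exact h2

/-- Membership in the range of an analytic family of injective linear maps is an analytic
condition. -/
theorem exists_analytic_obstruction [FiniteDimensional ℂ G] {Φ : ℂ → (ℂ × ℂ) →L[ℂ] G} {a : ℂ}
    (hΦ : AnalyticAt ℂ Φ a) (hinj : Function.Injective (Φ a)) (v : G) :
    ∃ (y : ℂ → ℂ × ℂ) (δ : ℂ → G), AnalyticAt ℂ y a ∧ AnalyticAt ℂ δ a ∧
      ∀ᶠ τ in 𝓝 a, (δ τ = 0 → Φ τ (y τ) = v) ∧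
        (v ∈ LinearMap.range (Φ τ : (ℂ × ℂ) →ₗ[ℂ] G) → δ τ = 0) := by
  -- The fixed complement `C` of the range at `a` remains a complement nearby; `δ τ` is the
  -- component in `C` of `v` when split along the range of `Φ τ` and `C`.
  obtain ⟨C, hC⟩ := (LinearMap.range (Φ a : (ℂ × ℂ) →ₗ[ℂ] G)).exists_isCompl
  set T : ℂ → ((ℂ × ℂ) × C) →L[ℂ] G := fun τ =>
    (Φ τ) ∘L ContinuousLinearMap.fst ℂ (ℂ × ℂ) C +
      C.subtypeL ∘L ContinuousLinearMap.snd ℂ (ℂ × ℂ) C with hT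
  have hTapp : ∀ τ y (c : C), T τ (y, c) = Φ τ y + c := fun τ y c => rfl
  have hTan : AnalyticAt ℂ T a :=
    AnalyticAt.add ((((ContinuousLinearMap.compL ℂ ((ℂ × ℂ) × C) (ℂ × ℂ) G).flip
        (ContinuousLinearMap.fst ℂ (ℂ × ℂ) C)).analyticAt _).comp hΦ) analyticAt_const
  have hbij : Function.Bijective (T a) := by
    constructor
    · refine (injective_iff_map_eq_zero _).2 ?_
      rintro ⟨x, c⟩ hx
      rw [hTapp] at hx
      have h2 : Φ a x ∈ C := by
        rw [eq_neg_of_add_eq_zero_left hx]; exact C.neg_mem c.2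
      have h3 := Submodule.disjoint_def.1 hC.disjoint _ ⟨x, rfl⟩ h2
      have h3' : Φ a x = 0 := h3
      have h4 : x = 0 := hinj (by simpa using h3')
      rw [h3', zero_add] at hx
      have h5 : c = 0 := Subtype.ext hx
      rw [h4, h5]; rfl
    · intro w
      have hw : w ∈ LinearMap.range (Φ a : (ℂ × ℂ) →ₗ[ℂ] G) ⊔ C := by rw [hC.sup_eq_top]; trivial
      obtain ⟨_, ⟨x, rfl⟩, c, hc, rfl⟩ := Submodule.mem_sup.1 hw
      exact ⟨(x, ⟨c, hc⟩), rfl⟩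
  obtain ⟨s, hs, hsol⟩ := exists_analytic_solution hTan hbij v
  refine ⟨fun τ => (s τ).1, fun τ => ((s τ).2 : G),
    ((ContinuousLinearMap.fst ℂ (ℂ × ℂ) C).analyticAt _).comp hs,
    ((C.subtypeL ∘L ContinuousLinearMap.snd ℂ (ℂ × ℂ) C).analyticAt _).comp hs, ?_⟩
  filter_upwards [hsol] with τ hτ
  have h1 : Φ τ (s τ).1 + ((s τ).2 : G) = v := hτ.1
  constructor
  · intro h; rwa [h, add_zero] at h1
  · rintro ⟨y, hy⟩
    have h2 : T τ (y, 0) = v := by rw [hTapp]; simpa using hy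
    have h3 := hτ.2 (h2.trans hτ.1.symm)
    rw [← h3]; rfl

/-- The image of the scroll under a linear projection which is defined on the whole scroll is not
a cone, even locally. -/
theorem not_eventually_mem_range [FiniteDimensional ℂ G] (hd₁ : 1 ≤ d₁) (hd₂ : 1 ≤ d₂)
    {L : (ScrollIndex d₁ d₂ → ℂ) →L[ℂ] G}
    (hL : ∀ p : ℂ × ℂ, p ≠ 0 → ∀ y, L (scrollMap d₁ d₂ p y) = 0 → y = 0) {p r : ℂ × ℂ}
    (hpr : p.1 * r.2 ≠ p.2 * r.1) {v : G} (hv : v ≠ 0) :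
    ¬ ∀ᶠ τ in 𝓝 (0 : ℂ), v ∈ LinearMap.range (ruledFamily L p r τ : (ℂ × ℂ) →ₗ[ℂ] G) := by
  intro h0
  set Φ := ruledFamily L p r with hΦ
  -- `U` is clopen: at a limit point the zeros of the obstruction `δ` accumulate, so `δ` vanishes
  -- identically nearby.
  set U : Set ℂ := {a | ∀ᶠ τ in 𝓝 a, v ∈ LinearMap.range (Φ τ : (ℂ × ℂ) →ₗ[ℂ] G)} with hU
  have hinj := ruledFamily_injective hL hpr
  have hopen : IsOpen U := isOpen_setOfPred_eventually_nhds
  have hclosed : IsClosed U := by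
    refine isClosed_of_closure_subset fun a ha => ?_
    obtain ⟨y, δ, -, hδ, hev⟩ := exists_analytic_obstruction (analyticAt_ruledFamily L p r a)
      (hinj a) v
    have hfreq : ∃ᶠ τ in 𝓝[≠] a, δ τ = 0 := by
      rw [frequently_nhdsWithin_iff, frequently_nhds_iff]
      intro V haV hV
      obtain ⟨W, hW, hWo, haW⟩ := eventually_nhds_iff.1 hev
      obtain ⟨u, ⟨huV, huW⟩, hu⟩ := mem_closure_iff.1 ha (V ∩ W) (hV.inter hWo) ⟨haV, haW⟩
      have h1 : ∀ᶠ τ in 𝓝[≠] u, τ ∈ V ∧ τ ∈ W ∧ v ∈ LinearMap.range (Φ τ : (ℂ × ℂ) →ₗ[ℂ] G) ∧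
          τ ≠ a := by
        have h2 : ∀ᶠ τ in 𝓝[≠] u, τ ≠ a := by
          by_cases hua : u = a
          · subst hua; exact self_mem_nhdsWithin
          · exact nhdsWithin_le_nhds (isOpen_ne.mem_nhds hua)
        filter_upwards [nhdsWithin_le_nhds (hV.mem_nhds huV), nhdsWithin_le_nhds (hWo.mem_nhds huW),
          nhdsWithin_le_nhds hu, h2] with τ a1 a2 a3 a4 using ⟨a1, a2, a3, a4⟩
      obtain ⟨τ, h1, h2, h3, h4⟩ := h1.exists
      exact ⟨τ, h1, (hW τ h2).2 h3, h4⟩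
    filter_upwards [hδ.frequently_zero_iff_eventually_zero.1 hfreq, hev] with τ h1 h2
    exact ⟨y τ, h2.1 h1⟩
  have huniv : U = Set.univ := IsClopen.eq_univ ⟨hclosed, hopen⟩ ⟨0, h0⟩
  have hall : ∀ τ, ∃ y, Φ τ y = v := fun τ => by
    have h1 : τ ∈ U := by rw [huniv]; trivial
    exact h1.self_of_nhds
  choose Y hY using hall
  have hYan : ∀ a, AnalyticAt ℂ Y a := by
    intro a
    obtain ⟨y, δ, hy, hδ, hev⟩ := exists_analytic_obstruction (analyticAt_ruledFamily L p r a)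
      (hinj a) v
    refine hy.congr ?_
    filter_upwards [hev] with τ hτ
    exact hinj τ ((hτ.1 (hτ.2 ⟨Y τ, hY τ⟩)).trans (hY τ).symm)
  -- An entire curve in the cone over the scroll that `L` maps to the single vector `v`. Properness
  -- of `L` bounds it, so it is constant by Liouville; as it meets different rulings, it is zero.
  set X : ℂ → (ScrollIndex d₁ d₂ → ℂ) := fun τ => scrollMap d₁ d₂ (p + τ • r) (Y τ) with hX
  have hdiff : Differentiable ℂ X := fun τ =>
    (analyticAt_scrollMap p r τ).differentiableAt.clm_apply (hYan τ).differentiableAt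
  have hLX : ∀ τ, L (X τ) = v := hY
  obtain ⟨C, hC⟩ := exists_norm_le hL
  set K : Set ((ℂ × ℂ) × (ℂ × ℂ)) := Metric.sphere 0 1 ×ˢ Metric.closedBall 0 (C * ‖v‖) with hK
  have hKc : IsCompact K := (isCompact_sphere _ _).prod (isCompact_closedBall _ _)
  have hbdd : Bornology.IsBounded (Set.range X) := by
    refine (hKc.image (continuous_scrollMap (d₁ := d₁) (d₂ := d₂))).isBounded.subset ?_
    rintro _ ⟨τ, rfl⟩
    obtain ⟨c, p', y', -, hp', -, heq⟩ := exists_norm_eq_one (d₁ := d₁) (d₂ := d₂)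
      (add_smul_ne_zero hpr τ) (Y τ)
    refine ⟨(p', y'), ⟨by simpa using hp', ?_⟩, heq⟩
    have h1 := hC p' hp' y'
    have h2 : L (scrollMap d₁ d₂ p' y') = v := by rw [heq]; exact hLX τ
    rw [h2] at h1
    simpa using h1
  have h01 := hdiff.apply_eq_apply_of_bounded hbdd 0 1
  have hX0 : X 0 = 0 := by
    refine scrollMap_eq_zero_of_eq hd₁ hd₂ ?_ h01
    simp only [zero_smul, add_zero, one_smul, Prod.fst_add, Prod.snd_add]
    intro h; exact hpr (by linear_combination h)
  exact hv (by rw [← hLX 0, hX0, map_zero])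

end RuledFamily

/-! ### Birationality excludes double points on smooth hypersurfaces -/

section DoublePoints

variable {d₁ d₂ : ℕ}

/-- A polynomial that vanishes on an open subset of the cone over the scroll vanishes on the
scroll. -/
theorem eval_eq_zero_of_eventually {f : MvPolynomial (ScrollIndex d₁ d₂) ℂ} {p r : ℂ × ℂ}
    (hpr : p.1 * r.2 ≠ p.2 * r.1) {y : ℂ × ℂ}
    (hf : ∀ᶠ x : (ℂ × ℂ) × ℂ in 𝓝 (y, 0),
      MvPolynomial.eval (scrollMap d₁ d₂ (p + x.2 • r) x.1) f = 0) (p' y' : ℂ × ℂ) :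
    MvPolynomial.eval (scrollMap d₁ d₂ p' y') f = 0 := by
  have han : AnalyticOnNhd ℂ (fun x : (ℂ × ℂ) × ℂ =>
      MvPolynomial.eval (scrollMap d₁ d₂ (p + x.2 • r) x.1) f) Set.univ := by
    rintro ⟨z, a⟩ -
    exact AnalyticAt.fun_comp (g := fun w => MvPolynomial.eval w f)
      (AnalyticOnNhd.eval_mvPolynomial f _ (Set.mem_univ _))
      (AnalyticAt.clm_apply_joint (analyticAt_scrollMap p r a) z)
  have hzero : ∀ x : (ℂ × ℂ) × ℂ, MvPolynomial.eval (scrollMap d₁ d₂ (p + x.2 • r) x.1) f = 0 :=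
    fun x => han.eqOn_zero_of_preconnected_of_eventuallyEq_zero isPreconnected_univ
      (Set.mem_univ _) hf (Set.mem_univ x)
  have hdet : p.1 * r.2 - p.2 * r.1 ≠ 0 := sub_ne_zero.2 hpr
  -- The family `p + τ • r` misses only the direction of `r`. The parameters `α • p + β • r` with `α
  -- ≠ 0` are rescalings of its members, and continuity in `α` covers `α = 0`.
  set β := (p.1 * p'.2 - p.2 * p'.1) / (p.1 * r.2 - p.2 * r.1) with hβ
  have hc : Continuous fun α : ℂ => α • p + β • r := by fun_prop
  have hcont : Continuous fun α : ℂ =>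
      MvPolynomial.eval (scrollMap d₁ d₂ (α • p + β • r) y') f :=
    (MvPolynomial.continuous_eval f).comp (Continuous.scrollMap hc continuous_const)
  have hp' : p' = ((p'.1 * r.2 - p'.2 * r.1) / (p.1 * r.2 - p.2 * r.1)) • p + β • r := by
    ext
    · simp only [Prod.fst_add, Prod.smul_fst, smul_eq_mul, hβ]
      rw [div_mul_eq_mul_div, div_mul_eq_mul_div, ← add_div, eq_div_iff hdet]; ring
    · simp only [Prod.snd_add, Prod.smul_snd, smul_eq_mul, hβ]
      rw [div_mul_eq_mul_div, div_mul_eq_mul_div, ← add_div, eq_div_iff hdet]; ring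
  have hfun := hcont.ext_on (dense_compl_singleton 0) continuous_const (g := fun _ => 0)
    fun α hα => ?_
  · have h3 := congrFun hfun ((p'.1 * r.2 - p'.2 * r.1) / (p.1 * r.2 - p.2 * r.1))
    rwa [← hp'] at h3
  · have hα' : α ≠ 0 := hα
    have h2 : α • p + β • r = α • (p + (β / α) • r) := by
      rw [smul_add, smul_smul, mul_div_cancel₀ _ hα']
    show MvPolynomial.eval (scrollMap d₁ d₂ (α • p + β • r) y') f = 0
    rw [h2, scrollMap_smul]
    exact hzero (_, β / α)

theorem scroll_subset_of_eventually (hd₁ : 1 ≤ d₁) (hd₂ : 1 ≤ d₂)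
    {Z : Set (ℙ ℂ (ScrollIndex d₁ d₂ → ℂ))} (hZ : IsZariskiClosed Z) {p r : ℂ × ℂ}
    (hpr : p.1 * r.2 ≠ p.2 * r.1) {y : ℂ × ℂ}
    (h : ∀ᶠ x : (ℂ × ℂ) × ℂ in 𝓝 (y, 0), ∃ hx : scrollMap d₁ d₂ (p + x.2 • r) x.1 ≠ 0,
      Projectivization.mk ℂ _ hx ∈ Z) : scroll d₁ d₂ ⊆ Z := by
  intro q hq
  rw [← hZ]
  intro f n hf hvan w hw
  have hq' := hq
  rw [← q.mk_rep, mk_mem_scroll_iff hd₁ hd₂] at hq'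
  obtain ⟨p', -, y', hy'⟩ := hq'
  rw [q.submodule_eq, ← hy'] at hw
  obtain ⟨a, rfl⟩ := Submodule.mem_span_singleton.1 hw
  rw [← map_smul]
  refine eval_eq_zero_of_eventually hpr (h.mono fun x hx => ?_) p' _
  obtain ⟨hx0, hx⟩ := hx
  refine hvan _ hx _ ?_
  rw [Projectivization.submodule_mk]
  exact Submodule.mem_span_singleton_self _

/-- A smooth hypersurface which locally contains the birational image of the scroll has no
double points near which one of the branches is immersed. -/
theorem not_double_of_immersion (hd₁ : 1 ≤ d₁) (hd₂ : 1 ≤ d₂)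
    {L : (ScrollIndex d₁ d₂ → ℂ) →L[ℂ] (Fin 4 → ℂ)}
    (hL : ∀ p : ℂ × ℂ, p ≠ 0 → ∀ y, L (scrollMap d₁ d₂ p y) = 0 → y = 0)
    (hbir : IsBirationalOn (L : (ScrollIndex d₁ d₂ → ℂ) →ₗ[ℂ] (Fin 4 → ℂ)) (scroll d₁ d₂))
    {p₁ r₁ p₂ r₂ : ℂ × ℂ} (h₁ : p₁.1 * r₁.2 ≠ p₁.2 * r₁.1) (h₂ : p₂.1 * r₂.2 ≠ p₂.2 * r₂.1)
    (h₁₂ : p₁.1 * p₂.2 ≠ p₁.2 * p₂.1) {y₁ y₂ : ℂ × ℂ} (hy₁ : y₁ ≠ 0)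
    (heq : ruledFamily L p₁ r₁ 0 y₁ = ruledFamily L p₂ r₂ 0 y₂)
    {h : (Fin 4 → ℂ) → ℂ} (hh : AnalyticAt ℂ h (ruledFamily L p₂ r₂ 0 y₂))
    (hh' : fderiv ℂ h (ruledFamily L p₂ r₂ 0 y₂) ≠ 0)
    (hz₁ : ∀ᶠ x : (ℂ × ℂ) × ℂ in 𝓝 (y₁, 0), h (ruledFamily L p₁ r₁ x.2 x.1) = 0)
    (hz₂ : ∀ᶠ x : (ℂ × ℂ) × ℂ in 𝓝 (y₂, 0), h (ruledFamily L p₂ r₂ x.2 x.1) = 0)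
    (himm : deriv (ruledFamily L p₂ r₂) 0 y₂ ∉
      LinearMap.range (ruledFamily L p₂ r₂ 0 : (ℂ × ℂ) →ₗ[ℂ] (Fin 4 → ℂ))) : False := by
  obtain ⟨Z, hZ, hnot, hfib⟩ := hbir
  -- It suffices that all points of the scroll near the first preimage lie in the exceptional set
  -- `Z`, that is, have a second point in their fibre.
  refine hnot (scroll_subset_of_eventually hd₁ hd₂ hZ h₁ (y := y₁) ?_)
  have hdet : ∀ᶠ z : ℂ × ℂ in 𝓝 0 ×ˢ 𝓝 0, (p₁ + z.1 • r₁).1 * (p₂ + z.2 • r₂).2 ≠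
      (p₁ + z.1 • r₁).2 * (p₂ + z.2 • r₂).1 := by
    rw [← nhds_prod_eq]
    have h1 : Continuous fun z : ℂ × ℂ => (p₁ + z.1 • r₁).1 * (p₂ + z.2 • r₂).2 -
      (p₁ + z.1 • r₁).2 * (p₂ + z.2 • r₂).1 := by fun_prop
    have h2 := h1.continuousAt.eventually_ne (x := ((0, 0) : ℂ × ℂ)) (y := (0 : ℂ))
      (by simpa [sub_eq_zero] using h₁₂)
    exact h2.mono fun z hz => sub_ne_zero.1 hz
  obtain ⟨N₁, hN₁, N₂, hN₂, hN⟩ := eventually_prod_iff.1 hdet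
  have han₁ := AnalyticAt.clm_apply_joint (analyticAt_ruledFamily L p₁ r₁ 0) y₁
  have han₂ := AnalyticAt.clm_apply_joint (analyticAt_ruledFamily L p₂ r₂ 0) y₂
  have hinj := injective_fderiv_joint (analyticAt_ruledFamily L p₂ r₂ 0)
    (ruledFamily_injective hL h₂ 0) himm
  -- The immersed second branch fills the hypersurface near the common point, hence covers the first
  -- branch; `N₂` keeps its rulings away from those of the first.
  have himg := eventually_mem_image_of_eq_zero han₂.hasStrictFDerivAt hinj (by simp)
    hh.hasStrictFDerivAt hh' hz₂ (N := {x | N₂ x.2}) (continuous_snd.continuousAt.eventually hN₂)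
  have himg' : ∀ᶠ x : (ℂ × ℂ) × ℂ in 𝓝 (y₁, 0), h (ruledFamily L p₁ r₁ x.2 x.1) = 0 →
      ruledFamily L p₁ r₁ x.2 x.1 ∈
        (fun x : (ℂ × ℂ) × ℂ => ruledFamily L p₂ r₂ x.2 x.1) '' {x | N₂ x.2} := by
    refine han₁.continuousAt.eventually (p := fun w => h w = 0 → w ∈
        (fun x : (ℂ × ℂ) × ℂ => ruledFamily L p₂ r₂ x.2 x.1) '' {x | N₂ x.2}) ?_
    simpa only [heq] using himg
  have hN₁' : ∀ᶠ x : (ℂ × ℂ) × ℂ in 𝓝 (y₁, 0), N₁ x.2 := continuous_snd.continuousAt.eventually hN₁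
  have hy' : ∀ᶠ x : (ℂ × ℂ) × ℂ in 𝓝 (y₁, 0), x.1 ≠ 0 :=
    continuous_fst.continuousAt.eventually_ne hy₁
  filter_upwards [hz₁, himg', hN₁', hy'] with x hx0 hx hxN hxy
  obtain ⟨⟨y', τ'⟩, hτ', hx'⟩ := hx hx0
  have hp₁ := add_smul_ne_zero h₁ x.2
  have hp₂ := add_smul_ne_zero h₂ τ'
  have hne : scrollMap d₁ d₂ (p₁ + x.2 • r₁) x.1 ≠ 0 := fun h0 =>
    hxy (scrollMap_injective hp₁ (h0.trans (map_zero _).symm))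
  have hne' : scrollMap d₁ d₂ (p₂ + τ' • r₂) y' ≠ 0 := by
    intro h0
    have h3 : L (scrollMap d₁ d₂ (p₂ + τ' • r₂) y') =
      L (scrollMap d₁ d₂ (p₁ + x.2 • r₁) x.1) := hx'
    rw [h0, map_zero] at h3
    exact hxy (hL _ hp₁ _ h3.symm)
  refine ⟨hne, ?_⟩
  by_contra hnZ
  have h4 := hfib _ ((mk_mem_scroll_iff hd₁ hd₂ hne).2 ⟨_, hp₁, _, rfl⟩) hnZ _
    ((mk_mem_scroll_iff hd₁ hd₂ hne').2 ⟨_, hp₂, _, rfl⟩) (by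
      rw [Projectivization.submodule_mk, Projectivization.submodule_mk, Submodule.map_span,
        Submodule.map_span, Set.image_singleton, Set.image_singleton]
      congr 2)
  rw [eq_comm, Projectivization.mk_eq_mk_iff'] at h4
  obtain ⟨a, ha⟩ := h4
  rw [← map_smul] at ha
  exact hne (scrollMap_eq_zero_of_eq hd₁ hd₂ (hN hxN hτ') ha.symm)

/-- The parametrization of a birational image of the scroll is an immersion at the points where it
maps to a smooth hypersurface. -/
theorem immersion_of_smooth (hd₁ : 1 ≤ d₁) (hd₂ : 1 ≤ d₂)
    {L : (ScrollIndex d₁ d₂ → ℂ) →L[ℂ] (Fin 4 → ℂ)}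
    (hL : ∀ p : ℂ × ℂ, p ≠ 0 → ∀ y, L (scrollMap d₁ d₂ p y) = 0 → y = 0)
    (hbir : IsBirationalOn (L : (ScrollIndex d₁ d₂ → ℂ) →ₗ[ℂ] (Fin 4 → ℂ)) (scroll d₁ d₂))
    {p r : ℂ × ℂ} (hpr : p.1 * r.2 ≠ p.2 * r.1) {y : ℂ × ℂ} (hy : y ≠ 0)
    {h : (Fin 4 → ℂ) → ℂ} (hh : AnalyticAt ℂ h (ruledFamily L p r 0 y))
    (hh' : fderiv ℂ h (ruledFamily L p r 0 y) ≠ 0)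
    (hz : ∀ᶠ x : (ℂ × ℂ) × ℂ in 𝓝 (y, 0), h (ruledFamily L p r x.2 x.1) = 0) :
    deriv (ruledFamily L p r) 0 y ∉
      LinearMap.range (ruledFamily L p r 0 : (ℂ × ℂ) →ₗ[ℂ] (Fin 4 → ℂ)) := by
  intro hsing
  have hinj := ruledFamily_injective hL hpr
  have hv : ruledFamily L p r 0 y ≠ 0 := fun h0 => hy (hinj 0 (h0.trans (map_zero _).symm))
  have han := AnalyticAt.clm_apply_joint (analyticAt_ruledFamily L p r 0) y
  -- Open conditions, which therefore also hold at the two nearby preimages of the double point; the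
  -- families are then re-based at `τ₁` and `τ₂`.
  have hN : ∀ᶠ x : (ℂ × ℂ) × ℂ in 𝓝 (y, 0), x.1 ≠ 0 ∧
      AnalyticAt ℂ h (ruledFamily L p r x.2 x.1) ∧ fderiv ℂ h (ruledFamily L p r x.2 x.1) ≠ 0 ∧
      ∀ᶠ x' : (ℂ × ℂ) × ℂ in 𝓝 x, h (ruledFamily L p r x'.2 x'.1) = 0 := by
    refine Eventually.and ?_ (Eventually.and ?_ (Eventually.and ?_ hz.eventually_nhds))
    · exact continuous_fst.continuousAt.eventually_ne hy
    · exact han.continuousAt.eventually hh.eventually_analyticAt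
    · exact han.continuousAt.eventually (hh.fderiv.continuousAt.eventually_ne hh')
  obtain ⟨⟨y₁, τ₁⟩, h₁, ⟨y₂, τ₂⟩, h₂, hne, heq, himm⟩ := exists_double_point (by simp)
    (analyticAt_ruledFamily L p r 0) (hinj 0) hh hh' hz hsing
    (not_eventually_mem_range hd₁ hd₂ hL hpr hv) hN
  have hshift : ∀ a : ℂ, (p + a • r).1 * r.2 ≠ (p + a • r).2 * r.1 := fun a h0 => by
    simp only [Prod.fst_add, Prod.snd_add, Prod.smul_fst, Prod.smul_snd, smul_eq_mul] at h0
    exact hpr (by linear_combination h0)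
  have hfam : ∀ (a : ℂ) z, ruledFamily L (p + a • r) r 0 z = ruledFamily L p r a z := fun a z => by
    rw [ruledFamily_add, add_zero]
  have hzero : ∀ (a : ℂ) z, (∀ᶠ x : (ℂ × ℂ) × ℂ in 𝓝 (z, a), h (ruledFamily L p r x.2 x.1) = 0) →
      ∀ᶠ x : (ℂ × ℂ) × ℂ in 𝓝 (z, 0), h (ruledFamily L (p + a • r) r x.2 x.1) = 0 := by
    intro a z hx
    have hc : ContinuousAt (fun x : (ℂ × ℂ) × ℂ => (x.1, a + x.2)) (z, 0) := by fun_prop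
    have h3 : (fun x : (ℂ × ℂ) × ℂ => (x.1, a + x.2)) (z, 0) = (z, a) := by simp
    rw [← h3] at hx
    filter_upwards [hc.eventually hx] with x hx
    rw [ruledFamily_add]; exact hx
  obtain ⟨h₁y, -, -, h₁z⟩ := h₁
  obtain ⟨-, h₂a, h₂d, h₂z⟩ := h₂
  refine not_double_of_immersion hd₁ hd₂ hL hbir (hshift τ₁) (hshift τ₂) ?_ h₁y
    (by rw [hfam, hfam]; exact heq) (by rw [hfam]; exact h₂a) (by rw [hfam]; exact h₂d)
    (hzero _ _ h₁z) (hzero _ _ h₂z) ?_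
  · intro h0
    simp only [Prod.fst_add, Prod.snd_add, Prod.smul_fst, Prod.smul_snd, smul_eq_mul] at h0
    have h3 : (τ₂ - τ₁) * (p.1 * r.2 - p.2 * r.1) = 0 := by linear_combination h0
    rcases mul_eq_zero.1 h3 with h4 | h4
    · exact hne (sub_eq_zero.1 h4).symm
    · exact hpr (sub_eq_zero.1 h4)
  · rw [deriv_ruledFamily_add, ruledFamily_add, add_zero]; exact himm

/-- A smooth point of a birational image of the scroll lies on the image of only one ruling. -/
theorem eq_of_smooth (hd₁ : 1 ≤ d₁) (hd₂ : 1 ≤ d₂)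
    {L : (ScrollIndex d₁ d₂ → ℂ) →L[ℂ] (Fin 4 → ℂ)}
    (hL : ∀ p : ℂ × ℂ, p ≠ 0 → ∀ y, L (scrollMap d₁ d₂ p y) = 0 → y = 0)
    (hbir : IsBirationalOn (L : (ScrollIndex d₁ d₂ → ℂ) →ₗ[ℂ] (Fin 4 → ℂ)) (scroll d₁ d₂))
    {p p' : ℂ × ℂ} {y y' : ℂ × ℂ} (hy : y ≠ 0) (hy' : y' ≠ 0)
    (heq : L (scrollMap d₁ d₂ p' y') = L (scrollMap d₁ d₂ p y))
    {h : (Fin 4 → ℂ) → ℂ} (hh : AnalyticAt ℂ h (L (scrollMap d₁ d₂ p y)))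
    (hh' : fderiv ℂ h (L (scrollMap d₁ d₂ p y)) ≠ 0)
    (hz : ∀ᶠ w in 𝓝 (L (scrollMap d₁ d₂ p y)),
      (∃ p : ℂ × ℂ, p ≠ 0 ∧ ∃ y, L (scrollMap d₁ d₂ p y) = w) → h w = 0) :
    p.1 * p'.2 = p.2 * p'.1 := by
  by_contra hpp'
  have hp'p : p'.1 * p.2 ≠ p'.2 * p.1 := fun h0 => hpp' (by linear_combination -h0)
  have hzero : ∀ (q r z : ℂ × ℂ), q.1 * r.2 ≠ q.2 * r.1 →
      L (scrollMap d₁ d₂ q z) = L (scrollMap d₁ d₂ p y) →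
      ∀ᶠ x : (ℂ × ℂ) × ℂ in 𝓝 (z, 0), h (ruledFamily L q r x.2 x.1) = 0 := by
    intro q r z hqr hqz
    have han := AnalyticAt.clm_apply_joint (analyticAt_ruledFamily L q r 0) z
    have h1 : ruledFamily L q r 0 z = L (scrollMap d₁ d₂ p y) := by rw [ruledFamily_zero]; exact hqz
    have h2 : ∀ᶠ x : (ℂ × ℂ) × ℂ in 𝓝 (z, 0),
        (∃ p : ℂ × ℂ, p ≠ 0 ∧ ∃ y, L (scrollMap d₁ d₂ p y) = ruledFamily L q r x.2 x.1) →
          h (ruledFamily L q r x.2 x.1) = 0 := by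
      refine han.continuousAt.eventually (p := fun w =>
        (∃ p : ℂ × ℂ, p ≠ 0 ∧ ∃ y, L (scrollMap d₁ d₂ p y) = w) → h w = 0) ?_
      simpa only [h1] using hz
    filter_upwards [h2] with x hx
    exact hx ⟨_, add_smul_ne_zero hqr x.2, x.1, rfl⟩
  -- Each of the two parameters serves as the transversal direction for the other.
  have h0 : ruledFamily L p p' 0 y = L (scrollMap d₁ d₂ p y) := by rw [ruledFamily_zero]; rfl
  have h0' : ruledFamily L p' p 0 y' = L (scrollMap d₁ d₂ p y) := by
    rw [ruledFamily_zero]; exact heq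
  exact not_double_of_immersion hd₁ hd₂ hL hbir hp'p hpp' hp'p hy' (h0'.trans h0.symm)
    (by rwa [h0]) (by rwa [h0]) (hzero _ _ _ hp'p heq) (hzero _ _ _ hpp' rfl)
    (immersion_of_smooth hd₁ hd₂ hL hbir hpp' hy (by rwa [h0]) (by rwa [h0])
      (hzero _ _ _ hpp' rfl))

end DoublePoints

/-! ### Tangent planes of images of the scroll -/

section TangentPlanes

variable {d₁ d₂ : ℕ}

/-- If a point of the image of the scroll lies on the image of only one ruling, the nearby points
of the image have preimages near the preimage of this point. -/
theorem eventually_exists_preimage {G : Type*} [NormedAddCommGroup G] [NormedSpace ℂ G]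
    {L : (ScrollIndex d₁ d₂ → ℂ) →L[ℂ] G}
    (hL : ∀ p : ℂ × ℂ, p ≠ 0 → ∀ y, L (scrollMap d₁ d₂ p y) = 0 → y = 0)
    {p r : ℂ × ℂ} (hpr : p.1 * r.2 ≠ p.2 * r.1) {y : ℂ × ℂ}
    (huniq : ∀ p' : ℂ × ℂ, p' ≠ 0 → ∀ y', L (scrollMap d₁ d₂ p' y') = L (scrollMap d₁ d₂ p y) →
      p.1 * p'.2 = p.2 * p'.1)
    {N : Set ((ℂ × ℂ) × ℂ)} (hN : N ∈ 𝓝 (y, (0 : ℂ))) :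
    ∀ᶠ w in 𝓝 (L (scrollMap d₁ d₂ p y)),
      (∃ p' : ℂ × ℂ, p' ≠ 0 ∧ ∃ y', L (scrollMap d₁ d₂ p' y') = w) →
        ∃ x ∈ N, ruledFamily L p r x.2 x.1 = w := by
  set v := L (scrollMap d₁ d₂ p y) with hv
  have hdet : p.1 * r.2 - p.2 * r.1 ≠ 0 := sub_ne_zero.2 hpr
  obtain ⟨C, hC⟩ := exists_norm_le hL
  set K : Set ((ℂ × ℂ) × (ℂ × ℂ)) :=
    Metric.sphere 0 1 ×ˢ Metric.closedBall 0 (|C| * (‖v‖ + 1)) with hK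
  have hKc : IsCompact K := (isCompact_sphere _ _).prod (isCompact_closedBall _ _)
  set m : (ℂ × ℂ) × (ℂ × ℂ) → G := fun z => L (scrollMap d₁ d₂ z.1 z.2) with hm
  have hmc : Continuous m :=
    L.continuous.comp (Continuous.scrollMap continuous_fst continuous_snd)
  -- Normalized preimages of vectors near `v` lie in the compact set `K`. Every preimage of `v` in
  -- `K` lies in the open set `O`, so the compact image of `K \ O` stays away from `v`.
  set O : Set ((ℂ × ℂ) × (ℂ × ℂ)) :=
    interior {z | ∃ x ∈ N, ruledFamily L p r x.2 x.1 = m z} with hO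
  have hclosed : IsClosed (m '' (K \ O)) :=
    ((hKc.diff isOpen_interior).image hmc).isClosed
  have hnot : v ∉ m '' (K \ O) := by
    rintro ⟨⟨p', y'⟩, ⟨hzK, hzO⟩, hz⟩
    apply hzO
    have hp' : p' ≠ 0 := by
      rintro rfl
      have := hzK.1
      simp at this
    have h1 := huniq p' hp' y' hz
    set a : (ℂ × ℂ) × (ℂ × ℂ) → ℂ := fun z =>
      (z.1.1 * r.2 - z.1.2 * r.1) / (p.1 * r.2 - p.2 * r.1) with ha
    set b : (ℂ × ℂ) × (ℂ × ℂ) → ℂ := fun z =>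
      (p.1 * z.1.2 - p.2 * z.1.1) / (p.1 * r.2 - p.2 * r.1) with hb
    have hab : ∀ z, z.1 = a z • p + b z • r := by
      intro z
      ext
      · simp only [Prod.fst_add, Prod.smul_fst, smul_eq_mul, ha, hb]
        rw [div_mul_eq_mul_div, div_mul_eq_mul_div, ← add_div, eq_div_iff hdet]; ring
      · simp only [Prod.snd_add, Prod.smul_snd, smul_eq_mul, ha, hb]
        rw [div_mul_eq_mul_div, div_mul_eq_mul_div, ← add_div, eq_div_iff hdet]; ring
    have hb0 : b (p', y') = 0 := by simp [hb, h1]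
    have hp'a : p' = a (p', y') • p := by
      have := hab (p', y')
      rw [hb0, zero_smul, add_zero] at this
      exact this
    have ha0 : a (p', y') ≠ 0 := fun h0 => hp' (by rw [hp'a, h0, zero_smul])
    have hac : Continuous a := by
      simp only [ha]; fun_prop
    have hbc : Continuous b := by
      simp only [hb]; fun_prop
    -- From `z.1 = a • (p + (b / a) • r)` the homogeneity of `scrollMap` gives the coordinates of
    -- the same point in the family through `p`.
    set X : (ℂ × ℂ) × (ℂ × ℂ) → (ℂ × ℂ) × ℂ := fun z =>
      ((a z ^ d₂ * z.2.1, a z ^ d₁ * z.2.2), b z / a z) with hX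
    have hXc : ContinuousAt X (p', y') := by
      refine ContinuousAt.prodMk (Continuous.continuousAt (by fun_prop)) ?_
      exact hbc.continuousAt.div hac.continuousAt ha0
    have hXv : X (p', y') = (y, 0) := by
      have h2 : L (scrollMap d₁ d₂ p' y') = L (scrollMap d₁ d₂ p y) := hz
      rw [hp'a, scrollMap_smul] at h2
      have hp : p ≠ 0 := by rintro rfl; simp at hpr
      have h3 := hL p hp (_ - y) (by rw [map_sub, map_sub, h2, sub_self])
      rw [sub_eq_zero] at h3
      simp only [hX, hb0, zero_div]
      rw [h3]
    rw [hO, mem_interior_iff_mem_nhds]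
    have hev : ∀ᶠ z in 𝓝 (p', y'), X z ∈ N := hXc (by rw [hXv]; exact hN)
    filter_upwards [hev, hac.continuousAt.eventually_ne ha0] with z hz hza
    refine ⟨X z, hz, ?_⟩
    simp only [hX, hm, ruledFamily_apply]
    rw [← scrollMap_smul, smul_add, smul_smul, mul_div_cancel₀ _ hza, ← hab]
  have hnear : ∀ᶠ w in 𝓝 v, ‖w‖ ≤ ‖v‖ + 1 :=
    (continuous_norm.continuousAt.eventually (Iic_mem_nhds (lt_add_one ‖v‖)))
  filter_upwards [hclosed.isOpen_compl.mem_nhds hnot, hnear] with w hw hwn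
  rintro ⟨p', hp', y', rfl⟩
  obtain ⟨c, p'', y'', -, hp'', -, heq⟩ := exists_norm_eq_one (d₁ := d₁) (d₂ := d₂) hp' y'
  have hmem : (p'', y'') ∈ K := by
    refine ⟨by simpa using hp'', ?_⟩
    rw [mem_closedBall_zero_iff]
    refine (hC p'' hp'' y'').trans ?_
    rw [heq]
    exact mul_le_mul (le_abs_self C) hwn (norm_nonneg _) (abs_nonneg C)
  have hzO : (p'', y'') ∈ O := by
    by_contra hzO
    exact hw ⟨_, ⟨hmem, hzO⟩, by simp only [hm]; rw [heq]⟩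
  obtain ⟨x, hx, hxe⟩ := interior_subset hzO
  refine ⟨x, hx, hxe.trans ?_⟩
  simp only [hm]; rw [heq]

/-- The tangent space of the cone over the image of the scroll, spanned by the partial derivatives
of the parametrization. -/
noncomputable def tangentSpan {G : Type*} [NormedAddCommGroup G] [NormedSpace ℂ G]
    (L : (ScrollIndex d₁ d₂ → ℂ) →L[ℂ] G) (p r y : ℂ × ℂ) : Submodule ℂ G :=
  LinearMap.range (fderiv ℂ (fun x : (ℂ × ℂ) × ℂ => ruledFamily L p r x.2 x.1) (y, 0) :
    ((ℂ × ℂ) × ℂ) →ₗ[ℂ] G)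

section

variable {G : Type*} [NormedAddCommGroup G] [NormedSpace ℂ G]
  {L : (ScrollIndex d₁ d₂ → ℂ) →L[ℂ] G} {p r y : ℂ × ℂ}

theorem mem_tangentSpan {w : G} : w ∈ tangentSpan L p r y ↔
    ∃ (z : ℂ × ℂ) (t : ℂ), L (scrollMap d₁ d₂ p z) + t • L (scrollDeriv d₁ d₂ p r y) = w := by
  have h : ∀ z t, fderiv ℂ (fun x : (ℂ × ℂ) × ℂ => ruledFamily L p r x.2 x.1) (y, 0) (z, t) =
      L (scrollMap d₁ d₂ p z) + t • L (scrollDeriv d₁ d₂ p r y) := by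
    intro z t
    rw [fderiv_joint_apply (analyticAt_ruledFamily L p r 0), ruledFamily_zero, deriv_ruledFamily]
    rfl
  constructor
  · rintro ⟨⟨z, t⟩, rfl⟩
    exact ⟨z, t, (h z t).symm⟩
  · rintro ⟨z, t, rfl⟩
    exact ⟨(z, t), h z t⟩

theorem finrank_tangentSpan
    (hL : ∀ p : ℂ × ℂ, p ≠ 0 → ∀ y, L (scrollMap d₁ d₂ p y) = 0 → y = 0)
    (hpr : p.1 * r.2 ≠ p.2 * r.1)
    (himm : deriv (ruledFamily L p r) 0 y ∉
      LinearMap.range (ruledFamily L p r 0 : (ℂ × ℂ) →ₗ[ℂ] G)) :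
    Module.finrank ℂ (tangentSpan L p r y) = 3 := by
  have hinj := injective_fderiv_joint (analyticAt_ruledFamily L p r 0)
    (ruledFamily_injective hL hpr 0) himm
  rw [tangentSpan, LinearMap.finrank_range_of_inj hinj]
  simp

/-- Functions that vanish on the image of the scroll have derivative zero along the tangent
spaces. -/
theorem eventually_fderiv_eq_zero {G' : Type*} [NormedAddCommGroup G'] [NormedSpace ℂ G']
    [CompleteSpace G'] {F : G → G'} (hF : AnalyticAt ℂ F (L (scrollMap d₁ d₂ p y)))
    (hz : ∀ᶠ x : (ℂ × ℂ) × ℂ in 𝓝 (y, 0), F (ruledFamily L p r x.2 x.1) = 0) :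
    ∀ᶠ y' in 𝓝 y, ∀ u ∈ tangentSpan L p r y', fderiv ℂ F (L (scrollMap d₁ d₂ p y')) u = 0 := by
  have hc : ContinuousAt (fun y' : ℂ × ℂ => (y', (0 : ℂ))) y := by fun_prop
  have hc2 : ContinuousAt (fun y' : ℂ × ℂ => L (scrollMap d₁ d₂ p y')) y := by fun_prop
  filter_upwards [hc.eventually hz.eventually_nhds, hc2.eventually hF.eventually_analyticAt]
    with y' h1 h2
  have hj := (AnalyticAt.clm_apply_joint (analyticAt_ruledFamily L p r 0)
    y').differentiableAt.hasFDerivAt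
  have h0 : ruledFamily L p r 0 y' = L (scrollMap d₁ d₂ p y') := by rw [ruledFamily_zero]; rfl
  have h3 : HasFDerivAt F (fderiv ℂ F (L (scrollMap d₁ d₂ p y')))
      ((fun x : (ℂ × ℂ) × ℂ => ruledFamily L p r x.2 x.1) (y', 0)) := by
    simp only [h0]; exact h2.differentiableAt.hasFDerivAt
  have h4 := h3.comp (y', (0 : ℂ)) hj
  have h5 : HasFDerivAt (F ∘ fun x : (ℂ × ℂ) × ℂ => ruledFamily L p r x.2 x.1)
      (0 : ((ℂ × ℂ) × ℂ) →L[ℂ] G') (y', 0) :=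
    (hasFDerivAt_const (0 : G') (y', (0 : ℂ))).congr_of_eventuallyEq h1
  have h6 := h4.unique h5
  rintro _ ⟨x, rfl⟩
  exact ContinuousLinearMap.ext_iff.1 h6 x

end

/-- The scroll is smooth: its parametrization is an immersion. -/
theorem scrollDeriv_notMem_range (hd₁ : 1 ≤ d₁) (hd₂ : 1 ≤ d₂) {p r : ℂ × ℂ}
    (hpr : p.1 * r.2 ≠ p.2 * r.1) {y : ℂ × ℂ} (hy : y ≠ 0) (z : ℂ × ℂ) :
    scrollMap d₁ d₂ p z ≠ scrollDeriv d₁ d₂ p r y := by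
  intro hzy
  have hp : p ≠ 0 := by rintro rfl; simp at hpr
  refine hy (scrollMap_injective (d₁ := d₁) (d₂ := d₂) hp ?_)
  rw [map_zero]
  set X := scrollMap d₁ d₂ p y with hX
  have hder : HasDerivAt (fun τ : ℂ => scrollMap d₁ d₂ (p + τ • r) y) (scrollDeriv d₁ d₂ p r y) 0 := by
    have h1 := (analyticAt_scrollMap (d₁ := d₁) (d₂ := d₂) p r 0).differentiableAt.hasDerivAt
    have h2 := h1.clm_apply (hasDerivAt_const (0 : ℂ) y)
    rwa [map_zero, add_zero] at h2
  have hcoord : ∀ i, HasDerivAt (fun τ : ℂ => scrollMap d₁ d₂ (p + τ • r) y i)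
      (scrollDeriv d₁ d₂ p r y i) 0 := hasDerivAt_pi.1 hder
  have hlin : ∀ a b : ℂ, HasDerivAt (fun τ : ℂ => a + τ * b) b 0 := fun a b => by
    simpa using ((hasDerivAt_id (0 : ℂ)).mul_const b).const_add a
  -- Differentiating the column relation and subtracting that of `scrollMap d₁ d₂ p z` shows that
  -- `X` also satisfies the relations of the ruling over `r`. Both sets of relations together force
  -- `X = 0`.
  have hrel : ∀ c : Fin d₂ ⊕ Fin d₁, r.2 * X (lowIndex c) = r.1 * X (highIndex c) := by
    intro c
    have h1 := (hlin p.2 r.2).mul (hcoord (lowIndex c))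
    have h2 := (hlin p.1 r.1).mul (hcoord (highIndex c))
    have h3 : (fun τ : ℂ => (p.2 + τ * r.2) * scrollMap d₁ d₂ (p + τ • r) y (lowIndex c)) =
        fun τ : ℂ => (p.1 + τ * r.1) * scrollMap d₁ d₂ (p + τ • r) y (highIndex c) :=
      funext fun τ => scrollMap_column (p + τ • r) y c
    have h4 := h1.unique (h2.congr_of_eventuallyEq (Eq.eventuallyEq h3))
    simp only [zero_mul, add_zero, zero_smul] at h4
    have h5 := scrollMap_column (d₁ := d₁) (d₂ := d₂) p z c
    rw [hzy] at h5
    linear_combination h4 - h5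
  have hcol := scrollMap_column (d₁ := d₁) (d₂ := d₂) p y
  have hdet : p.1 * r.2 - p.2 * r.1 ≠ 0 := sub_ne_zero.2 hpr
  refine eq_zero_of_columns hd₁ hd₂ (fun c => ?_) fun c => ?_
  · refine (mul_eq_zero.1 (?_ : (p.1 * r.2 - p.2 * r.1) * _ = 0)).resolve_left hdet
    linear_combination p.1 * hrel c - r.1 * hcol c
  · refine (mul_eq_zero.1 (?_ : (p.1 * r.2 - p.2 * r.1) * _ = 0)).resolve_left hdet
    linear_combination p.2 * hrel c - r.2 * hcol c

/-- The image of the scroll is smooth at a point which has only one preimage if the projection is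
not singular at this preimage. -/
theorem hasTangentPlane_projImage (hd₁ : 1 ≤ d₁) (hd₂ : 1 ≤ d₂) {n : ℕ}
    {L : (ScrollIndex d₁ d₂ → ℂ) →L[ℂ] (Fin n → ℂ)}
    (hL : ∀ p : ℂ × ℂ, p ≠ 0 → ∀ y, L (scrollMap d₁ d₂ p y) = 0 → y = 0)
    {p r : ℂ × ℂ} (hpr : p.1 * r.2 ≠ p.2 * r.1) {y : ℂ × ℂ}
    (huniq : ∀ p' : ℂ × ℂ, p' ≠ 0 → ∀ y', L (scrollMap d₁ d₂ p' y') = L (scrollMap d₁ d₂ p y) →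
      p.1 * p'.2 = p.2 * p'.1)
    (himm : deriv (ruledFamily L p r) 0 y ∉
      LinearMap.range (ruledFamily L p r 0 : (ℂ × ℂ) →ₗ[ℂ] (Fin n → ℂ)))
    (hv : L (scrollMap d₁ d₂ p y) ≠ 0) :
    HasTangentPlane (projImage (L : (ScrollIndex d₁ d₂ → ℂ) →ₗ[ℂ] (Fin n → ℂ)) (scroll d₁ d₂))
      (Projectivization.mk ℂ _ hv) (tangentSpan L p r y) := by
  refine ⟨finrank_tangentSpan hL hpr himm, L (scrollMap d₁ d₂ p y), ?_, hv, ?_⟩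
  · rw [Projectivization.submodule_mk]; exact Submodule.mem_span_singleton_self _
  have h0 : ruledFamily L p r 0 y = L (scrollMap d₁ d₂ p y) := by rw [ruledFamily_zero]; rfl
  obtain ⟨k, F, hFan, hF0, hFs, hFk, hFi, hFz⟩ := exists_submersion_of_immersion
    (AnalyticAt.clm_apply_joint (analyticAt_ruledFamily L p r 0) y)
    (injective_fderiv_joint (analyticAt_ruledFamily L p r 0) (ruledFamily_injective hL hpr 0) himm)
    (N := Set.univ) univ_mem
  simp only [h0] at hFan hF0 hFs hFk hFi
  refine ⟨k, F, hFan, hF0, hFs, hFk, ?_⟩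
  -- Zeros of `F` are image points because `F` cuts out the immersed piece; conversely, uniqueness
  -- of the preimage rules out other branches of the image.
  filter_upwards [hFi, eventually_exists_preimage hL hpr huniq hFz, isOpen_ne.mem_nhds hv]
    with w h1 h2 h3
  rw [mem_cone_projImage_iff hd₁ hd₂ h3]
  constructor
  · intro hw
    obtain ⟨x, hx, rfl⟩ := h2 hw
    exact hx
  · intro hw
    obtain ⟨x, -, rfl⟩ := h1 hw
    exact ⟨_, add_smul_ne_zero hpr x.2, x.1, rfl⟩

/-- The span of the ruling and the tangent directions at all its points. -/
noncomputable def rulingSpan {G : Type*} [NormedAddCommGroup G] [NormedSpace ℂ G]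
    (L : (ScrollIndex d₁ d₂ → ℂ) →L[ℂ] G) (p r : ℂ × ℂ) : Submodule ℂ G :=
  LinearMap.range (L ∘L scrollMap d₁ d₂ p : (ℂ × ℂ) →ₗ[ℂ] G) ⊔
    LinearMap.range (L ∘L scrollDeriv d₁ d₂ p r : (ℂ × ℂ) →ₗ[ℂ] G)

theorem tangentSpan_le_rulingSpan {G : Type*} [NormedAddCommGroup G] [NormedSpace ℂ G]
    (L : (ScrollIndex d₁ d₂ → ℂ) →L[ℂ] G) (p r y : ℂ × ℂ) :
    tangentSpan L p r y ≤ rulingSpan L p r := by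
  intro w hw
  obtain ⟨z, t, rfl⟩ := mem_tangentSpan.1 hw
  exact Submodule.add_mem_sup ⟨z, rfl⟩ (Submodule.smul_mem _ t ⟨y, rfl⟩)

/-- If all tangent directions along a ruling span a three-dimensional space, then this is the
tangent plane at every smooth point of the image of the ruling. -/
theorem eq_rulingSpan_of_hasTangentPlane (hd₁ : 1 ≤ d₁) (hd₂ : 1 ≤ d₂) {n : ℕ}
    {L : (ScrollIndex d₁ d₂ → ℂ) →L[ℂ] (Fin n → ℂ)}
    (hL : ∀ p : ℂ × ℂ, p ≠ 0 → ∀ y, L (scrollMap d₁ d₂ p y) = 0 → y = 0)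
    {p r : ℂ × ℂ} (hpr : p.1 * r.2 ≠ p.2 * r.1)
    (hdim : Module.finrank ℂ (rulingSpan L p r) = 3)
    {q : ℙ ℂ (Fin n → ℂ)} {W : Submodule ℂ (Fin n → ℂ)}
    (hq : q.submodule ≤ LinearMap.range (L ∘L scrollMap d₁ d₂ p : (ℂ × ℂ) →ₗ[ℂ] (Fin n → ℂ)))
    (hW : HasTangentPlane
      (projImage (L : (ScrollIndex d₁ d₂ → ℂ) →ₗ[ℂ] (Fin n → ℂ)) (scroll d₁ d₂)) q W) :
    W = rulingSpan L p r := by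
  obtain ⟨hW3, v, hvq, hv0, k, F, hFan, -, -, hFk, hFc⟩ := hW
  obtain ⟨y, hy⟩ := hq hvq
  have hy' : L (scrollMap d₁ d₂ p y) = v := hy
  rw [← hy'] at hv0 hFan hFk hFc
  have h0 : ruledFamily L p r 0 y = L (scrollMap d₁ d₂ p y) := by rw [ruledFamily_zero]; rfl
  have hz : ∀ᶠ x : (ℂ × ℂ) × ℂ in 𝓝 (y, 0), F (ruledFamily L p r x.2 x.1) = 0 := by
    have hc := (AnalyticAt.clm_apply_joint (analyticAt_ruledFamily L p r 0) y).continuousAt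
    have h1 : ∀ᶠ x : (ℂ × ℂ) × ℂ in 𝓝 (y, 0), ruledFamily L p r x.2 x.1 ≠ 0 ∧
        (ruledFamily L p r x.2 x.1 ∈
          cone (projImage (L : (ScrollIndex d₁ d₂ → ℂ) →ₗ[ℂ] (Fin n → ℂ)) (scroll d₁ d₂)) ↔
          F (ruledFamily L p r x.2 x.1) = 0) := by
      refine hc.eventually (p := fun w => w ≠ 0 ∧ (w ∈ cone _ ↔ F w = 0)) ?_
      simp only [h0]
      exact (continuousAt_id.eventually_ne hv0).and hFc
    filter_upwards [h1] with x hx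
    exact hx.2.1 ((mem_cone_projImage_iff hd₁ hd₂ hx.1).2
      ⟨_, add_smul_ne_zero hpr x.2, x.1, rfl⟩)
  have hev := eventually_fderiv_eq_zero hFan hz
  suffices hle : rulingSpan L p r ≤ W by
    exact (Submodule.eq_of_le_of_finrank_eq hle (by rw [hdim, hW3])).symm
  have hWmem : ∀ u, fderiv ℂ F (L (scrollMap d₁ d₂ p y)) u = 0 → u ∈ W := by
    intro u hu; rw [← hFk]; exact hu
  -- At a point that is not immersed, `tangentSpan` is only the ruling, and a limit is needed. The
  -- tangent space at `y + ε • c` contains `ε • L (scrollDeriv d₁ d₂ p r c)`, because the part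
  -- coming from `y` lies in the ruling. Dividing by `ε` and letting `ε → 0` puts this direction
  -- into `W`.
  by_cases himm : deriv (ruledFamily L p r) 0 y ∈
      LinearMap.range (ruledFamily L p r 0 : (ℂ × ℂ) →ₗ[ℂ] (Fin n → ℂ))
  · obtain ⟨z, hzy⟩ := himm
    have hzy' : L (scrollMap d₁ d₂ p z) = L (scrollDeriv d₁ d₂ p r y) := by
      rw [ruledFamily_zero, deriv_ruledFamily] at hzy; exact hzy
    refine sup_le ?_ ?_
    · rintro _ ⟨z, rfl⟩
      exact hWmem _ (hev.self_of_nhds _ (mem_tangentSpan.2 ⟨z, 0, by simp⟩))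
    · rintro _ ⟨c, rfl⟩
      refine hWmem _ ?_
      have hlin : Continuous fun ε : ℂ => L (scrollMap d₁ d₂ p (y + ε • c)) := by fun_prop
      have hcont : ContinuousAt (fun ε : ℂ => fderiv ℂ F (L (scrollMap d₁ d₂ p (y + ε • c)))
          (L (scrollDeriv d₁ d₂ p r c))) 0 := by
        have h1 : ContinuousAt (fderiv ℂ F) (L (scrollMap d₁ d₂ p (y + (0 : ℂ) • c))) := by
          rw [zero_smul, add_zero]; exact hFan.fderiv.continuousAt
        exact (ContinuousAt.comp (f := fun ε : ℂ => L (scrollMap d₁ d₂ p (y + ε • c)))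
          (g := fderiv ℂ F) h1 hlin.continuousAt).clm_apply continuousAt_const
      have hpunct : ∀ᶠ ε in 𝓝[≠] (0 : ℂ), fderiv ℂ F (L (scrollMap d₁ d₂ p (y + ε • c)))
          (L (scrollDeriv d₁ d₂ p r c)) = 0 := by
        have h1 : ContinuousAt (fun ε : ℂ => y + ε • c) 0 := by fun_prop
        have h2 : (fun ε : ℂ => y + ε • c) 0 = y := by simp
        rw [← h2] at hev
        filter_upwards [nhdsWithin_le_nhds (h1.eventually hev), self_mem_nhdsWithin] with ε h3 hε
        have h4 : L (scrollMap d₁ d₂ p (-z)) + (1 : ℂ) • L (scrollDeriv d₁ d₂ p r (y + ε • c)) =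
            ε • L (scrollDeriv d₁ d₂ p r c) := by
          rw [map_neg, map_neg, hzy', one_smul, map_add, map_add, neg_add_cancel_left, map_smul,
            map_smul]
        have h4 := h3 _ (mem_tangentSpan.2 ⟨-z, 1, h4⟩)
        rw [map_smul] at h4
        exact (smul_eq_zero.1 h4).resolve_left hε
      have h5 := tendsto_nhds_unique (hcont.tendsto.mono_left nhdsWithin_le_nhds)
        (tendsto_const_nhds.congr' (hpunct.mono fun ε h => h.symm))
      rw [zero_smul, add_zero] at h5
      exact h5
  · have h1 : tangentSpan L p r y = rulingSpan L p r :=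
      Submodule.eq_of_le_of_finrank_eq (tangentSpan_le_rulingSpan L p r y)
        (by rw [hdim, finrank_tangentSpan hL hpr himm])
    rw [← h1]
    exact fun u hu => hWmem u (hev.self_of_nhds u hu)

/-- A projection which is singular at a point of the scroll maps the tangent direction
transversal to the ruling into the image of the ruling. -/
theorem exists_eq_of_isSingularAt (hd₁ : 1 ≤ d₁) (hd₂ : 1 ≤ d₂) {n : ℕ}
    {L : (ScrollIndex d₁ d₂ → ℂ) →L[ℂ] (Fin n → ℂ)}
    (hL : ∀ p : ℂ × ℂ, p ≠ 0 → ∀ y, L (scrollMap d₁ d₂ p y) = 0 → y = 0)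
    {P : ℙ ℂ (ScrollIndex d₁ d₂ → ℂ)}
    (hsing : IsSingularAt (L : (ScrollIndex d₁ d₂ → ℂ) →ₗ[ℂ] (Fin n → ℂ)) (scroll d₁ d₂) P)
    {p r : ℂ × ℂ} (hpr : p.1 * r.2 ≠ p.2 * r.1)
    (hP : P.submodule ≤
      LinearMap.range (scrollMap d₁ d₂ p : (ℂ × ℂ) →ₗ[ℂ] (ScrollIndex d₁ d₂ → ℂ))) :
    ∃ y : ℂ × ℂ, y ≠ 0 ∧ scrollMap d₁ d₂ p y ∈ P.submodule ∧
      ∃ z, L (scrollMap d₁ d₂ p z) = L (scrollDeriv d₁ d₂ p r y) := by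
  obtain ⟨W, ⟨hW3, v, hvP, hv0, k, F, hFan, -, -, hFk, hFc⟩, w, hwW, hw0, hLw⟩ := hsing
  obtain ⟨y, hy⟩ := hP hvP
  have hy' : scrollMap d₁ d₂ p y = v := hy
  have hp : p ≠ 0 := by rintro rfl; simp at hpr
  have hy0 : y ≠ 0 := by rintro rfl; rw [map_zero] at hy'; exact hv0 hy'.symm
  refine ⟨y, hy0, by rw [hy']; exact hvP, ?_⟩
  -- With the identity as projection, `tangentSpan` computes the tangent plane of the scroll itself.
  set I := ContinuousLinearMap.id ℂ (ScrollIndex d₁ d₂ → ℂ) with hI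
  have hId : ∀ p : ℂ × ℂ, p ≠ 0 → ∀ y, I (scrollMap d₁ d₂ p y) = 0 → y = 0 := fun p hp y h =>
    scrollMap_injective hp (h.trans (map_zero _).symm)
  have hyI : I (scrollMap d₁ d₂ p y) = v := hy'
  have h0 : ruledFamily I p r 0 y = v := by rw [ruledFamily_zero]; exact hy'
  have hz : ∀ᶠ x : (ℂ × ℂ) × ℂ in 𝓝 (y, 0), F (ruledFamily I p r x.2 x.1) = 0 := by
    have hc := (AnalyticAt.clm_apply_joint (analyticAt_ruledFamily I p r 0) y).continuousAt
    have h1 : ∀ᶠ x : (ℂ × ℂ) × ℂ in 𝓝 (y, 0), ruledFamily I p r x.2 x.1 ≠ 0 ∧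
        (ruledFamily I p r x.2 x.1 ∈ cone (scroll d₁ d₂) ↔
          F (ruledFamily I p r x.2 x.1) = 0) := by
      refine hc.eventually (p := fun w => w ≠ 0 ∧ (w ∈ cone _ ↔ F w = 0)) ?_
      simp only [h0]
      exact (continuousAt_id.eventually_ne hv0).and hFc
    filter_upwards [h1] with x hx
    exact hx.2.1 ⟨hx.1, (mk_mem_scroll_iff hd₁ hd₂ hx.1).2
      ⟨_, add_smul_ne_zero hpr x.2, x.1, rfl⟩⟩
  have hev := (eventually_fderiv_eq_zero (by rwa [hyI]) hz).self_of_nhds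
  have hle : tangentSpan I p r y ≤ W := by
    intro u hu
    rw [← hFk]
    have := hev u hu
    rwa [hyI] at this
  have himm : deriv (ruledFamily I p r) 0 y ∉
      LinearMap.range (ruledFamily I p r 0 : (ℂ × ℂ) →ₗ[ℂ] (ScrollIndex d₁ d₂ → ℂ)) := by
    rintro ⟨z, hz⟩
    rw [ruledFamily_zero, deriv_ruledFamily] at hz
    exact scrollDeriv_notMem_range hd₁ hd₂ hpr hy0 z hz
  rw [← Submodule.eq_of_le_of_finrank_eq hle
    (by rw [finrank_tangentSpan hId hpr himm, hW3])] at hwW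
  obtain ⟨z, t, rfl⟩ := mem_tangentSpan.1 hwW
  have hLw' : L (scrollMap d₁ d₂ p z + t • scrollDeriv d₁ d₂ p r y) = 0 := hLw
  rw [map_add, map_smul] at hLw'
  have ht : t ≠ 0 := by
    rintro rfl
    rw [zero_smul, add_zero] at hLw'
    exact hw0 (by simp [hL p hp z hLw'])
  refine ⟨-(t⁻¹ • z), ?_⟩
  rw [map_neg, map_neg, map_smul, map_smul, eq_neg_of_add_eq_zero_left hLw', smul_neg, neg_neg,
    inv_smul_smul₀ ht]

end TangentPlanes

/-! ### Ordinary singularities -/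

section OrdinarySingularities

variable {x : (Fin 4 → ℂ) → (Fin 3 → ℂ)} {v : Fin 4 → ℂ}

theorem surjective_fderiv_of_ker_eq (hv : v ≠ 0)
    (hker : LinearMap.ker (fderiv ℂ x v : (Fin 4 → ℂ) →ₗ[ℂ] (Fin 3 → ℂ)) = ℂ ∙ v) :
    Function.Surjective (fderiv ℂ x v) := by
  have h1 := LinearMap.finrank_range_add_finrank_ker
    (fderiv ℂ x v : (Fin 4 → ℂ) →ₗ[ℂ] (Fin 3 → ℂ))
  rw [hker, finrank_span_singleton hv] at h1
  have h2 : LinearMap.range (fderiv ℂ x v : (Fin 4 → ℂ) →ₗ[ℂ] (Fin 3 → ℂ)) = ⊤ :=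
    Submodule.eq_top_of_finrank_eq (by simp at h1 ⊢; omega)
  exact LinearMap.range_eq_top.1 h2

theorem eventually_surjective_fderiv (hx : AnalyticAt ℂ x v)
    (hs : Function.Surjective (fderiv ℂ x v)) :
    ∀ᶠ w in 𝓝 v, Function.Surjective (fderiv ℂ x w) := by
  obtain ⟨R, hR⟩ := (fderiv ℂ x v : (Fin 4 → ℂ) →ₗ[ℂ] (Fin 3 → ℂ)).exists_rightInverse_of_surjective
    (LinearMap.range_eq_top.2 hs)
  set R' : (Fin 3 → ℂ) →L[ℂ] (Fin 4 → ℂ) := LinearMap.toContinuousLinearMap R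
  have h1 : ContinuousAt (fun w => fderiv ℂ x w ∘L R') v :=
    hx.fderiv.continuousAt.clm_comp continuousAt_const
  have h2 : fderiv ℂ x v ∘L R' = 1 := by
    ext1 u
    exact LinearMap.congr_fun hR u
  have h3 : {A : (Fin 3 → ℂ) →L[ℂ] (Fin 3 → ℂ) | IsUnit A} ∈ 𝓝 (fderiv ℂ x v ∘L R') := by
    rw [h2]; exact Units.nhds (1 : ((Fin 3 → ℂ) →L[ℂ] (Fin 3 → ℂ))ˣ)
  filter_upwards [h1 h3] with w hw u
  have h4 := ContinuousLinearMap.ext_iff.1 (Ring.mul_inverse_cancel _ hw) u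
  exact ⟨R' (Ring.inverse (fderiv ℂ x w ∘L R') u), h4⟩

theorem hasFDerivAt_coord (hx : AnalyticAt ℂ x v) (i : Fin 3) :
    HasFDerivAt (fun w => x w i) ((ContinuousLinearMap.proj i) ∘L fderiv ℂ x v) v :=
  hasFDerivAt_pi'.1 hx.differentiableAt.hasFDerivAt i

theorem analyticAt_coord (hx : AnalyticAt ℂ x v) (i : Fin 3) : AnalyticAt ℂ (fun w => x w i) v :=
  analyticAt_pi_iff.1 hx i

theorem fderiv_coord_ne_zero (hx : AnalyticAt ℂ x v) (hs : Function.Surjective (fderiv ℂ x v))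
    (i : Fin 3) : fderiv ℂ (fun w => x w i) v ≠ 0 := by
  rw [(hasFDerivAt_coord hx i).fderiv]
  intro h0
  obtain ⟨u, hu⟩ := hs (Pi.single i 1)
  have := ContinuousLinearMap.ext_iff.1 h0 u
  simp [hu] at this

/-- The pinch point surface `x₀ ^ 2 = x₁ ^ 2 * x₂` is smooth outside its double line. -/
theorem fderiv_pinch_ne_zero (hx : AnalyticAt ℂ x v) (hs : Function.Surjective (fderiv ℂ x v))
    (h1 : x v 1 ≠ 0) : fderiv ℂ (fun w => x w 0 ^ 2 - x w 1 ^ 2 * x w 2) v ≠ 0 := by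
  have hd := ((hasFDerivAt_coord hx 0).pow 2).sub
    (((hasFDerivAt_coord hx 1).pow 2).mul (hasFDerivAt_coord hx 2))
  have hd' : HasFDerivAt (fun w => x w 0 ^ 2 - x w 1 ^ 2 * x w 2) _ v := hd
  rw [hd'.fderiv]
  intro h0
  -- The partial derivative with respect to `x₂` is `-x₁ ^ 2`, which is nonzero off the double line.
  obtain ⟨u, hu⟩ := hs (Pi.single 2 1)
  have := ContinuousLinearMap.ext_iff.1 h0 u
  simp [hu] at this
  exact h1 this

end OrdinarySingularities

/-! ### Immersed points on singular rulings, torsal lines and the rank -/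

section Main

variable {d₁ d₂ : ℕ}

/-- If the projection of the scroll to a good surface is singular at a point of a ruling, then some
point of this ruling is mapped to a smooth point of the surface. -/
theorem exists_immersed_point (hd₁ : 1 ≤ d₁) (hd₂ : 1 ≤ d₂)
    {L : (ScrollIndex d₁ d₂ → ℂ) →L[ℂ] (Fin 4 → ℂ)}
    (hL : ∀ p : ℂ × ℂ, p ≠ 0 → ∀ y, L (scrollMap d₁ d₂ p y) = 0 → y = 0)
    (hbir : IsBirationalOn (L : (ScrollIndex d₁ d₂ → ℂ) →ₗ[ℂ] (Fin 4 → ℂ)) (scroll d₁ d₂))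
    (hgood : IsGood
      (projImage (L : (ScrollIndex d₁ d₂ → ℂ) →ₗ[ℂ] (Fin 4 → ℂ)) (scroll d₁ d₂)))
    {p r : ℂ × ℂ} (hpr : p.1 * r.2 ≠ p.2 * r.1) {y : ℂ × ℂ} (hy : y ≠ 0)
    (hsing : deriv (ruledFamily L p r) 0 y ∈
      LinearMap.range (ruledFamily L p r 0 : (ℂ × ℂ) →ₗ[ℂ] (Fin 4 → ℂ))) :
    ∃ y' : ℂ × ℂ, y' ≠ 0 ∧ deriv (ruledFamily L p r) 0 y' ∉
        LinearMap.range (ruledFamily L p r 0 : (ℂ × ℂ) →ₗ[ℂ] (Fin 4 → ℂ)) ∧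
      ∀ q : ℂ × ℂ, q ≠ 0 → ∀ z, L (scrollMap d₁ d₂ q z) = L (scrollMap d₁ d₂ p y') →
        p.1 * q.2 = p.2 * q.1 := by
  set S := projImage (L : (ScrollIndex d₁ d₂ → ℂ) →ₗ[ℂ] (Fin 4 → ℂ)) (scroll d₁ d₂) with hS
  have hp : p ≠ 0 := by rintro rfl; simp at hpr
  have hv : L (scrollMap d₁ d₂ p y) ≠ 0 := fun h => hy (hL p hp y h)
  have h0 : ∀ z, ruledFamily L p r 0 z = L (scrollMap d₁ d₂ p z) := fun z => by
    rw [ruledFamily_zero]; rfl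
  have hmem : Projectivization.mk ℂ _ hv ∈ S := by
    obtain ⟨_, h⟩ := (mem_cone_projImage_iff hd₁ hd₂
      (L := (L : (ScrollIndex d₁ d₂ → ℂ) →ₗ[ℂ] (Fin 4 → ℂ))) hv).2 ⟨p, hp, y, rfl⟩
    exact h
  have hcont := (AnalyticAt.clm_apply_joint (analyticAt_ruledFamily L p r 0) y).continuousAt
  have hvm : L (scrollMap d₁ d₂ p y) ∈ (Projectivization.mk ℂ _ hv).submodule := by
    rw [Projectivization.submodule_mk]; exact Submodule.mem_span_singleton_self _
  -- the equation of the surface near the given point, pulled back to the parameter space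
  have heqn : ∀ f : (Fin 3 → ℂ) → ℂ, HasLocalEquation S (Projectivization.mk ℂ _ hv) f →
      ∃ x : (Fin 4 → ℂ) → (Fin 3 → ℂ), AnalyticAt ℂ x (L (scrollMap d₁ d₂ p y)) ∧
        x (L (scrollMap d₁ d₂ p y)) = 0 ∧
        LinearMap.ker (fderiv ℂ x (L (scrollMap d₁ d₂ p y)) :
          (Fin 4 → ℂ) →ₗ[ℂ] (Fin 3 → ℂ)) = ℂ ∙ L (scrollMap d₁ d₂ p y) ∧
        (∀ (c : ℂ) (w : Fin 4 → ℂ), c ≠ 0 → x (c • w) = x w) ∧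
        (∀ᶠ w in 𝓝 (L (scrollMap d₁ d₂ p y)),
          (∃ q : ℂ × ℂ, q ≠ 0 ∧ ∃ z, L (scrollMap d₁ d₂ q z) = w) → f (x w) = 0) ∧
        ∀ᶠ z : (ℂ × ℂ) × ℂ in 𝓝 (y, 0), f (x (ruledFamily L p r z.2 z.1)) = 0 := by
    rintro f ⟨x, ⟨hhom, hx⟩, hf⟩
    obtain ⟨hxan, hx0, hker⟩ := hx _ hvm hv
    rw [Projectivization.submodule_mk] at hker
    have hw : ∀ᶠ w in 𝓝 (L (scrollMap d₁ d₂ p y)),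
        (∃ q : ℂ × ℂ, q ≠ 0 ∧ ∃ z, L (scrollMap d₁ d₂ q z) = w) → f (x w) = 0 := by
      filter_upwards [hf _ hvm hv, continuousAt_id.eventually_ne hv] with w h1 h2 h3
      exact h1.1 ((mem_cone_projImage_iff hd₁ hd₂ h2).2 h3)
    refine ⟨x, hxan, hx0, hker, hhom, hw, ?_⟩
    have h1 : ∀ᶠ z : (ℂ × ℂ) × ℂ in 𝓝 (y, 0),
        (∃ q : ℂ × ℂ, q ≠ 0 ∧ ∃ z', L (scrollMap d₁ d₂ q z') = ruledFamily L p r z.2 z.1) →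
          f (x (ruledFamily L p r z.2 z.1)) = 0 := by
      refine hcont.eventually (p := fun w =>
        (∃ q : ℂ × ℂ, q ≠ 0 ∧ ∃ z', L (scrollMap d₁ d₂ q z') = w) → f (x w) = 0) ?_
      simpa only [h0] using hw
    filter_upwards [h1] with z hz using hz ⟨_, add_smul_ne_zero hpr z.2, z.1, rfl⟩
  -- A coordinate vanishing on the image germ would put it into a smooth hypersurface, where the
  -- parametrization has to be an immersion, against `hsing`.
  have hbranch : ∀ x : (Fin 4 → ℂ) → (Fin 3 → ℂ), AnalyticAt ℂ x (L (scrollMap d₁ d₂ p y)) →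
      LinearMap.ker (fderiv ℂ x (L (scrollMap d₁ d₂ p y)) :
          (Fin 4 → ℂ) →ₗ[ℂ] (Fin 3 → ℂ)) = ℂ ∙ L (scrollMap d₁ d₂ p y) →
      ∀ i, ¬ ∀ᶠ z : (ℂ × ℂ) × ℂ in 𝓝 (y, 0), x (ruledFamily L p r z.2 z.1) i = 0 := by
    intro x hx hker i hz
    refine immersion_of_smooth hd₁ hd₂ hL hbir hpr hy (h := fun w => x w i) ?_ ?_ hz hsing
    · rw [h0]; exact analyticAt_coord hx i
    · rw [h0]; exact fderiv_coord_ne_zero hx (surjective_fderiv_of_ker_eq hv hker) i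
  have hgan : ∀ x : (Fin 4 → ℂ) → (Fin 3 → ℂ), AnalyticAt ℂ x (L (scrollMap d₁ d₂ p y)) →
      ∀ i, AnalyticAt ℂ (fun z : (ℂ × ℂ) × ℂ => x (ruledFamily L p r z.2 z.1) i) (y, 0) := by
    intro x hx i
    refine AnalyticAt.fun_comp (g := fun w => x w i)
      (f := fun z : (ℂ × ℂ) × ℂ => ruledFamily L p r z.2 z.1) ?_
      (AnalyticAt.clm_apply_joint (analyticAt_ruledFamily L p r 0) y)
    simp only [h0]; exact analyticAt_coord hx i
  -- In the first three cases the pulled-back equation is a product of coordinates; one factor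
  -- vanishes identically, which `hbranch` excludes. Only the pinch point survives.
  rcases hgood.ordinary _ hmem with h | h | h | h
  · obtain ⟨x, hx, -, hker, -, -, hz⟩ := heqn _ h
    exact absurd hz (hbranch x hx hker 0)
  · obtain ⟨x, hx, -, hker, -, -, hz⟩ := heqn _ h
    rcases eventually_zero_or_of_mul (hgan x hx 0) (hgan x hx 1) hz with h1 | h1
    · exact absurd h1 (hbranch x hx hker 0)
    · exact absurd h1 (hbranch x hx hker 1)
  · obtain ⟨x, hx, -, hker, -, -, hz⟩ := heqn _ h
    rcases eventually_zero_or_of_mul ((hgan x hx 0).mul (hgan x hx 1)) (hgan x hx 2) hz with h1 | h1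
    · rcases eventually_zero_or_of_mul (hgan x hx 0) (hgan x hx 1) h1 with h2 | h2
      · exact absurd h2 (hbranch x hx hker 0)
      · exact absurd h2 (hbranch x hx hker 1)
    · exact absurd h1 (hbranch x hx hker 2)
  · obtain ⟨x, hx, hx0, hker, hhom, hw, hz⟩ := heqn _ h
    have hlin : ContinuousAt (fun y' : ℂ × ℂ => L (scrollMap d₁ d₂ p y')) y := by fun_prop
    -- What has to persist at a nearby point `y'` of the ruling: `x` is still an analytic
    -- submersion, and the pinch equation still holds on the surface.
    have hN := ((hlin.eventually hx.eventually_analyticAt).and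
      ((hlin.eventually (eventually_surjective_fderiv hx (surjective_fderiv_of_ker_eq hv hker))).and
      ((hlin.eventually hw.eventually_nhds).and (continuousAt_id.eventually_ne hy))))
    obtain ⟨y', ⟨hxan, hxs, hxw, hy'⟩, hx1⟩ := exists_ne_zero_of_pinch
      (analyticAt_ruledFamily L p r 0) (ruledFamily_injective hL hpr 0) hy (x := x)
      (by rwa [h0]) (by rwa [h0]) (by rwa [h0]) hhom
      (hz.mono fun z hz => sub_eq_zero.1 hz)
      (not_eventually_mem_range hd₁ hd₂ hL hpr (by rwa [h0])) hN
    rw [h0] at hx1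
    have hy'0 : y' ≠ 0 := hy'
    have hv' : L (scrollMap d₁ d₂ p y') ≠ 0 := fun h => hy'0 (hL p hp y' h)
    have hhan : AnalyticAt ℂ (fun w => x w 0 ^ 2 - x w 1 ^ 2 * x w 2)
        (L (scrollMap d₁ d₂ p y')) :=
      ((analyticAt_coord hxan 0).pow 2).sub
        (((analyticAt_coord hxan 1).pow 2).mul (analyticAt_coord hxan 2))
    have hhd := fderiv_pinch_ne_zero hxan hxs hx1
    refine ⟨y', hy'0, ?_, fun q hq z hqz => ?_⟩
    · refine immersion_of_smooth hd₁ hd₂ hL hbir hpr hy'0 (by rw [h0]; exact hhan)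
        (by rw [h0]; exact hhd) ?_
      have hcont' := (AnalyticAt.clm_apply_joint (analyticAt_ruledFamily L p r 0) y').continuousAt
      have h1 : ∀ᶠ z : (ℂ × ℂ) × ℂ in 𝓝 (y', 0),
          (∃ q : ℂ × ℂ, q ≠ 0 ∧ ∃ z', L (scrollMap d₁ d₂ q z') = ruledFamily L p r z.2 z.1) →
            x (ruledFamily L p r z.2 z.1) 0 ^ 2 - x (ruledFamily L p r z.2 z.1) 1 ^ 2 *
              x (ruledFamily L p r z.2 z.1) 2 = 0 := by
        refine hcont'.eventually (p := fun w =>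
          (∃ q : ℂ × ℂ, q ≠ 0 ∧ ∃ z', L (scrollMap d₁ d₂ q z') = w) →
            x w 0 ^ 2 - x w 1 ^ 2 * x w 2 = 0) ?_
        simpa only [h0] using hxw
      filter_upwards [h1] with z hz using hz ⟨_, add_smul_ne_zero hpr z.2, z.1, rfl⟩
    · refine eq_of_smooth hd₁ hd₂ hL hbir hy'0 ?_ hqz hhan hhd hxw
      rintro rfl
      rw [map_zero, map_zero] at hqz
      exact hv' hqz.symm

/-- The columns are the values, at the standard basis of `ℂ²`, of the two maps whose ranges generate
`rulingSpan`. Matching `t + τ` with `p + τ • r` treats finite parameters and `∞` alike. -/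
theorem derivMatrix_rank {n : ℕ} {L : (ScrollIndex d₁ d₂ → ℂ) →L[ℂ] (Fin n → ℂ)} {p r : ℂ × ℂ}
    {Q₁ Q₂ : Fin n → ℂ[X]} {t : ℂ}
    (h₁ : ∀ i τ, (Q₁ i).eval (t + τ) = L (scrollMap d₁ d₂ (p + τ • r) (0, 1)) i)
    (h₂ : ∀ i τ, (Q₂ i).eval (t + τ) = L (scrollMap d₁ d₂ (p + τ • r) (1, 0)) i) :
    (derivMatrix Q₁ Q₂ t).rank = Module.finrank ℂ (rulingSpan L p r) := by
  have hval : ∀ (Q : Fin n → ℂ[X]) (z : ℂ × ℂ),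
      (∀ i τ, (Q i).eval (t + τ) = L (scrollMap d₁ d₂ (p + τ • r) z) i) →
      (fun i => (Q i).eval t) = L (scrollMap d₁ d₂ p z) ∧
      (fun i => (Polynomial.derivative (Q i)).eval t) = L (scrollDeriv d₁ d₂ p r z) := by
    intro Q z h
    constructor
    · ext i
      have := h i 0
      simpa using this
    · ext i
      have h1 : HasDerivAt (fun τ : ℂ => (Q i).eval (t + τ))
          ((Polynomial.derivative (Q i)).eval t) 0 := by
        have h2 := (Q i).hasDerivAt (t + 0)
        rw [add_zero] at h2
        have h3 : HasDerivAt (fun τ : ℂ => t + τ) 1 0 := (hasDerivAt_id (0 : ℂ)).const_add t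
        have h4 : HasDerivAt (fun x => (Q i).eval x) ((Polynomial.derivative (Q i)).eval t)
          ((fun τ : ℂ => t + τ) 0) := by simpa using h2
        have h5 := h4.comp (0 : ℂ) h3
        rwa [mul_one] at h5
      have h6 : HasDerivAt (fun τ : ℂ => L (scrollMap d₁ d₂ (p + τ • r) z) i)
          (L (scrollDeriv d₁ d₂ p r z) i) 0 := by
        have h7 := (analyticAt_scrollMap (d₁ := d₁) (d₂ := d₂) p r 0).differentiableAt.hasDerivAt
        have h8 := h7.clm_apply (hasDerivAt_const (0 : ℂ) z)
        rw [map_zero, add_zero] at h8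
        exact hasDerivAt_pi.1 (L.hasFDerivAt.comp_hasDerivAt (0 : ℂ) h8) i
      exact h1.unique (h6.congr_of_eventuallyEq (Eq.eventuallyEq (funext fun τ => h i τ)))
  obtain ⟨a₁, b₁⟩ := hval Q₁ _ h₁
  obtain ⟨a₂, b₂⟩ := hval Q₂ _ h₂
  rw [Matrix.rank_eq_finrank_span_cols]
  have hrange : ∀ f : (ℂ × ℂ) →L[ℂ] (Fin n → ℂ), ∀ c : ℂ × ℂ,
      f c = c.1 • f (1, 0) + c.2 • f (0, 1) := by
    intro f c
    rw [← map_smul, ← map_smul, ← map_add]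
    congr 1
    ext <;> simp
  have hcols : Set.range (derivMatrix Q₁ Q₂ t).col =
      {L (scrollMap d₁ d₂ p (0, 1)), L (scrollMap d₁ d₂ p (1, 0)),
        L (scrollDeriv d₁ d₂ p r (0, 1)), L (scrollDeriv d₁ d₂ p r (1, 0))} := by
    rw [← a₁, ← a₂, ← b₁, ← b₂]
    ext w
    simp only [Set.mem_range, Set.mem_insert_iff, Set.mem_singleton_iff]
    constructor
    · rintro ⟨j, rfl⟩
      fin_cases j
      exacts [Or.inl rfl, Or.inr (Or.inl rfl), Or.inr (Or.inr (Or.inl rfl)),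
        Or.inr (Or.inr (Or.inr rfl))]
    · rintro (rfl | rfl | rfl | rfl)
      exacts [⟨0, rfl⟩, ⟨1, rfl⟩, ⟨2, rfl⟩, ⟨3, rfl⟩]
  rw [hcols]
  suffices h : Submodule.span ℂ {L (scrollMap d₁ d₂ p (0, 1)), L (scrollMap d₁ d₂ p (1, 0)),
      L (scrollDeriv d₁ d₂ p r (0, 1)), L (scrollDeriv d₁ d₂ p r (1, 0))} = rulingSpan L p r by
    rw [h]
  apply le_antisymm
  · rw [Submodule.span_le]
    rintro w (rfl | rfl | rfl | rfl)
    · exact Submodule.mem_sup_left ⟨_, rfl⟩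
    · exact Submodule.mem_sup_left ⟨_, rfl⟩
    · exact Submodule.mem_sup_right ⟨_, rfl⟩
    · exact Submodule.mem_sup_right ⟨_, rfl⟩
  · refine sup_le ?_ ?_
    · rintro _ ⟨c, rfl⟩
      rw [ContinuousLinearMap.coe_coe, hrange]
      exact Submodule.add_mem _ (Submodule.smul_mem _ _ (Submodule.subset_span (by simp)))
        (Submodule.smul_mem _ _ (Submodule.subset_span (by simp)))
    · rintro _ ⟨c, rfl⟩
      rw [ContinuousLinearMap.coe_coe, hrange]
      exact Submodule.add_mem _ (Submodule.smul_mem _ _ (Submodule.subset_span (by simp)))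
        (Submodule.smul_mem _ _ (Submodule.subset_span (by simp)))

/-- The image of the ruling through a point where the projection is singular is a torsal line,
and the tangent directions along this ruling span a three-dimensional space. -/
theorem isTorsalLine_of_singular (hd₁ : 1 ≤ d₁) (hd₂ : 1 ≤ d₂)
    (A : (ScrollIndex d₁ d₂ → ℂ) →ₗ[ℂ] (Fin 5 → ℂ)) (B : (Fin 5 → ℂ) →ₗ[ℂ] (Fin 4 → ℂ))
    (hreg : IsRegularOn (B ∘ₗ A) (scroll d₁ d₂))
    (hbir : IsBirationalOn (B ∘ₗ A) (scroll d₁ d₂))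
    (hgood : IsGood (projImage (B ∘ₗ A) (scroll d₁ d₂)))
    {P : ℙ ℂ (ScrollIndex d₁ d₂ → ℂ)} (hsing : IsSingularAt A (scroll d₁ d₂) P)
    {p r : ℂ × ℂ} (hpr : p.1 * r.2 ≠ p.2 * r.1)
    (hP : P.submodule ≤
      LinearMap.range (scrollMap d₁ d₂ p : (ℂ × ℂ) →ₗ[ℂ] (ScrollIndex d₁ d₂ → ℂ))) :
    IsTorsalLine (projImage A (scroll d₁ d₂))
      (LinearMap.range (LinearMap.toContinuousLinearMap A ∘L scrollMap d₁ d₂ p :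
        (ℂ × ℂ) →ₗ[ℂ] (Fin 5 → ℂ))) ∧
    Module.finrank ℂ (rulingSpan (LinearMap.toContinuousLinearMap A) p r) = 3 := by
  set A' := LinearMap.toContinuousLinearMap A with hA'
  set L := LinearMap.toContinuousLinearMap (B ∘ₗ A) with hLdef
  have hLA : ∀ w, L w = B (A' w) := fun w => rfl
  have hp : p ≠ 0 := by rintro rfl; simp at hpr
  have hL : ∀ p : ℂ × ℂ, p ≠ 0 → ∀ y, L (scrollMap d₁ d₂ p y) = 0 → y = 0 := by
    intro q hq y hy
    by_contra hy0
    have hne : scrollMap d₁ d₂ q y ≠ 0 := fun h =>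
      hy0 (scrollMap_injective hq (h.trans (map_zero _).symm))
    refine hne (hreg _ ((mk_mem_scroll_iff hd₁ hd₂ hne).2 ⟨q, hq, y, rfl⟩) _ ?_ hy)
    rw [Projectivization.submodule_mk]
    exact Submodule.mem_span_singleton_self _
  have hA : ∀ p : ℂ × ℂ, p ≠ 0 → ∀ y, A' (scrollMap d₁ d₂ p y) = 0 → y = 0 := fun q hq y hy =>
    hL q hq y (by rw [hLA, hy, map_zero])
  obtain ⟨y, hy, -, z, hz⟩ := exists_eq_of_isSingularAt (L := A') hd₁ hd₂ hA hsing hpr hP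
  -- Singularity descends from `A` to `L = B ∘ A`; immersion and uniqueness of the ruling at `y'`
  -- then lift back from `L` to `A`.
  obtain ⟨y', hy', himm, huniq⟩ := exists_immersed_point (L := L) hd₁ hd₂ hL hbir hgood hpr hy
    ⟨z, by
      rw [ruledFamily_zero, deriv_ruledFamily]
      show L (scrollMap d₁ d₂ p z) = L (scrollDeriv d₁ d₂ p r y)
      rw [hLA, hLA, hz]⟩
  have himmA : deriv (ruledFamily A' p r) 0 y' ∉
      LinearMap.range (ruledFamily A' p r 0 : (ℂ × ℂ) →ₗ[ℂ] (Fin 5 → ℂ)) := by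
    rintro ⟨u, hu⟩
    rw [ruledFamily_zero, deriv_ruledFamily] at hu
    have hu' : A' (scrollMap d₁ d₂ p u) = A' (scrollDeriv d₁ d₂ p r y') := hu
    refine himm ⟨u, ?_⟩
    rw [ruledFamily_zero, deriv_ruledFamily]
    show L (scrollMap d₁ d₂ p u) = L (scrollDeriv d₁ d₂ p r y')
    rw [hLA, hLA, hu']
  have huniqA : ∀ q : ℂ × ℂ, q ≠ 0 → ∀ z, A' (scrollMap d₁ d₂ q z) = A' (scrollMap d₁ d₂ p y') →
      p.1 * q.2 = p.2 * q.1 := fun q hq z hqz =>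
    huniq q hq z (by rw [hLA, hLA, hqz])
  -- Modulo the ruling the transversal derivative kills `y`, so its value at `y'` is the only new
  -- direction.
  have hspan : tangentSpan A' p r y' = rulingSpan A' p r := by
    refine le_antisymm (tangentSpan_le_rulingSpan A' p r y') (sup_le ?_ ?_)
    · rintro _ ⟨u, rfl⟩
      exact mem_tangentSpan.2 ⟨u, 0, by simp⟩
    · rintro _ ⟨c, rfl⟩
      -- `y` and `y'` form a basis
      have hdet : y.1 * y'.2 - y.2 * y'.1 ≠ 0 := by
        intro hdet
        have hprop : ∃ a : ℂ, y' = a • y := by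
          by_cases h1 : y.1 = 0
          · have h2 : y.2 ≠ 0 := fun h2 => hy (Prod.ext h1 h2)
            refine ⟨y'.2 / y.2, ?_⟩
            have h3 : y'.1 = 0 := by
              rw [h1, zero_mul, zero_sub, neg_eq_zero] at hdet
              exact (mul_eq_zero.1 hdet).resolve_left h2
            ext
            · simp [h1, h3]
            · simp [h2]
          · refine ⟨y'.1 / y.1, ?_⟩
            ext
            · simp [h1]
            · simp only [Prod.smul_snd, smul_eq_mul]
              rw [div_mul_eq_mul_div, eq_div_iff h1]
              linear_combination hdet
        obtain ⟨a, rfl⟩ := hprop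
        refine himmA ⟨a • z, ?_⟩
        rw [ruledFamily_zero, deriv_ruledFamily]
        show A' (scrollMap d₁ d₂ p (a • z)) = A' (scrollDeriv d₁ d₂ p r (a • y))
        rw [map_smul, map_smul, map_smul, map_smul, hz]
      have hc : c = ((c.1 * y'.2 - c.2 * y'.1) / (y.1 * y'.2 - y.2 * y'.1)) • y +
          ((y.1 * c.2 - y.2 * c.1) / (y.1 * y'.2 - y.2 * y'.1)) • y' := by
        ext
        · simp only [Prod.fst_add, Prod.smul_fst, smul_eq_mul]
          rw [div_mul_eq_mul_div, div_mul_eq_mul_div, ← add_div, eq_div_iff hdet]; ring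
        · simp only [Prod.snd_add, Prod.smul_snd, smul_eq_mul]
          rw [div_mul_eq_mul_div, div_mul_eq_mul_div, ← add_div, eq_div_iff hdet]; ring
      refine mem_tangentSpan.2
        ⟨((c.1 * y'.2 - c.2 * y'.1) / (y.1 * y'.2 - y.2 * y'.1)) • z,
          (y.1 * c.2 - y.2 * c.1) / (y.1 * y'.2 - y.2 * y'.1), ?_⟩
      show _ = A' (scrollDeriv d₁ d₂ p r c)
      conv_rhs => rw [hc]
      rw [map_smul, map_smul, hz, map_add, map_add, map_smul, map_smul, map_smul, map_smul]
  have hdim : Module.finrank ℂ (rulingSpan A' p r) = 3 := by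
    rw [← hspan]; exact finrank_tangentSpan hA hpr himmA
  have hinj : Function.Injective
      ((A' ∘L scrollMap d₁ d₂ p : (ℂ × ℂ) →L[ℂ] (Fin 5 → ℂ)) : (ℂ × ℂ) →ₗ[ℂ] (Fin 5 → ℂ)) :=
    (injective_iff_map_eq_zero _).2 fun u hu => hA p hp u hu
  have hv : A' (scrollMap d₁ d₂ p y') ≠ 0 := fun h => hy' (hA p hp y' h)
  refine ⟨⟨?_, ?_, rulingSpan A' p r, ⟨Projectivization.mk ℂ _ hv, ?_, ?_⟩, ?_⟩, hdim⟩
  · rw [LinearMap.finrank_range_of_inj hinj]; simp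
  · intro q hq
    have h1 : q.rep ∈ q.submodule := by
      rw [q.submodule_eq]; exact Submodule.mem_span_singleton_self _
    obtain ⟨u, hu⟩ := hq h1
    obtain ⟨_, h2⟩ := (mem_cone_projImage_iff hd₁ hd₂ (L := A) q.rep_nonzero).2 ⟨p, hp, u, hu⟩
    rwa [q.mk_rep] at h2
  · rw [Projectivization.submodule_mk, Submodule.span_singleton_le_iff_mem]
    exact ⟨y', rfl⟩
  · rw [← hspan]
    exact hasTangentPlane_projImage hd₁ hd₂ hA hpr huniqA himmA hv
  · intro q W hq hW
    exact eq_rulingSpan_of_hasTangentPlane hd₁ hd₂ hA hpr hdim hq hW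

/-! ### Rulings and coefficient polynomials in coordinates -/

theorem ruling_eq_range {t : OnePoint ℂ} {p : ℂ × ℂ}
    (h : ruling d₁ d₂ t = Submodule.span ℂ {directrixLeft d₁ d₂ p, directrixRight d₁ d₂ p}) :
    ruling d₁ d₂ t =
      LinearMap.range (scrollMap d₁ d₂ p : (ℂ × ℂ) →ₗ[ℂ] (ScrollIndex d₁ d₂ → ℂ)) := by
  rw [h]
  ext w
  rw [Submodule.mem_span_pair]
  constructor
  · rintro ⟨a, b, rfl⟩; exact ⟨(a, b), rfl⟩
  · rintro ⟨y, rfl⟩; exact ⟨y.1, y.2, rfl⟩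

theorem ruling_coe (t : ℂ) : ruling d₁ d₂ (t : OnePoint ℂ) =
    Submodule.span ℂ {directrixLeft d₁ d₂ (1, t), directrixRight d₁ d₂ (1, t)} := by
  show Submodule.span ℂ _ = _
  congr 2
  · ext i; rcases i with j | j <;> simp [directrixLeft]
  · congr 1; ext i; rcases i with j | j <;> simp [directrixRight]

theorem ruling_infty : ruling d₁ d₂ (∞ : OnePoint ℂ) =
    Submodule.span ℂ {directrixLeft d₁ d₂ (0, 1), directrixRight d₁ d₂ (0, 1)} := by
  show Submodule.span ℂ _ = _
  congr 2
  · ext i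
    rcases i with j | j
    · rcases Fin.eq_castSucc_or_eq_last j with ⟨k, rfl⟩ | rfl
      · have : d₂ - (k : ℕ) ≠ 0 := by omega
        simp [directrixLeft, this, Fin.castSucc_ne_last]
      · simp [directrixLeft]
    · simp [directrixLeft]
  · congr 1
    ext i
    rcases i with j | j
    · simp [directrixRight]
    · rcases Fin.eq_castSucc_or_eq_last j with ⟨k, rfl⟩ | rfl
      · have : d₁ - (k : ℕ) ≠ 0 := by omega
        simp [directrixRight, this, Fin.castSucc_ne_last]
      · simp [directrixRight]

theorem map_directrixRight {n : ℕ} (L : (ScrollIndex d₁ d₂ → ℂ) →ₗ[ℂ] (Fin n → ℂ)) (p : ℂ × ℂ)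
    (i : Fin n) : L (scrollMap d₁ d₂ p (0, 1)) i =
      ∑ j : Fin (d₁ + 1), L (Pi.single (Sum.inr j) 1) i * (p.1 ^ (d₁ - (j : ℕ)) * p.2 ^ (j : ℕ)) := by
  have h : scrollMap d₁ d₂ p (0, 1) = ∑ j : Fin (d₁ + 1),
      (p.1 ^ (d₁ - (j : ℕ)) * p.2 ^ (j : ℕ)) • (Pi.single (Sum.inr j) 1 : ScrollIndex d₁ d₂ → ℂ) := by
    ext k
    rcases k with k | k
    · simp [scrollMap_inl]
    · simp [scrollMap_inr, Pi.single_apply]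
  rw [h, map_sum, Finset.sum_apply]
  exact Finset.sum_congr rfl fun j _ => by rw [map_smul, Pi.smul_apply, smul_eq_mul, mul_comm]

theorem map_directrixLeft {n : ℕ} (L : (ScrollIndex d₁ d₂ → ℂ) →ₗ[ℂ] (Fin n → ℂ)) (p : ℂ × ℂ)
    (i : Fin n) : L (scrollMap d₁ d₂ p (1, 0)) i =
      ∑ j : Fin (d₂ + 1), L (Pi.single (Sum.inl j) 1) i * (p.1 ^ (d₂ - (j : ℕ)) * p.2 ^ (j : ℕ)) := by
  have h : scrollMap d₁ d₂ p (1, 0) = ∑ j : Fin (d₂ + 1),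
      (p.1 ^ (d₂ - (j : ℕ)) * p.2 ^ (j : ℕ)) • (Pi.single (Sum.inl j) 1 : ScrollIndex d₁ d₂ → ℂ) := by
    ext k
    rcases k with k | k
    · simp [scrollMap_inl, Pi.single_apply]
    · simp [scrollMap_inr]
  rw [h, map_sum, Finset.sum_apply]
  exact Finset.sum_congr rfl fun j _ => by rw [map_smul, Pi.smul_apply, smul_eq_mul, mul_comm]

theorem reflect_sum {d : ℕ} (a : Fin (d + 1) → ℂ) :
    (∑ j : Fin (d + 1), Polynomial.C (a j) * Polynomial.X ^ (j : ℕ) : ℂ[X]).reflect d =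
      ∑ j : Fin (d + 1), Polynomial.C (a j) * Polynomial.X ^ (d - (j : ℕ)) := by
  have h : ∀ s : Finset (Fin (d + 1)),
      (∑ j ∈ s, Polynomial.C (a j) * Polynomial.X ^ (j : ℕ) : ℂ[X]).reflect d =
        ∑ j ∈ s, Polynomial.C (a j) * Polynomial.X ^ (d - (j : ℕ)) := by
    intro s
    induction s using Finset.induction_on with
    | empty => simp
    | insert j s hj ih =>
      rw [Finset.sum_insert hj, Finset.sum_insert hj, Polynomial.reflect_add, ih,
        Polynomial.reflect_C_mul_X_pow, Polynomial.revAt_le (by omega)]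
  exact h _

end Main

end RuledSurface

theorem mainTheorem9 (d₁ d₂ : ℕ) (hd₁ : 1 ≤ d₁) (hd₂ : 1 ≤ d₂)
    (A : (RuledSurface.ScrollIndex d₁ d₂ → ℂ) →ₗ[ℂ] (Fin 5 → ℂ))
    (B : (Fin 5 → ℂ) →ₗ[ℂ] (Fin 4 → ℂ))
    (hreg : RuledSurface.IsRegularOn (B ∘ₗ A) (RuledSurface.scroll d₁ d₂))
    (hbir : RuledSurface.IsBirationalOn (B ∘ₗ A) (RuledSurface.scroll d₁ d₂))
    (hgood : RuledSurface.IsGood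
      (RuledSurface.projImage (B ∘ₗ A) (RuledSurface.scroll d₁ d₂)))
    (P' : ℙ ℂ (RuledSurface.ScrollIndex d₁ d₂ → ℂ))
    (hP' : P' ∈ RuledSurface.scroll d₁ d₂)
    (hsing : RuledSurface.IsSingularAt A (RuledSurface.scroll d₁ d₂) P') :
    ∃ t : OnePoint ℂ,
      P'.submodule ≤ RuledSurface.ruling d₁ d₂ t ∧
      P'.submodule.map A ≤ (RuledSurface.ruling d₁ d₂ t).map A ∧
      RuledSurface.IsTorsalLine (RuledSurface.projImage A (RuledSurface.scroll d₁ d₂))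
        ((RuledSurface.ruling d₁ d₂ t).map A) ∧
      (RuledSurface.rulingMatrix A t).rank = 3 := by
  obtain ⟨p, hp, y, hy⟩ : ∃ p : ℂ × ℂ, p ≠ 0 ∧ ∃ y, RuledSurface.scrollMap d₁ d₂ p y = P'.rep := by
    rw [← RuledSurface.mk_mem_scroll_iff hd₁ hd₂ P'.rep_nonzero, P'.mk_rep]
    exact hP'
  suffices h : ∃ (t : OnePoint ℂ) (p r : ℂ × ℂ), p.1 * r.2 ≠ p.2 * r.1 ∧
      (∃ y, RuledSurface.scrollMap d₁ d₂ p y = P'.rep) ∧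
      RuledSurface.ruling d₁ d₂ t = Submodule.span ℂ
        {RuledSurface.directrixLeft d₁ d₂ p, RuledSurface.directrixRight d₁ d₂ p} ∧
      (RuledSurface.rulingMatrix A t).rank = Module.finrank ℂ
        (RuledSurface.rulingSpan (LinearMap.toContinuousLinearMap A) p r) by
    obtain ⟨t, p, r, hpr, ⟨y, hy⟩, hruling, hrank⟩ := h
    have hrange := RuledSurface.ruling_eq_range hruling
    have hle : P'.submodule ≤ RuledSurface.ruling d₁ d₂ t := by
      rw [hrange, P'.submodule_eq, Submodule.span_singleton_le_iff_mem]
      exact ⟨y, hy⟩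
    obtain ⟨htorsal, hdim⟩ := RuledSurface.isTorsalLine_of_singular hd₁ hd₂ A B hreg hbir hgood
      hsing hpr (by rwa [hrange] at hle)
    refine ⟨t, hle, Submodule.map_mono hle, ?_, hrank.trans hdim⟩
    have hmap : (RuledSurface.ruling d₁ d₂ t).map A =
        LinearMap.range (LinearMap.toContinuousLinearMap A ∘L RuledSurface.scrollMap d₁ d₂ p :
          (ℂ × ℂ) →ₗ[ℂ] (Fin 5 → ℂ)) := by
      rw [hrange]
      exact (LinearMap.range_comp _ _).symm
    rw [hmap]
    exact htorsal
  by_cases h1 : p.1 = 0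
  · have h2 : p.2 ≠ 0 := fun h2 => hp (Prod.ext h1 h2)
    -- At infinity the family `(0, 1) + τ • (1, 0) = (τ, 1)` has the local parameter `u = τ`, and
    -- evaluating the directrices there yields the reflected polynomials.
    refine ⟨OnePoint.infty, (0, 1), (1, 0), by simp, ?_, RuledSurface.ruling_infty, ?_⟩
    · have h3 : p = p.2 • ((0, 1) : ℂ × ℂ) := by ext <;> simp [h1]
      rw [h3, RuledSurface.scrollMap_smul] at hy
      exact ⟨_, hy⟩
    · refine RuledSurface.derivMatrix_rank (fun i τ => ?_) fun i τ => ?_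
      · refine Eq.trans ?_ (RuledSurface.map_directrixRight A _ i).symm
        rw [RuledSurface.polyQ₁, RuledSurface.reflect_sum, Polynomial.eval_finsetSum]
        simp
      · refine Eq.trans ?_ (RuledSurface.map_directrixLeft A _ i).symm
        rw [RuledSurface.polyQ₂, RuledSurface.reflect_sum, Polynomial.eval_finsetSum]
        simp
  -- Here `(1, t) + τ • (0, 1) = (1, t + τ)`, so that moving along the family is moving the affine
  -- parameter.
  · refine ⟨((p.2 / p.1 : ℂ) : OnePoint ℂ), (1, p.2 / p.1), (0, 1), by simp, ?_,
      RuledSurface.ruling_coe _, ?_⟩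
    · have h3 : p = p.1 • ((1, p.2 / p.1) : ℂ × ℂ) := by
        ext <;> simp [mul_div_cancel₀ _ h1]
      rw [h3, RuledSurface.scrollMap_smul] at hy
      exact ⟨_, hy⟩
    · refine RuledSurface.derivMatrix_rank (fun i τ => ?_) fun i τ => ?_
      · refine Eq.trans ?_ (RuledSurface.map_directrixRight A _ i).symm
        rw [RuledSurface.polyQ₁, Polynomial.eval_finsetSum]
        simp
      · refine Eq.trans ?_ (RuledSurface.map_directrixLeft A _ i).symm
        rw [RuledSurface.polyQ₂, Polynomial.eval_finsetSum]
        simp
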